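/- **Setting.** Let $M\ge 1$ nodes $i=1,\dots,M$ hold local functions $f_i:\mathbb R^d\to\mathbb R$ and let $f=\frac1M\sum_{i=1}^M f_i$. Assume that every $f_i$ is convex and differentiable with $L$-Lipschitz gradient, and that $f$ is $\mu$-strongly convex with $\mu>0$ (in particular this holds if every $f_i$ is $L$-smooth and $\mu$-strongly convex). Let $(A_t,B_t,S_t)_{t\ge 0}$ be random triples on a probability space, independent across $t$ (for fixed $t$ the three components may be dependent), where $A_t=(a_{t,ij})$ and $B_t=(b_{t,ij})$ are random $M\times M$ matrices and $S_t\subseteq\{1,\dots,M\}$ is the set of sampled nodes. The matrices $A_t$ are identically distributed, and so are the matrices $B_t$. Almost surely, $A_t$ is row-stochastic, $B_t$ is column-stochastic, and all diagonal entries of $A_t$ and $B_t$ are at least $\delta$, for a constant $\delta>0$. The matrices $\mathbb E[A_0]$ and $\mathbb E[B_0]$ are primitive. Each node is sampled with a time-independent positive probability, $\mathbb P(i\in S_t)=p_i>0$, where $p_i$ may vary with $i$. **Algorithm (PPDS with stepsize $\eta$).** Node $i$ keeps an iterate $x_t^i$, the point $c_t^i$ at which its stored gradient was computed, and a gradient tracker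 $G_t^i$. The initial $x_0^i,c_0^i,G_0^i$ are deterministic with $\sum_i G_0^i=\sum_i\nabla f_i(c_0^i)$ (for example $G_0^i=\nabla f_i(c_0^i)$). At time $t$, if $i\in S_t$ then $$G^i_{t+1/2}=G^i_t+\nabla f_i(x^i_t)-\nabla f_i(c^i_t),\qquad x^i_{t+1/2}=x^i_t-\eta\,G^i_{t+1/2},\qquad c^i_{t+1}=x^i_t,$$ and if $i\notin S_t$ then $G^i_{t+1/2}=G^i_t$, $x^i_{t+1/2}=x^i_t$, $c^i_{t+1}=c^i_t$. Afterwards $$x^i_{t+1}=\sum_j a_{t,ij}\,x^j_{t+1/2},\qquad G^i_{t+1}=\sum_j b_{t,ij}\,G^j_{t+1/2}.$$ Write $\bar x_t=\frac1M\sum_i x_t^i$, and let $\pi_0=(\frac1M,\dots,\frac1M)^\top$, $\pi_{t+1}=B_t\pi_t$. **Theorem.** There is $\bar\eta>0$, depending only on $\mu$, $L$ and the process $(A_t,B_t,S_t)_t$, such that for every $\eta\in(0,\bar\eta]$ there are $C>0$ and $\rho\in(0,1)$, depending only on these data and on $\eta$ (not on $d$, the functions $f_i$, or the initialization), with the following property.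 The function $f$ has a unique minimizer $x^\star$, and for every run of PPDS with stepsize $\eta$ and every $t\ge 0$, each of the quantities $$\mathbb E\|\bar x_t-x^\star\|^2,\quad \mathbb E[f(\bar x_t)-f(x^\star)],\quad \mathbb E\sum_i\|x_t^i-\bar x_t\|^2,\quad \mathbb E\sum_i\Big\|G_t^i-\pi_{t,i}\sum_jG_t^j\Big\|^2,$$ $$\mathbb E\sum_i\|\nabla f_i(x_t^i)-\nabla f_i(c_t^i)\|^2,\quad \mathbb E\|x_t^i-x^\star\|^2\ \ (1\le i\le M)$$ is finite and at most $C\,\Psi_0\,\rho^t$, where $$\Psi_0=\|\bar x_0-x^\star\|^2+\sum_i\|x_0^i-\bar x_0\|^2+\sum_i\Big\|G_0^i-\tfrac1M\sum_jG_0^j\Big\|^2+\sum_i\|\nabla f_i(x_0^i)-\nabla f_i(c_0^i)\|^2 .$$ Moreover, almost surely $x_t^i\to x^\star$ as $t\to\infty$ for every node $i$. -/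

import Mathlib

open MeasureTheory ProbabilityTheory Filter Topology
open scoped NNReal

namespace PPDS

/-- Random matrices are measured entrywise. -/
instance instMeasurableSpaceMatrix {ι : Type*} : MeasurableSpace (Matrix ι ι ℝ) :=
  inferInstanceAs (MeasurableSpace (ι → ι → ℝ))

/-- The entrywise expectation of a random matrix. -/
noncomputable def expMatrix {ι Ω : Type*} [MeasurableSpace Ω] (P : Measure Ω)
    (M : Ω → Matrix ι ι ℝ) : Matrix ι ι ℝ :=
  Matrix.of fun i j => ∫ ω, M ω i j ∂P

/-- Assumptions on the environment of the algorithm.  At time `t`, `A t` is the mixing matrix of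
the iterates, `B t` the mixing matrix of the gradient trackers, and `S t` the set of sampled
nodes. The triples `(A t, B t, S t)` are independent across time; at a fixed time the three
components may depend on each other arbitrarily. -/
structure Environment {ι Ω : Type*} [Fintype ι] [DecidableEq ι] [MeasurableSpace Ω]
    (P : Measure Ω) (A B : ℕ → Ω → Matrix ι ι ℝ) (S : ℕ → Ω → Finset ι)
    (p : ι → ℝ) (δ : ℝ) : Prop where
  measurable_A : ∀ t, Measurable (A t)
  measurable_B : ∀ t, Measurable (B t)
  measurable_S : ∀ t, Measurable (S t)
  /-- temporal independence -/
  indep : iIndepFun (fun t ω => (A t ω, B t ω, S t ω)) P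
  /-- the matrices `A t` share one distribution, and so do the matrices `B t` -/
  ident_A : ∀ t, IdentDistrib (A t) (A 0) P P
  ident_B : ∀ t, IdentDistrib (B t) (B 0) P P
  row_stochastic : ∀ t, ∀ᵐ ω ∂P, A t ω ∈ Matrix.rowStochastic ℝ ι
  col_stochastic : ∀ t, ∀ᵐ ω ∂P, B t ω ∈ Matrix.colStochastic ℝ ι
  /-- the diagonal entries are bounded away from zero -/
  diag_pos : 0 < δ
  diag_A : ∀ t, ∀ᵐ ω ∂P, ∀ i, δ ≤ A t ω i i
  diag_B : ∀ t, ∀ᵐ ω ∂P, ∀ i, δ ≤ B t ω i i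
  primitive_A : (expMatrix P (A 0)).IsPrimitive
  primitive_B : (expMatrix P (B 0)).IsPrimitive
  /-- node `i` is sampled with probability `p i > 0`, possibly different from node to node -/
  sampling_pos : ∀ i, 0 < p i
  sampling : ∀ t i, P.real {ω | i ∈ S t ω} = p i

/-- The local variables of all nodes: the iterates `x`, the points `c` at which the stored local
gradients were computed, and the gradient trackers `G`. -/
structure State (ι E : Type*) where
  x : ι → E
  c : ι → E
  G : ι → E

section Algorithm

variable {ι E : Type*} [Fintype ι] [DecidableEq ι] [NormedAddCommGroup E]
  [InnerProductSpace ℝ E] [CompleteSpace E]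

/-- The global objective, that is, the average of the local functions. -/
noncomputable def objective (f : ι → E → ℝ) (y : E) : ℝ :=
  (1 / (Fintype.card ι : ℝ)) * ∑ i, f i y

/-- The average over the nodes. -/
noncomputable def average (v : ι → E) : E :=
  (1 / (Fintype.card ι : ℝ)) • ∑ i, v i

/-- The trackers after the local computation: a sampled node replaces its stored gradient by the
gradient at its current iterate. -/
noncomputable def halfG (f : ι → E → ℝ) (S : Finset ι) (s : State ι E) (i : ι) : E :=
  if i ∈ S then s.G i + gradient (f i) (s.x i) - gradient (f i) (s.c i) else s.G i

/-- The iterates after the local computation: a sampled node moves along its tracker. -/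
noncomputable def halfX (f : ι → E → ℝ) (η : ℝ) (S : Finset ι) (s : State ι E) (i : ι) : E :=
  if i ∈ S then s.x i - η • halfG f S s i else s.x i

/-- One iteration of PPDS: local computation at the sampled nodes, then mixing of the iterates
by `A` and of the trackers by `B`. -/
noncomputable def step (f : ι → E → ℝ) (η : ℝ) (A B : Matrix ι ι ℝ) (S : Finset ι)
    (s : State ι E) : State ι E where
  x := fun i => ∑ j, A i j • halfX f η S s j
  c := fun i => if i ∈ S then s.x i else s.c i
  G := fun i => ∑ j, B i j • halfG f S s j

/-- The run of PPDS with stepsize `η` started at the state `s₀`. -/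
noncomputable def run {Ω : Type*} (f : ι → E → ℝ) (η : ℝ) (A B : ℕ → Ω → Matrix ι ι ℝ)
    (S : ℕ → Ω → Finset ι) (s₀ : State ι E) : ℕ → Ω → State ι E
  | 0, _ => s₀
  | t + 1, ω => step f η (A t ω) (B t ω) (S t ω) (run f η A B S s₀ t ω)

/-- The random weights of the trackers: uniform at first, then mixed by the matrices `B t`. -/
noncomputable def weight {Ω : Type*} (B : ℕ → Ω → Matrix ι ι ℝ) : ℕ → Ω → ι → ℝ
  | 0, _ => fun _ => 1 / (Fintype.card ι : ℝ)
  | t + 1, ω => Matrix.mulVec (B t ω) (weight B t ω)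

/-- Squared distance of the average iterate to `z`. -/
noncomputable def distSq (z : E) (s : State ι E) : ℝ :=
  ‖average s.x - z‖ ^ 2

/-- Squared consensus error. -/
noncomputable def consensusSq (s : State ι E) : ℝ :=
  ∑ i, ‖s.x i - average s.x‖ ^ 2

/-- Squared distance of the trackers to the multiples, with weights `w`, of their sum. -/
noncomputable def trackingSq (w : ι → ℝ) (s : State ι E) : ℝ :=
  ∑ i, ‖s.G i - w i • ∑ j, s.G j‖ ^ 2

/-- Squared distance between the current and the stored local gradients. -/
noncomputable def gradientSq (f : ι → E → ℝ) (s : State ι E) : ℝ :=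
  ∑ i, ‖gradient (f i) (s.x i) - gradient (f i) (s.c i)‖ ^ 2

/-- Size of the error of a deterministic initial state. -/
noncomputable def initialError (f : ι → E → ℝ) (z : E) (s : State ι E) : ℝ :=
  distSq z s + consensusSq s + trackingSq (fun _ => 1 / (Fintype.card ι : ℝ)) s + gradientSq f s

/-- The random variables `Q t` are integrable, with expectation at most `K * ρ ^ t`. -/
def GeomBound {Ω : Type*} [MeasurableSpace Ω] (P : Measure Ω) (Q : ℕ → Ω → ℝ) (K ρ : ℝ) : Prop :=
  ∀ t, Integrable (Q t) P ∧ ∫ ω, Q t ω ∂P ≤ K * ρ ^ t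

end Algorithm

end PPDS

/-! A single realization of `A t` or `B t` need not contract anything; only the mean matrices mix.
Let `u` be the positive stationary distribution of `E[A 0]` and `v` that of the transpose of `E[B
0]`. Four errors are followed in expectation: `D`, the squared distance of the `u`-weighted mean of
the iterates to the minimizer; `V`, their `u`-weighted variance; `H`, the staleness of the stored
gradients; and a constant `a` that controls the trackers.

Variance. Mixing by `A` bounds the new variance by an expression linear in the entries of `A`: the
positive diagonal turns the Jensen gap of each row into a Dirichlet energy
(`sum_mul_norm_mix_sq_le`). Linearity and independence replace `A t` by its mean, and primitivity
gives the mean a Poincaré inequality (`exists_wvar_le_energy`).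

Trackers. The deviation `e` from the weighted sum obeys `e' = B (e + input)`, and no fixed norm of
`e` is known to contract. The argument is dual: the invariant is `E‖∑ y i • e i‖² ≤ a * wvar v y`
for every fixed real vector `y`. Pairing `y` with `B e` is pairing `Bᵀ y` with `e`, and `Bᵀ` is
row-stochastic with positive diagonal, so the variance of the test vector contracts in expectation.

Mean. The deviation of `uᵀ A` from `uᵀ` has mean zero. The gradient step enters with coefficient `∑
j, (uᵀ A) j * 1_{j ∈ S} * w j`, where `w` are the tracker weights. The diagonal alone gives `E[(uᵀ
A) j * 1_{j ∈ S}] ≥ δ * u j * p j`, whatever the dependence of `A` and `S`; since the weights sum to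
one, no lower bound on them is needed. Strong convexity then contracts `D` by a factor `1 - O(η)`.

Closing. `V`, `H` and `a` contract at rates independent of `η`. The couplings of order one, `V` into
`D` and `H`, and `H` into `a`, form no cycle, and the others carry a factor `η` or `η²`. A suitably
weighted sum therefore decays geometrically for small `η` (`exists_contracting_weights`). -/

namespace PPDS

/-! ### Weighted means, variances and the effect of one averaging step. -/

section WeightedVariance

lemma norm_sum_smul_sq_le {ι E : Type*} [NormedAddCommGroup E] [NormedSpace ℝ E] (s : Finset ι) (w : ι → ℝ) (y : ι → E) (hw : ∀ i, 0 ≤ w i) :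
    ‖∑ j ∈ s, w j • y j‖ ^ 2 ≤ (∑ j ∈ s, w j) * ∑ j ∈ s, w j * ‖y j‖ ^ 2 := by
  have h1 : ‖∑ j ∈ s, w j • y j‖ ≤ ∑ j ∈ s, w j * ‖y j‖ := by
    refine (norm_sum_le _ _).trans (Finset.sum_le_sum fun j _ => ?_)
    rw [norm_smul, Real.norm_of_nonneg (hw j)]
  refine (pow_le_pow_left₀ (norm_nonneg _) h1 2).trans ?_
  exact Finset.sum_sq_le_sum_mul_sum_of_sq_le_mul _ (fun j _ => hw j)
    (fun j _ => mul_nonneg (hw j) (sq_nonneg _)) (fun j _ => le_of_eq (by ring))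

lemma norm_add_sq_le_theta {E : Type*} [NormedAddCommGroup E] (a b : E) {θ : ℝ} (hθ : 0 < θ) :
    ‖a + b‖ ^ 2 ≤ (1 + θ) * ‖a‖ ^ 2 + (1 + 1 / θ) * ‖b‖ ^ 2 := by
  have h1 := norm_add_le a b
  have h2 : ‖a + b‖ ^ 2 ≤ (‖a‖ + ‖b‖) ^ 2 := pow_le_pow_left₀ (norm_nonneg _) h1 2
  have h3 : 0 ≤ (θ * ‖a‖ - ‖b‖) ^ 2 / θ := by positivity
  have h4 : (θ * ‖a‖ - ‖b‖) ^ 2 / θ = θ * ‖a‖ ^ 2 - 2 * ‖a‖ * ‖b‖ + 1 / θ * ‖b‖ ^ 2 := by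
    field_simp; ring
  nlinarith

lemma norm_add_sq_le_two {E : Type*} [NormedAddCommGroup E] (a b : E) : ‖a + b‖ ^ 2 ≤ 2 * ‖a‖ ^ 2 + 2 * ‖b‖ ^ 2 := by
  have := norm_add_sq_le_theta a b one_pos
  norm_num at this; linarith

lemma norm_add_three_sq_le {E : Type*} [NormedAddCommGroup E] (a b c : E) :
    ‖a + b + c‖ ^ 2 ≤ 3 * ‖a‖ ^ 2 + 3 * ‖b‖ ^ 2 + 3 * ‖c‖ ^ 2 := by
  have h2 : ‖a + b + c‖ ^ 2 ≤ (‖a‖ + ‖b‖ + ‖c‖) ^ 2 :=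
    pow_le_pow_left₀ (norm_nonneg _) (norm_add₃_le) 2
  nlinarith [sq_nonneg (‖a‖ - ‖b‖), sq_nonneg (‖a‖ - ‖c‖), sq_nonneg (‖b‖ - ‖c‖)]

variable {ι E : Type*} [Fintype ι] [NormedAddCommGroup E] [InnerProductSpace ℝ E]

lemma norm_sum_sq_le (y : ι → E) :
    ‖∑ j, y j‖ ^ 2 ≤ Fintype.card ι * ∑ j, ‖y j‖ ^ 2 := by
  have := norm_sum_smul_sq_le Finset.univ (fun _ => (1 : ℝ)) y (fun _ => zero_le_one)
  simpa using this

lemma norm_sum_smul_sq_le_sum_sq (w : ι → ℝ) (y : ι → E) :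
    ‖∑ j, w j • y j‖ ^ 2 ≤ (∑ j, w j ^ 2) * ∑ j, ‖y j‖ ^ 2 := by
  have h1 : ‖∑ j, w j • y j‖ ≤ ∑ j, |w j| * ‖y j‖ := by
    refine (norm_sum_le _ _).trans (Finset.sum_le_sum fun j _ => ?_)
    rw [norm_smul, Real.norm_eq_abs]
  refine (pow_le_pow_left₀ (norm_nonneg _) h1 2).trans ?_
  refine (Finset.sum_mul_sq_le_sq_mul_sq _ _ _).trans ?_
  simp

/-- Sub-convex combinations do not increase the sum of the squared norms. -/
lemma norm_sum_smul_sq_le_sum (w : ι → ℝ) (y : ι → E) (h0 : ∀ i, 0 ≤ w i) (h1 : ∑ i, w i ≤ 1) :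
    ‖∑ j, w j • y j‖ ^ 2 ≤ ∑ j, ‖y j‖ ^ 2 := by
  have hw : ∀ i, w i ≤ 1 := fun i =>
    (Finset.single_le_sum (fun j _ => h0 j) (Finset.mem_univ i)).trans h1
  refine (norm_sum_smul_sq_le _ w y h0).trans ?_
  have h2 : ∑ j, w j * ‖y j‖ ^ 2 ≤ ∑ j, ‖y j‖ ^ 2 :=
    Finset.sum_le_sum fun j _ => mul_le_of_le_one_left (sq_nonneg _) (hw j)
  have h3 : 0 ≤ ∑ j, w j * ‖y j‖ ^ 2 :=
    Finset.sum_nonneg fun j _ => mul_nonneg (h0 j) (sq_nonneg _)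
  exact (mul_le_of_le_one_left h3 h1).trans h2

/-- Weighted mean. -/
noncomputable def wmean (u : ι → ℝ) (x : ι → E) : E := ∑ i, u i • x i

/-- Weighted variance. -/
noncomputable def wvar (u : ι → ℝ) (x : ι → E) : ℝ := ∑ i, u i * ‖x i - wmean u x‖ ^ 2

lemma wmean_sub_const {u : ι → ℝ} (hu : ∑ i, u i = 1) (x : ι → E) (z : E) :
    ∑ i, u i • (x i - z) = wmean u x - z := by
  simp only [smul_sub, Finset.sum_sub_distrib, ← Finset.sum_smul, hu, one_smul, wmean]

lemma sum_mul_norm_sub_sq {u : ι → ℝ} (hu : ∑ i, u i = 1) (x : ι → E) (z : E) :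
    ∑ i, u i * ‖x i - z‖ ^ 2 = wvar u x + ‖wmean u x - z‖ ^ 2 := by
  have h : ∀ i, ‖x i - z‖ ^ 2 = ‖x i - wmean u x‖ ^ 2
      + 2 * inner ℝ (x i - wmean u x) (wmean u x - z) + ‖wmean u x - z‖ ^ 2 := fun i => by
    rw [← norm_add_sq_real, sub_add_sub_cancel]
  have h0 : ∑ i, u i * inner ℝ (x i - wmean u x) (wmean u x - z) = 0 := by
    simp only [← real_inner_smul_left, ← sum_inner, wmean_sub_const hu, sub_self, inner_zero_left]
  calc ∑ i, u i * ‖x i - z‖ ^ 2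
      = ∑ i, (u i * ‖x i - wmean u x‖ ^ 2
        + 2 * (u i * inner ℝ (x i - wmean u x) (wmean u x - z))
        + u i * ‖wmean u x - z‖ ^ 2) := Finset.sum_congr rfl fun i _ => by rw [h i]; ring
    _ = _ := by
      rw [Finset.sum_add_distrib, Finset.sum_add_distrib, ← Finset.mul_sum, h0,
        ← Finset.sum_mul, hu, wvar]; ring

lemma wvar_nonneg {u : ι → ℝ} (hu : ∀ i, 0 ≤ u i) (x : ι → E) : 0 ≤ wvar u x :=
  Finset.sum_nonneg fun i _ => mul_nonneg (hu i) (sq_nonneg _)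

lemma wvar_le {u : ι → ℝ} (hu : ∑ i, u i = 1) (x : ι → E) (z : E) :
    wvar u x ≤ ∑ i, u i * ‖x i - z‖ ^ 2 := by
  rw [sum_mul_norm_sub_sq hu]; nlinarith [sq_nonneg ‖wmean u x - z‖]

/-- The variance dominates the squared distances to a point that carries some mass. -/
lemma mul_sum_le_wvar [DecidableEq ι] {w : ι → ℝ} (h0 : ∀ i, 0 ≤ w i) (h1 : ∑ i, w i = 1)
    {δ : ℝ} {i : ι} (hi : δ ≤ w i) (x : ι → E) :
    δ * ∑ j, w j * ‖x i - x j‖ ^ 2 ≤ wvar w x := by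
  have h2 := sum_mul_norm_sub_sq h1 x (x i)
  have h3 : ‖wmean w x - x i‖ ^ 2 ≤ (1 - δ) * ∑ j, w j * ‖x j - x i‖ ^ 2 := by
    rw [← wmean_sub_const h1 x (x i)]
    -- The term `j = i` vanishes, so Cauchy–Schwarz only sees the mass `1 - w i ≤ 1 - δ`; this is
    -- where the positive diagonal produces a gain.
    have e1 : ∑ j, w j • (x j - x i) = ∑ j ∈ Finset.univ.erase i, w j • (x j - x i) := by
      rw [Finset.sum_erase]; simp
    have e2 : ∑ j, w j * ‖x j - x i‖ ^ 2 = ∑ j ∈ Finset.univ.erase i, w j * ‖x j - x i‖ ^ 2 := by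
      rw [Finset.sum_erase]; simp
    have e3 : ∑ j ∈ Finset.univ.erase i, w j = 1 - w i := by
      rw [← h1, ← Finset.sum_erase_add _ _ (Finset.mem_univ i)]; ring
    rw [e1, e2]
    refine (norm_sum_smul_sq_le _ w _ h0).trans ?_
    rw [e3]
    exact mul_le_mul_of_nonneg_right (by linarith)
      (Finset.sum_nonneg fun j _ => mul_nonneg (h0 j) (sq_nonneg _))
  have h4 : ∑ j, w j * ‖x i - x j‖ ^ 2 = ∑ j, w j * ‖x j - x i‖ ^ 2 :=
    Finset.sum_congr rfl fun j _ => by rw [norm_sub_rev]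
  rw [h4]; linarith

/-- Mixing by a row-stochastic matrix with diagonal bounded below. -/
lemma sum_mul_norm_mix_sq_le [DecidableEq ι] {A : Matrix ι ι ℝ}
    (hA : A ∈ Matrix.rowStochastic ℝ ι) {δ : ℝ} (hδ : ∀ i, δ ≤ A i i) {u : ι → ℝ}
    (hu : ∀ i, 0 ≤ u i) (x : ι → E) (z : E) :
    ∑ i, u i * ‖∑ j, A i j • x j - z‖ ^ 2 ≤
      ∑ i, ∑ j, A i j * (u i * ‖x j - z‖ ^ 2 - δ * u i * ‖x i - x j‖ ^ 2) := by
  refine Finset.sum_le_sum fun i _ => ?_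
  have h0 : ∀ j, 0 ≤ A i j := fun j => Matrix.nonneg_of_mem_rowStochastic hA
  have h1 := Matrix.sum_row_of_mem_rowStochastic hA i
  have h2 := mul_sum_le_wvar h0 h1 (hδ i) x
  have h3 := sum_mul_norm_sub_sq h1 x z
  -- The bound stays linear in the row of `A`, so that an expectation can later pass to the mean
  -- matrix.
  have h4 : ∑ j, A i j * (u i * ‖x j - z‖ ^ 2 - δ * u i * ‖x i - x j‖ ^ 2)
      = u i * (∑ j, A i j * ‖x j - z‖ ^ 2 - δ * ∑ j, A i j * ‖x i - x j‖ ^ 2) := by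
    rw [mul_sub, Finset.mul_sum, Finset.mul_sum, Finset.mul_sum, ← Finset.sum_sub_distrib]
    exact Finset.sum_congr rfl fun j _ => by ring
  rw [h4]
  refine mul_le_mul_of_nonneg_left ?_ (hu i)
  rw [h3]; change ‖wmean (A i) x - z‖ ^ 2 ≤ _
  linarith

end WeightedVariance

/-! ### Stationary distribution and Poincaré inequality of a primitive stochastic matrix. -/

section Perron

variable {ι : Type*} [Fintype ι] [DecidableEq ι]

/-- Since `A 1 = 1`, the matrix `A - 1` is singular and has a left null vector `w`. The triangle
inequality makes `|w|` subinvariant, conservation of total mass makes it invariant, and a positive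
power of `A` makes it positive. -/
lemma exists_pos_stationary [Nonempty ι] {A : Matrix ι ι ℝ} (hA : A ∈ Matrix.rowStochastic ℝ ι)
    (hp : A.IsPrimitive) :
    ∃ u : ι → ℝ, (∀ i, 0 < u i) ∧ ∑ i, u i = 1 ∧ ∀ j, ∑ i, u i * A i j = u j := by
  have hdet : (A - 1).det = 0 := by
    refine Matrix.exists_mulVec_eq_zero_iff.1 ⟨1, one_ne_zero, ?_⟩
    rw [Matrix.sub_mulVec, Matrix.one_mulVec, Matrix.one_vecMul_of_mem_rowStochastic hA, sub_self]
  obtain ⟨w, hw0, hw⟩ := Matrix.exists_vecMul_eq_zero_iff.2 hdet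
  rw [Matrix.vecMul_sub, Matrix.vecMul_one, sub_eq_zero] at hw
  have hwj : ∀ j, ∑ i, w i * A i j = w j := fun j => congrFun hw j
  have hle : ∀ j, |w j| ≤ ∑ i, |w i| * A i j := fun j => by
    rw [← hwj j]
    refine (Finset.abs_sum_le_sum_abs _ _).trans (Finset.sum_le_sum fun i _ => ?_)
    rw [abs_mul, abs_of_nonneg (hp.nonneg i j)]
  have hsum : ∑ j, |w j| = ∑ j, ∑ i, |w i| * A i j := by
    rw [Finset.sum_comm]
    refine Finset.sum_congr rfl fun i _ => ?_
    rw [← Finset.mul_sum, Matrix.sum_row_of_mem_rowStochastic hA, mul_one]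
  -- Entrywise inequalities with equal totals are equalities.
  have heq : ∀ j, ∑ i, |w i| * A i j = |w j| := fun j =>
    (((Finset.sum_eq_sum_iff_of_le (fun j _ => hle j)).1 hsum) j (Finset.mem_univ j)).symm
  have hvec : Matrix.vecMul (fun i => |w i|) A = fun i => |w i| := funext heq
  have hpow : ∀ k : ℕ, Matrix.vecMul (fun i => |w i|) (A ^ k) = fun i => |w i| := fun k => by
    induction k with
    | zero => simp
    | succ k ih => rw [pow_succ, ← Matrix.vecMul_vecMul, ih, hvec]
  obtain ⟨k, -, hk⟩ := hp.exists_pos_pow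
  obtain ⟨i₀, hi₀⟩ := Function.ne_iff.1 hw0
  have hpos : ∀ j, 0 < |w j| := fun j => by
    have := congrFun (hpow k) j
    rw [← this]
    refine Finset.sum_pos' (fun i _ => mul_nonneg (abs_nonneg _) (hk i j).le)
      ⟨i₀, Finset.mem_univ _, mul_pos (abs_pos.2 hi₀) (hk i₀ j)⟩
  have hs : 0 < ∑ j, |w j| := Finset.sum_pos (fun j _ => hpos j) Finset.univ_nonempty
  refine ⟨fun i => |w i| / ∑ j, |w j|, fun i => div_pos (hpos i) hs, ?_, fun j => ?_⟩
  · rw [← Finset.sum_div, div_self hs.ne']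
  · change ∑ i, |w i| / (∑ j, |w j|) * A i j = |w j| / ∑ j, |w j|
    simp only [div_mul_eq_mul_div]
    rw [← Finset.sum_div, heq j]

/-- Dirichlet form of a weighted matrix. -/
noncomputable def energy {E : Type*} [NormedAddCommGroup E] (u : ι → ℝ) (A : Matrix ι ι ℝ)
    (x : ι → E) : ℝ := ∑ i, ∑ j, u i * A i j * ‖x i - x j‖ ^ 2

/-- A jump by `A * B` passes through an intermediate node `l`, and `‖x i - x j‖²` splits there. Row
sums of `B` remove the second leg from the first term; stationarity of `u` under `A` removes the
first leg from the second. -/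
lemma energy_mul_le {E : Type*} [NormedAddCommGroup E] [InnerProductSpace ℝ E] {u : ι → ℝ}
    {A B : Matrix ι ι ℝ} (hA : A ∈ Matrix.rowStochastic ℝ ι) (hB : B ∈ Matrix.rowStochastic ℝ ι)
    (hu : ∀ i, 0 ≤ u i) (hs : ∀ j, ∑ i, u i * A i j = u j) (x : ι → E) :
    energy u (A * B) x ≤ 2 * energy u A x + 2 * energy u B x := by
  have hA0 : ∀ i j, 0 ≤ A i j := fun i j => Matrix.nonneg_of_mem_rowStochastic hA
  have hB0 : ∀ i j, 0 ≤ B i j := fun i j => Matrix.nonneg_of_mem_rowStochastic hB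
  have h1 : energy u (A * B) x = ∑ i, ∑ l, ∑ j, u i * A i l * B l j * ‖x i - x j‖ ^ 2 := by
    refine Finset.sum_congr rfl fun i _ => ?_
    rw [Finset.sum_comm]
    refine Finset.sum_congr rfl fun j _ => ?_
    rw [Matrix.mul_apply, Finset.mul_sum, Finset.sum_mul]
    exact Finset.sum_congr rfl fun l _ => by ring
  have h2 : energy u A x = ∑ i, ∑ l, ∑ j, u i * A i l * B l j * ‖x i - x l‖ ^ 2 := by
    refine Finset.sum_congr rfl fun i _ => Finset.sum_congr rfl fun l _ => ?_
    rw [← Finset.sum_mul, ← Finset.mul_sum, Matrix.sum_row_of_mem_rowStochastic hB, mul_one]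
  have h3 : energy u B x = ∑ i, ∑ l, ∑ j, u i * A i l * B l j * ‖x l - x j‖ ^ 2 := by
    rw [Finset.sum_comm]
    refine Finset.sum_congr rfl fun l _ => ?_
    rw [Finset.sum_comm]
    refine Finset.sum_congr rfl fun j _ => ?_
    rw [← Finset.sum_mul, ← Finset.sum_mul, hs]
  rw [h1, h2, h3]
  simp only [Finset.mul_sum, ← Finset.sum_add_distrib]
  refine Finset.sum_le_sum fun i _ => Finset.sum_le_sum fun l _ => Finset.sum_le_sum fun j _ => ?_
  have h4 := norm_add_sq_le_two (x i - x l) (x l - x j)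
  rw [sub_add_sub_cancel] at h4
  have h5 : 0 ≤ u i * A i l * B l j := mul_nonneg (mul_nonneg (hu i) (hA0 i l)) (hB0 l j)
  nlinarith

/-- A power of `A` with positive entries connects all pairs directly, so its energy dominates the
variance; `energy_mul_le` bounds that energy by a multiple of the energy of `A`. The constant
precedes the space `E`: it is used both for real test vectors and for iterates of any dimension. -/
lemma exists_wvar_le_energy [Nonempty ι] {A : Matrix ι ι ℝ} (hA : A ∈ Matrix.rowStochastic ℝ ι)
    (hp : A.IsPrimitive) {u : ι → ℝ} (hu : ∀ i, 0 ≤ u i) (hu1 : ∑ i, u i = 1)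
    (hs : ∀ j, ∑ i, u i * A i j = u j) :
    ∃ c : ℝ, 0 < c ∧ ∀ (E : Type) [NormedAddCommGroup E] [InnerProductSpace ℝ E] (x : ι → E),
      c * wvar u x ≤ energy u A x := by
  obtain ⟨k, hk0, hk⟩ := hp.exists_pos_pow
  have hnn : ∀ (E : Type) [NormedAddCommGroup E] [InnerProductSpace ℝ E] (x : ι → E),
      0 ≤ energy u A x := fun E _ _ x =>
    Finset.sum_nonneg fun i _ => Finset.sum_nonneg fun j _ =>
      mul_nonneg (mul_nonneg (hu i) (hp.nonneg i j)) (sq_nonneg _)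
  have hC : ∀ n : ℕ, ∃ C : ℝ, 0 < C ∧
      ∀ (E : Type) [NormedAddCommGroup E] [InnerProductSpace ℝ E] (x : ι → E),
        energy u (A ^ (n + 1)) x ≤ C * energy u A x := fun n => by
    induction n with
    | zero => exact ⟨1, one_pos, fun E _ _ x => by simp⟩
    | succ n ih =>
      obtain ⟨C, hC, h⟩ := ih
      refine ⟨2 + 2 * C, by linarith, fun E _ _ x => ?_⟩
      rw [pow_succ' A (n + 1)]
      refine (energy_mul_le hA (Submonoid.pow_mem _ hA _) hu hs x).trans ?_
      linarith [h E x]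
  obtain ⟨n, rfl⟩ : ∃ n, k = n + 1 := ⟨k - 1, by omega⟩
  obtain ⟨C, hC, h⟩ := hC n
  obtain ⟨⟨i₀, j₀⟩, hmin⟩ := Finite.exists_min fun q : ι × ι => (A ^ (n + 1)) q.1 q.2
  set m := (A ^ (n + 1)) i₀ j₀ with hm
  refine ⟨m / C, div_pos (hk _ _) hC, fun E _ _ x => ?_⟩
  have h1 : m * wvar u x ≤ energy u (A ^ (n + 1)) x := by
    have h2 : ∀ i, m * (u i * wvar u x) ≤ ∑ j, u i * (A ^ (n + 1)) i j * ‖x i - x j‖ ^ 2 := by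
      intro i
      have h3 := wvar_le hu1 x (x i)
      have h4 : ∑ j, u j * ‖x j - x i‖ ^ 2 ≤ ∑ j, ‖x i - x j‖ ^ 2 :=
        Finset.sum_le_sum fun j _ => by
          rw [norm_sub_rev]
          refine mul_le_of_le_one_left (sq_nonneg _) ?_
          rw [← hu1]; exact Finset.single_le_sum (fun j _ => hu j) (Finset.mem_univ j)
      calc m * (u i * wvar u x) ≤ m * (u i * ∑ j, ‖x i - x j‖ ^ 2) :=
            mul_le_mul_of_nonneg_left (mul_le_mul_of_nonneg_left (h3.trans h4) (hu i)) (hk _ _).le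
        _ = ∑ j, u i * m * ‖x i - x j‖ ^ 2 := by
            rw [Finset.mul_sum, Finset.mul_sum]; exact Finset.sum_congr rfl fun j _ => by ring
        _ ≤ _ := Finset.sum_le_sum fun j _ => mul_le_mul_of_nonneg_right
            (mul_le_mul_of_nonneg_left (hmin (i, j)) (hu i)) (sq_nonneg _)
    have h5 := Finset.sum_le_sum fun i (_ : i ∈ Finset.univ) => h2 i
    rw [← Finset.mul_sum, ← Finset.sum_mul, hu1, one_mul] at h5
    exact h5
  rw [div_mul_eq_mul_div, div_le_iff₀ hC]
  linarith [h E x]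

end Perron

/-! ### Deterministic one-step inequalities for a single realization. -/

section Pathwise

variable {ι E : Type*} [Fintype ι] [NormedAddCommGroup E] [InnerProductSpace ℝ E]

/-- Sum of the squared distances to the weighted mean. -/
noncomputable def spreadSq (u : ι → ℝ) (x : ι → E) : ℝ := ∑ i, ‖x i - wmean u x‖ ^ 2

lemma spreadSq_nonneg (u : ι → ℝ) (x : ι → E) : 0 ≤ spreadSq u x :=
  Finset.sum_nonneg fun _ _ => sq_nonneg _

lemma trackingSq_nonneg (w : ι → ℝ) (s : State ι E) : 0 ≤ trackingSq w s :=
  Finset.sum_nonneg fun _ _ => sq_nonneg _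

lemma mul_spreadSq_le_wvar {u : ι → ℝ} {κ : ℝ} (hκ : ∀ i, κ ≤ u i) (x : ι → E) :
    κ * spreadSq u x ≤ wvar u x := by
  rw [spreadSq, Finset.mul_sum]
  exact Finset.sum_le_sum fun i _ => mul_le_mul_of_nonneg_right (hκ i) (sq_nonneg _)

variable [CompleteSpace E]

lemma gradientSq_nonneg (f : ι → E → ℝ) (s : State ι E) : 0 ≤ gradientSq f s :=
  Finset.sum_nonneg fun _ _ => sq_nonneg _

/-- Indicator of the sampled set. -/
noncomputable def ind [DecidableEq ι] (S : Finset ι) (i : ι) : ℝ := if i ∈ S then 1 else 0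

omit [Fintype ι] in
lemma ind_nonneg [DecidableEq ι] (S : Finset ι) (i : ι) : 0 ≤ ind S i := by
  unfold ind; split_ifs <;> norm_num

omit [Fintype ι] in
lemma ind_le_one [DecidableEq ι] (S : Finset ι) (i : ι) : ind S i ≤ 1 := by
  unfold ind; split_ifs <;> norm_num

/-- Difference between the current and the stored gradient. -/
noncomputable def staleness (f : ι → E → ℝ) (s : State ι E) (i : ι) : E :=
  gradient (f i) (s.x i) - gradient (f i) (s.c i)

/-- Deviation of the trackers from the multiples, with weights `w`, of their sum. -/
noncomputable def trackErr (w : ι → ℝ) (s : State ι E) (i : ι) : E := s.G i - w i • ∑ j, s.G j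

omit [Fintype ι] in
lemma halfG_eq [DecidableEq ι] (f : ι → E → ℝ) (S : Finset ι) (s : State ι E) (i : ι) :
    halfG f S s i = s.G i + ind S i • staleness f s i := by
  unfold halfG ind staleness
  split_ifs
  · rw [one_smul, add_sub_assoc]
  · rw [zero_smul, add_zero]

omit [Fintype ι] in
lemma halfX_eq [DecidableEq ι] (f : ι → E → ℝ) (η : ℝ) (S : Finset ι) (s : State ι E) (i : ι) :
    halfX f η S s i = s.x i - (η * ind S i) • halfG f S s i := by
  unfold halfX ind
  split_ifs <;> simp

/-- Sum of the local gradients at one point. -/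
noncomputable def gradSum (f : ι → E → ℝ) (y : E) : E := ∑ i, gradient (f i) y

omit [Fintype ι] in
lemma norm_sq_gradient_sub_le {f : ι → E → ℝ} {L : ℝ≥0} (hL : ∀ i, LipschitzWith L (gradient (f i)))
    (i : ι) (y z : E) :
    ‖gradient (f i) y - gradient (f i) z‖ ^ 2 ≤ (L : ℝ) ^ 2 * ‖y - z‖ ^ 2 := by
  rw [← mul_pow]
  exact pow_le_pow_left₀ (norm_nonneg _) ((hL i).norm_sub_le y z) 2

lemma norm_sq_gradSum_sub_le {f : ι → E → ℝ} {L : ℝ≥0} (hL : ∀ i, LipschitzWith L (gradient (f i)))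
    (y z : E) :
    ‖gradSum f y - gradSum f z‖ ^ 2 ≤ (Fintype.card ι : ℝ) ^ 2 * L ^ 2 * ‖y - z‖ ^ 2 := by
  rw [gradSum, gradSum, ← Finset.sum_sub_distrib]
  refine (norm_sum_sq_le _).trans ?_
  have : ∑ i, ‖gradient (f i) y - gradient (f i) z‖ ^ 2 ≤ ∑ _i : ι, (L : ℝ) ^ 2 * ‖y - z‖ ^ 2 :=
    Finset.sum_le_sum fun i _ => norm_sq_gradient_sub_le hL i y z
  rw [Finset.sum_const, Finset.card_univ, nsmul_eq_mul] at this
  calc _ ≤ (Fintype.card ι : ℝ) * (Fintype.card ι * (L ^ 2 * ‖y - z‖ ^ 2)) := by gcongr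
    _ = _ := by ring

/-- The invariants of a run. -/
structure Conserved (f : ι → E → ℝ) (w : ι → ℝ) (s : State ι E) : Prop where
  sum_G : ∑ i, s.G i = ∑ i, gradient (f i) (s.c i)
  nonneg : ∀ i, 0 ≤ w i
  sum_one : ∑ i, w i = 1

lemma Conserved.le_one {f : ι → E → ℝ} {w : ι → ℝ} {s : State ι E} (h : Conserved f w s) (i : ι) :
    w i ≤ 1 := by
  rw [← h.sum_one]; exact Finset.single_le_sum (fun j _ => h.nonneg j) (Finset.mem_univ i)

/-- The trackers sum to the stored gradients, so their sum differs from the full gradient at the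
weighted mean only through staleness and disagreement of the iterates. -/
lemma norm_sq_sum_G_sub_le {f : ι → E → ℝ} {L : ℝ≥0} (hL : ∀ i, LipschitzWith L (gradient (f i)))
    {w : ι → ℝ} {s : State ι E} (hs : Conserved f w s) (u : ι → ℝ) :
    ‖∑ i, s.G i - gradSum f (wmean u s.x)‖ ^ 2 ≤
      2 * Fintype.card ι * gradientSq f s + 2 * Fintype.card ι * L ^ 2 * spreadSq u s.x := by
  have e : ∑ i, s.G i - gradSum f (wmean u s.x)
      = -(∑ i, (gradient (f i) (s.x i) - gradient (f i) (s.c i)))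
        + ∑ i, (gradient (f i) (s.x i) - gradient (f i) (wmean u s.x)) := by
    rw [hs.sum_G, gradSum, Finset.sum_sub_distrib, Finset.sum_sub_distrib]; abel
  rw [e]
  refine (norm_add_sq_le_two _ _).trans ?_
  rw [norm_neg]
  have h1 := norm_sum_sq_le fun i => gradient (f i) (s.x i) - gradient (f i) (s.c i)
  have h2 := norm_sum_sq_le fun i => gradient (f i) (s.x i) - gradient (f i) (wmean u s.x)
  have h3 : ∑ i, ‖gradient (f i) (s.x i) - gradient (f i) (wmean u s.x)‖ ^ 2
      ≤ L ^ 2 * spreadSq u s.x := by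
    rw [spreadSq, Finset.mul_sum]
    exact Finset.sum_le_sum fun i _ => norm_sq_gradient_sub_le hL i _ _
  have h4 : (Fintype.card ι : ℝ) * ∑ i, ‖gradient (f i) (s.x i) - gradient (f i) (wmean u s.x)‖ ^ 2
      ≤ Fintype.card ι * (L ^ 2 * spreadSq u s.x) := by gcongr
  have h5 : gradientSq f s = ∑ i, ‖gradient (f i) (s.x i) - gradient (f i) (s.c i)‖ ^ 2 := rfl
  rw [← h5] at h1
  linarith

/-- Sum of all error terms. -/
noncomputable def totalErr (u : ι → ℝ) (f : ι → E → ℝ) (z : E) (w : ι → ℝ) (s : State ι E) : ℝ :=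
  ‖wmean u s.x - z‖ ^ 2 + spreadSq u s.x + trackingSq w s + gradientSq f s

/-- This controls every `η²` remainder. No bound on the gradients is required, because `gradSum f`
vanishes at `z` and is Lipschitz; each updated tracker is its deviation plus a share of the total
plus a possible gradient correction. -/
lemma sum_norm_sq_halfG_le [DecidableEq ι] [Nonempty ι] {f : ι → E → ℝ} {L : ℝ≥0}
    (hL : ∀ i, LipschitzWith L (gradient (f i))) {w : ι → ℝ} {s : State ι E}
    (hs : Conserved f w s) (u : ι → ℝ) (S : Finset ι) {z : E} (hz : gradSum f z = 0) :
    ∑ i, ‖halfG f S s i‖ ^ 2 ≤ (3 + 6 * (Fintype.card ι : ℝ) ^ 3 * L ^ 2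
      + 12 * (Fintype.card ι : ℝ) ^ 2 + 12 * (Fintype.card ι : ℝ) ^ 2 * L ^ 2)
        * totalErr u f z w s := by
  set M : ℝ := (Fintype.card ι : ℝ) with hM
  have hM1 : 1 ≤ M := by rw [hM]; exact_mod_cast Fintype.card_pos
  have h1 : ∀ i, ‖halfG f S s i‖ ^ 2 ≤ 3 * ‖trackErr w s i‖ ^ 2 + 3 * ‖∑ j, s.G j‖ ^ 2
      + 3 * ‖staleness f s i‖ ^ 2 := fun i => by
    have e : halfG f S s i = trackErr w s i + w i • ∑ j, s.G j + ind S i • staleness f s i := by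
      rw [halfG_eq, trackErr, sub_add_cancel]
    rw [e]
    refine (norm_add_three_sq_le _ _ _).trans ?_
    have a1 : ‖w i • ∑ j, s.G j‖ ≤ ‖∑ j, s.G j‖ := by
      rw [norm_smul, Real.norm_of_nonneg (hs.nonneg i)]
      exact mul_le_of_le_one_left (norm_nonneg _) (hs.le_one i)
    have a2 : ‖ind S i • staleness f s i‖ ≤ ‖staleness f s i‖ := by
      rw [norm_smul, Real.norm_of_nonneg (ind_nonneg S i)]
      exact mul_le_of_le_one_left (norm_nonneg _) (ind_le_one S i)
    gcongr
  have h2 : ∑ i, ‖halfG f S s i‖ ^ 2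
      ≤ 3 * trackingSq w s + 3 * M * ‖∑ j, s.G j‖ ^ 2 + 3 * gradientSq f s := by
    refine (Finset.sum_le_sum fun i _ => h1 i).trans (le_of_eq ?_)
    rw [Finset.sum_add_distrib, Finset.sum_add_distrib, ← Finset.mul_sum, ← Finset.mul_sum,
      ← Finset.mul_sum, Finset.sum_const, Finset.card_univ, nsmul_eq_mul, ← hM]
    change 3 * trackingSq w s + _ + 3 * gradientSq f s = _
    ring
  have h3 : ‖∑ j, s.G j‖ ^ 2 ≤ 2 * (M ^ 2 * L ^ 2 * ‖wmean u s.x - z‖ ^ 2)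
      + 2 * (2 * M * gradientSq f s + 2 * M * L ^ 2 * spreadSq u s.x) := by
    have e : ∑ j, s.G j = (gradSum f (wmean u s.x) - gradSum f z)
        + (∑ i, s.G i - gradSum f (wmean u s.x)) := by rw [hz]; abel
    have b1 := norm_sq_gradSum_sub_le hL (wmean u s.x) z
    have b2 := norm_sq_sum_G_sub_le hL hs u
    have b3 := norm_add_sq_le_two (gradSum f (wmean u s.x) - gradSum f z)
      (∑ i, s.G i - gradSum f (wmean u s.x))
    rw [← e] at b3
    linarith
  have hD : 0 ≤ ‖wmean u s.x - z‖ ^ 2 := sq_nonneg _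
  have hX := spreadSq_nonneg u s.x
  have hT := trackingSq_nonneg w s
  have hH := gradientSq_nonneg f s
  set D := ‖wmean u s.x - z‖ ^ 2
  set X := spreadSq u s.x
  set T := trackingSq w s
  set H := gradientSq f s
  have h4 : 3 * M * ‖∑ j, s.G j‖ ^ 2 ≤ 3 * M * (2 * (M ^ 2 * L ^ 2 * D)
      + 2 * (2 * M * H + 2 * M * L ^ 2 * X)) := by gcongr
  have hW : totalErr u f z w s = D + X + T + H := rfl
  rw [hW]
  refine h2.trans ?_
  have p1 : 0 ≤ M ^ 3 * (L : ℝ) ^ 2 := by positivity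
  have p2 : 0 ≤ M ^ 2 := by positivity
  have p3 : 0 ≤ M ^ 2 * (L : ℝ) ^ 2 := by positivity
  have e : 3 * T + 3 * M * (2 * (M ^ 2 * L ^ 2 * D) + 2 * (2 * M * H + 2 * M * L ^ 2 * X)) + 3 * H
      = 3 * T + 6 * (M ^ 3 * L ^ 2) * D + 12 * M ^ 2 * H + 12 * (M ^ 2 * L ^ 2) * X + 3 * H := by ring
  have e2 : (3 + 6 * M ^ 3 * (L : ℝ) ^ 2 + 12 * M ^ 2 + 12 * M ^ 2 * L ^ 2)
      = (3 + 6 * (M ^ 3 * (L : ℝ) ^ 2) + 12 * M ^ 2 + 12 * (M ^ 2 * L ^ 2)) := by ring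
  rw [e2]
  have hW' : 0 ≤ X + T + H := by positivity
  have q1 := mul_nonneg p1 hW'
  have q2 := mul_nonneg p2 (show 0 ≤ D + X + T by positivity)
  have q3 := mul_nonneg p3 (show 0 ≤ D + T + H by positivity)
  nlinarith

lemma step_x_eq [DecidableEq ι] (f : ι → E → ℝ) (η : ℝ) (A B : Matrix ι ι ℝ) (S : Finset ι)
    (s : State ι E) (i : ι) :
    (step f η A B S s).x i
      = ∑ j, A i j • s.x j - η • ∑ j, (A i j * ind S j) • halfG f S s j := by
  change ∑ j, A i j • halfX f η S s j = _
  simp only [halfX_eq, smul_sub, Finset.sum_sub_distrib, Finset.smul_sum, smul_smul]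
  congr 1
  exact Finset.sum_congr rfl fun j _ => by congr 1; ring

lemma norm_sq_mixed_halfG_le [DecidableEq ι] (f : ι → E → ℝ) {v : ι → ℝ} (h0 : ∀ j, 0 ≤ v j)
    (h1 : ∑ j, v j = 1) (S : Finset ι) (s : State ι E) :
    ‖∑ j, (v j * ind S j) • halfG f S s j‖ ^ 2 ≤ ∑ j, ‖halfG f S s j‖ ^ 2 := by
  refine norm_sum_smul_sq_le_sum _ _ (fun j => mul_nonneg (h0 j) (ind_nonneg S j)) ?_
  rw [← h1]
  exact Finset.sum_le_sum fun j _ => mul_le_of_le_one_right (h0 j) (ind_le_one S j)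

/-- The variance is at most the second moment about any point, so the old mean can be kept as
centre. Young's inequality with parameter `θ` separates mixing from the gradient move; a small `θ`
preserves the contraction. -/
lemma wvar_step_le [DecidableEq ι] (f : ι → E → ℝ) {η θ δ : ℝ} (hθ : 0 < θ) {A : Matrix ι ι ℝ}
    (B : Matrix ι ι ℝ) (hA : A ∈ Matrix.rowStochastic ℝ ι) (hδ : ∀ i, δ ≤ A i i) (S : Finset ι)
    (s : State ι E) {u : ι → ℝ} (hu : ∀ i, 0 ≤ u i) (hu1 : ∑ i, u i = 1) :
    wvar u (step f η A B S s).x ≤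
      (1 + θ) * ∑ i, ∑ j, A i j * (u i * ‖s.x j - wmean u s.x‖ ^ 2
        - δ * u i * ‖s.x i - s.x j‖ ^ 2)
      + (1 + 1 / θ) * η ^ 2 * ∑ j, ‖halfG f S s j‖ ^ 2 := by
  refine (wvar_le hu1 _ (wmean u s.x)).trans ?_
  have h1 : ∀ i, u i * ‖(step f η A B S s).x i - wmean u s.x‖ ^ 2
      ≤ (1 + θ) * (u i * ‖∑ j, A i j • s.x j - wmean u s.x‖ ^ 2)
        + u i * ((1 + 1 / θ) * η ^ 2 * ∑ j, ‖halfG f S s j‖ ^ 2) := fun i => by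
    have e : (step f η A B S s).x i - wmean u s.x = (∑ j, A i j • s.x j - wmean u s.x)
        + (-(η • ∑ j, (A i j * ind S j) • halfG f S s j)) := by rw [step_x_eq]; abel
    have a1 := norm_add_sq_le_theta (∑ j, A i j • s.x j - wmean u s.x)
      (-(η • ∑ j, (A i j * ind S j) • halfG f S s j)) hθ
    rw [← e, norm_neg, norm_smul, mul_pow, Real.norm_eq_abs, sq_abs] at a1
    have a2 := norm_sq_mixed_halfG_le f (fun j => Matrix.nonneg_of_mem_rowStochastic hA)
      (Matrix.sum_row_of_mem_rowStochastic hA i) S s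
    have a3 : (1 + 1 / θ) * (η ^ 2 * ‖∑ j, (A i j * ind S j) • halfG f S s j‖ ^ 2)
        ≤ (1 + 1 / θ) * (η ^ 2 * ∑ j, ‖halfG f S s j‖ ^ 2) := by gcongr
    calc _ ≤ u i * ((1 + θ) * ‖∑ j, A i j • s.x j - wmean u s.x‖ ^ 2
          + (1 + 1 / θ) * (η ^ 2 * ∑ j, ‖halfG f S s j‖ ^ 2)) :=
          mul_le_mul_of_nonneg_left (a1.trans (by linarith)) (hu i)
      _ = _ := by ring
  refine (Finset.sum_le_sum fun i _ => h1 i).trans ?_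
  rw [Finset.sum_add_distrib, ← Finset.mul_sum, ← Finset.sum_mul, hu1, one_mul]
  have := sum_mul_norm_mix_sq_le hA hδ hu s.x (wmean u s.x)
  gcongr

/-- The displacement is what makes gradients stale. Its mixing part is measured from the weighted
mean, hence is small once the nodes nearly agree. -/
lemma sum_norm_sq_step_sub_le [DecidableEq ι] (f : ι → E → ℝ) {η : ℝ} {A : Matrix ι ι ℝ}
    (B : Matrix ι ι ℝ) (hA : A ∈ Matrix.rowStochastic ℝ ι) (S : Finset ι)
    (s : State ι E) (u : ι → ℝ) :
    ∑ i, ‖(step f η A B S s).x i - s.x i‖ ^ 2 ≤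
      Fintype.card ι * (6 * spreadSq u s.x + 3 * η ^ 2 * ∑ j, ‖halfG f S s j‖ ^ 2) := by
  have h1 : ∀ i, ‖(step f η A B S s).x i - s.x i‖ ^ 2 ≤
      6 * spreadSq u s.x + 3 * η ^ 2 * ∑ j, ‖halfG f S s j‖ ^ 2 := fun i => by
    have hr := Matrix.sum_row_of_mem_rowStochastic hA i
    have h0 : ∀ j, 0 ≤ A i j := fun j => Matrix.nonneg_of_mem_rowStochastic hA
    have e : (step f η A B S s).x i - s.x i = (∑ j, A i j • (s.x j - wmean u s.x))
        + (-(s.x i - wmean u s.x)) + (-(η • ∑ j, (A i j * ind S j) • halfG f S s j)) := by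
      rw [step_x_eq, wmean_sub_const hr, wmean]; abel
    have a1 := norm_add_three_sq_le (∑ j, A i j • (s.x j - wmean u s.x))
      (-(s.x i - wmean u s.x)) (-(η • ∑ j, (A i j * ind S j) • halfG f S s j))
    rw [← e, norm_neg, norm_neg, norm_smul, mul_pow, Real.norm_eq_abs, sq_abs] at a1
    have a2 := norm_sq_mixed_halfG_le f h0 hr S s
    have a3 : ‖∑ j, A i j • (s.x j - wmean u s.x)‖ ^ 2 ≤ spreadSq u s.x :=
      norm_sum_smul_sq_le_sum _ _ h0 hr.le
    have a4 : ‖s.x i - wmean u s.x‖ ^ 2 ≤ spreadSq u s.x :=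
      Finset.single_le_sum (f := fun i => ‖s.x i - wmean u s.x‖ ^ 2) (fun j _ => sq_nonneg _)
        (Finset.mem_univ i)
    have a5 : η ^ 2 * ‖∑ j, (A i j * ind S j) • halfG f S s j‖ ^ 2
        ≤ η ^ 2 * ∑ j, ‖halfG f S s j‖ ^ 2 := by gcongr
    linarith
  refine (Finset.sum_le_sum fun i _ => h1 i).trans (le_of_eq ?_)
  rw [Finset.sum_const, Finset.card_univ, nsmul_eq_mul]

/-- A sampled node stores the gradient at its current iterate, so its new staleness comes from the
displacement alone; an unsampled node adds the displacement to the old staleness. -/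
lemma gradientSq_step_le [DecidableEq ι] {f : ι → E → ℝ} {L : ℝ≥0}
    (hL : ∀ i, LipschitzWith L (gradient (f i))) (η : ℝ) {θ : ℝ} (hθ : 0 < θ) (A B : Matrix ι ι ℝ)
    (S : Finset ι) (s : State ι E) :
    gradientSq f (step f η A B S s) ≤
      (1 + θ) * ∑ i, (1 - ind S i) * ‖staleness f s i‖ ^ 2
      + (1 + 1 / θ) * L ^ 2 * ∑ i, ‖(step f η A B S s).x i - s.x i‖ ^ 2 := by
  rw [Finset.mul_sum, Finset.mul_sum, ← Finset.sum_add_distrib]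
  refine Finset.sum_le_sum fun i _ => ?_
  set y := (step f η A B S s).x i
  have h1 := norm_sq_gradient_sub_le hL i y (s.x i)
  have hc : (step f η A B S s).c i = if i ∈ S then s.x i else s.c i := rfl
  rw [hc]
  unfold ind
  split_ifs with h
  · have : 0 ≤ 1 / θ * (L ^ 2 * ‖y - s.x i‖ ^ 2) := by positivity
    nlinarith
  · have e : gradient (f i) y - gradient (f i) (s.c i)
        = staleness f s i + (gradient (f i) y - gradient (f i) (s.x i)) := by
      rw [staleness]; abel
    rw [e, sub_zero, one_mul]
    refine (norm_add_sq_le_theta _ _ hθ).trans ?_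
    rw [mul_assoc (1 + 1 / θ)]
    gcongr

/-- Sampling adds to the trackers exactly the increments of the stored gradients, and a
column-stochastic matrix preserves totals. -/
lemma conserved_step [DecidableEq ι] {f : ι → E → ℝ} (η : ℝ) (A : Matrix ι ι ℝ) {B : Matrix ι ι ℝ}
    (hB : B ∈ Matrix.colStochastic ℝ ι) (S : Finset ι) {w : ι → ℝ} {s : State ι E}
    (hs : Conserved f w s) : Conserved f (B.mulVec w) (step f η A B S s) where
  sum_G := by
    change ∑ i, ∑ j, B i j • halfG f S s j = ∑ i, gradient (f i) (if i ∈ S then s.x i else s.c i)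
    rw [Finset.sum_comm]
    simp only [← Finset.sum_smul, Matrix.sum_col_of_mem_colStochastic hB, one_smul, halfG_eq,
      Finset.sum_add_distrib]
    rw [hs.sum_G, ← Finset.sum_add_distrib]
    refine Finset.sum_congr rfl fun i _ => ?_
    unfold ind staleness
    split_ifs <;> simp
  nonneg := Matrix.nonneg_mulVec_of_mem_colStochastic hB hs.nonneg
  sum_one := by rw [Matrix.sum_mulVec_of_mem_colStochastic hB, hs.sum_one]

/-- Change of the tracking error in one step. -/
lemma sum_smul_trackErr_step [DecidableEq ι] {f : ι → E → ℝ} (η : ℝ) (A : Matrix ι ι ℝ)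
    {B : Matrix ι ι ℝ} (hB : B ∈ Matrix.colStochastic ℝ ι) (S : Finset ι) (w : ι → ℝ)
    (s : State ι E) (y : ι → ℝ) :
    ∑ i, y i • trackErr (B.mulVec w) (step f η A B S s) i
      = ∑ j, (∑ i, B i j * y i) • trackErr w s j
        + ∑ j, (∑ i, B i j * y i) • (ind S j • staleness f s j
          - w j • ∑ k, ind S k • staleness f s k) := by
  have hsum : ∑ i, (step f η A B S s).G i = ∑ j, halfG f S s j := by
    change ∑ i, ∑ j, B i j • halfG f S s j = _
    rw [Finset.sum_comm]
    simp only [← Finset.sum_smul, Matrix.sum_col_of_mem_colStochastic hB, one_smul]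
  -- Mixed trackers and mixed weights undergo the same linear map, so `B` factors out of the
  -- deviation and can be moved onto the test vector `y`.
  have h1 : ∀ i, trackErr (B.mulVec w) (step f η A B S s) i
      = ∑ j, B i j • (halfG f S s j - w j • ∑ k, halfG f S s k) := fun i => by
    rw [trackErr, hsum]
    change ∑ j, B i j • halfG f S s j - (∑ j, B i j * w j) • ∑ j, halfG f S s j = _
    simp only [smul_sub, Finset.sum_sub_distrib, smul_smul, Finset.sum_smul]
  have h2 : ∀ j, halfG f S s j - w j • ∑ k, halfG f S s k = trackErr w s j
      + (ind S j • staleness f s j - w j • ∑ k, ind S k • staleness f s k) := fun j => by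
    simp only [halfG_eq, Finset.sum_add_distrib, smul_add, trackErr]; abel
  rw [← Finset.sum_add_distrib]
  simp only [← smul_add, ← h2]
  simp only [h1, Finset.smul_sum, Finset.sum_smul]
  rw [Finset.sum_comm]
  refine Finset.sum_congr rfl fun j _ => Finset.sum_congr rfl fun i _ => ?_
  rw [smul_smul, mul_comm]

omit [CompleteSpace E] in
-- A zero-sum family does not see constants, so `y` may be centred. This is why the variance of the
-- test vector is the right scale for the trackers.
lemma norm_sq_sum_smul_le_of_sum_eq_zero {y : ι → ℝ} {e : ι → E} (he : ∑ i, e i = 0) (z : ℝ) :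
    ‖∑ i, y i • e i‖ ^ 2 ≤ (∑ i, (y i - z) ^ 2) * ∑ i, ‖e i‖ ^ 2 := by
  have : ∑ i, y i • e i = ∑ i, (y i - z) • e i := by
    simp only [sub_smul, Finset.sum_sub_distrib, ← Finset.smul_sum, he, smul_zero, sub_zero]
  rw [this]
  exact norm_sum_smul_sq_le_sum_sq _ _

/-- The input has zero sum because the weights sum to one, so only the centred part of `Bᵀ y`
matters. Each entry of `Bᵀ y` is a convex combination of entries of `y`, which bounds it by the
spread of `y`. -/
lemma norm_sq_trackErr_input_le [DecidableEq ι] [Nonempty ι] {f : ι → E → ℝ} {B : Matrix ι ι ℝ}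
    (hB : B ∈ Matrix.colStochastic ℝ ι) (S : Finset ι) {w : ι → ℝ}
    {s : State ι E} (hs : Conserved f w s) (y : ι → ℝ) (uB : ι → ℝ) :
    ‖∑ j, (∑ i, B i j * y i) • (ind S j • staleness f s j
          - w j • ∑ k, ind S k • staleness f s k)‖ ^ 2
      ≤ 4 * (Fintype.card ι : ℝ) ^ 3 * spreadSq uB y * gradientSq f s := by
  set M : ℝ := (Fintype.card ι : ℝ) with hM
  have hM1 : 1 ≤ M := by rw [hM]; exact_mod_cast Fintype.card_pos
  have hH := gradientSq_nonneg f s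
  have hX := spreadSq_nonneg uB y
  set ε : ι → E := fun j => ind S j • staleness f s j
          - w j • ∑ k, ind S k • staleness f s k with hε
  have h0 : ∑ j, ε j = 0 := by
    simp only [hε, Finset.sum_sub_distrib, ← Finset.sum_smul, hs.sum_one, one_smul, sub_self]
  refine (norm_sq_sum_smul_le_of_sum_eq_zero h0 (wmean uB y)).trans ?_
  have hst : ∀ k, ‖ind S k • staleness f s k‖ ^ 2 ≤ ‖staleness f s k‖ ^ 2 := fun k => by
    refine pow_le_pow_left₀ (norm_nonneg _) ?_ 2
    rw [norm_smul, Real.norm_of_nonneg (ind_nonneg S k)]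
    exact mul_le_of_le_one_left (norm_nonneg _) (ind_le_one S k)
  have h1 : ∑ j, (∑ i, B i j * y i - wmean uB y) ^ 2 ≤ M * spreadSq uB y := by
    have : ∀ j, (∑ i, B i j * y i - wmean uB y) ^ 2 ≤ spreadSq uB y := fun j => by
      have hc := Matrix.sum_col_of_mem_colStochastic hB j
      have e := wmean_sub_const hc y (wmean uB y)
      have b := norm_sum_smul_sq_le_sum (fun i => B i j) (fun i => y i - wmean uB y)
        (fun i => Matrix.nonneg_of_mem_colStochastic hB) hc.le
      rw [e, Real.norm_eq_abs, sq_abs] at b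
      exact b
    refine (Finset.sum_le_sum fun j _ => this j).trans (le_of_eq ?_)
    rw [Finset.sum_const, Finset.card_univ, nsmul_eq_mul]
  have h2 : ∑ j, ‖ε j‖ ^ 2 ≤ 4 * M ^ 2 * gradientSq f s := by
    have hS : ‖∑ k, ind S k • staleness f s k‖ ^ 2 ≤ M * gradientSq f s := by
      refine (norm_sum_sq_le _).trans ?_
      rw [← hM]
      exact mul_le_mul_of_nonneg_left (Finset.sum_le_sum fun k _ => hst k) (by linarith)
    have : ∀ j, ‖ε j‖ ^ 2 ≤ 2 * ‖staleness f s j‖ ^ 2 + 2 * (M * gradientSq f s) := fun j => by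
      have b := norm_add_sq_le_two (ind S j • staleness f s j)
        (-(w j • ∑ k, ind S k • staleness f s k))
      rw [← sub_eq_add_neg, norm_neg] at b
      have b2 : ‖w j • ∑ k, ind S k • staleness f s k‖ ^ 2 ≤ M * gradientSq f s := by
        refine le_trans (pow_le_pow_left₀ (norm_nonneg _) ?_ 2) hS
        rw [norm_smul, Real.norm_of_nonneg (hs.nonneg j)]
        exact mul_le_of_le_one_left (norm_nonneg _) (hs.le_one j)
      have := hst j
      linarith
    refine (Finset.sum_le_sum fun j _ => this j).trans ?_
    rw [Finset.sum_add_distrib, ← Finset.mul_sum, Finset.sum_const, Finset.card_univ, nsmul_eq_mul,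
      ← hM]
    change 2 * gradientSq f s + _ ≤ _
    have : gradientSq f s ≤ M ^ 2 * gradientSq f s :=
      le_mul_of_one_le_left hH (one_le_pow₀ hM1)
    nlinarith
  calc _ ≤ (M * spreadSq uB y) * (4 * M ^ 2 * gradientSq f s) := by
        gcongr
    _ = _ := by ring

/-- Change of the squared distance of the weighted mean to the minimizer in one step. -/
lemma norm_sq_wmean_step_sub_le [DecidableEq ι] {f : ι → E → ℝ} {L : ℝ≥0}
    (hL : ∀ i, LipschitzWith L (gradient (f i))) {η m lam : ℝ} (hη : 0 ≤ η) (hlam : 0 < lam)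
    {A : Matrix ι ι ℝ} (B : Matrix ι ι ℝ) (hA : A ∈ Matrix.rowStochastic ℝ ι) (S : Finset ι)
    {w : ι → ℝ} {s : State ι E} (hs : Conserved f w s) {u : ι → ℝ} (hu : ∀ i, 0 ≤ u i)
    (hu1 : ∑ i, u i = 1) {z : E} (hz : ∀ y, m * ‖y - z‖ ^ 2 ≤ inner ℝ (gradSum f y) (y - z)) :
    ‖wmean u (step f η A B S s).x - z‖ ^ 2 ≤ ‖wmean u s.x - z‖ ^ 2
      + 2 * ∑ j, (∑ i, u i * A i j - u j) * inner ℝ (wmean u s.x - z) (s.x j - wmean u s.x)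
      - 2 * η * m * ∑ j, ((∑ i, u i * A i j) * ind S j) * (w j * ‖wmean u s.x - z‖ ^ 2)
      + η * lam * ‖wmean u s.x - z‖ ^ 2
      + η / lam * ((6 * Fintype.card ι + 3) * gradientSq f s
        + 6 * Fintype.card ι * L ^ 2 * spreadSq u s.x + 3 * trackingSq w s)
      + 2 * Fintype.card ι * spreadSq u s.x + 2 * η ^ 2 * ∑ j, ‖halfG f S s j‖ ^ 2 := by
  set M : ℝ := (Fintype.card ι : ℝ) with hM
  set v : ι → ℝ := fun j => ∑ i, u i * A i j with hv
  have hv0 : ∀ j, 0 ≤ v j := fun j => Finset.sum_nonneg fun i _ =>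
    mul_nonneg (hu i) (Matrix.nonneg_of_mem_rowStochastic hA)
  have hv1 : ∑ j, v j = 1 := by
    rw [← hu1, Finset.sum_comm]
    refine Finset.sum_congr rfl fun i _ => ?_
    rw [← Finset.mul_sum, Matrix.sum_row_of_mem_rowStochastic hA, mul_one]
  have hvle : ∀ j, v j ≤ 1 := fun j => by
    rw [← hv1]; exact Finset.single_le_sum (fun j _ => hv0 j) (Finset.mem_univ j)
  have hule : ∀ j, u j ≤ 1 := fun j => by
    rw [← hu1]; exact Finset.single_le_sum (fun j _ => hu j) (Finset.mem_univ j)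
  set xt := wmean u s.x with hxt
  -- The shift of the weighted mean caused by mixing alone. It averages to zero, but its square is
  -- of order one in the spread and must be kept.
  set n : E := ∑ j, (v j - u j) • (s.x j - xt) with hn
  set q : E := ∑ j, (v j * ind S j) • halfG f S s j with hq
  have hmean : wmean u (step f η A B S s).x = ∑ j, v j • s.x j - η • q := by
    simp only [wmean, step_x_eq, smul_sub, Finset.sum_sub_distrib, hq, hv, Finset.sum_smul,
      Finset.smul_sum, Finset.sum_mul, smul_smul]
    congr 1
    · rw [Finset.sum_comm]
    · rw [Finset.sum_comm]
      refine Finset.sum_congr rfl fun j _ => Finset.sum_congr rfl fun i _ => ?_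
      congr 1; ring
  have hdec : wmean u (step f η A B S s).x - z = (xt - z) + (n - η • q) := by
    have : n = ∑ j, v j • s.x j - xt := by
      simp only [hn, sub_smul, Finset.sum_sub_distrib]
      rw [wmean_sub_const hv1, wmean_sub_const hu1, wmean, ← hxt, sub_self, sub_zero]
    rw [hmean, this]; abel
  have hin : inner ℝ (xt - z) n = ∑ j, (v j - u j) * inner ℝ (xt - z) (s.x j - xt) := by
    simp only [hn, inner_sum, real_inner_smul_right]
  have hnn : ‖n‖ ^ 2 ≤ M * spreadSq u s.x := by
    refine (norm_sum_smul_sq_le_sum_sq _ _).trans ?_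
    refine mul_le_mul_of_nonneg_right ?_ (spreadSq_nonneg u s.x)
    have : ∑ j, (v j - u j) ^ 2 ≤ ∑ _j : ι, (1 : ℝ) := Finset.sum_le_sum fun j _ => by
      have := hv0 j; have := hvle j; have := hu j; have := hule j
      nlinarith
    simpa using this
  have hqq : ‖q‖ ^ 2 ≤ ∑ j, ‖halfG f S s j‖ ^ 2 := norm_sq_mixed_halfG_le f hv0 hv1 S s
  have hnq : ‖n - η • q‖ ^ 2 ≤ 2 * M * spreadSq u s.x + 2 * η ^ 2 * ∑ j, ‖halfG f S s j‖ ^ 2 := by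
    have b := norm_add_sq_le_two n (-(η • q))
    rw [← sub_eq_add_neg, norm_neg, norm_smul, mul_pow, Real.norm_eq_abs, sq_abs] at b
    have : η ^ 2 * ‖q‖ ^ 2 ≤ η ^ 2 * ∑ j, ‖halfG f S s j‖ ^ 2 := by gcongr
    linarith
  set a : ℝ := ∑ j, (v j * ind S j) * w j with ha
  have hvi : ∀ j, 0 ≤ v j * ind S j := fun j => mul_nonneg (hv0 j) (ind_nonneg S j)
  have hvi1 : ∑ j, v j * ind S j ≤ 1 := by
    rw [← hv1]
    exact Finset.sum_le_sum fun j _ => mul_le_of_le_one_right (hv0 j) (ind_le_one S j)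
  have ha0 : 0 ≤ a := Finset.sum_nonneg fun j _ => mul_nonneg (hvi j) (hs.nonneg j)
  have ha1 : a ≤ 1 := by
    refine le_trans (Finset.sum_le_sum fun j _ => ?_) hvi1
    exact mul_le_of_le_one_right (hvi j) (hs.le_one j)
  set r : E := ∑ i, s.G i - gradSum f xt with hr
  -- The perturbation of the ideal direction `a • gradSum f xt`: error of the tracker sum, tracker
  -- deviations and fresh corrections. All of them are small in the other three errors.
  set q₂ : E := a • r + ∑ j, (v j * ind S j) • trackErr w s j
    + ∑ j, (v j * ind S j * ind S j) • staleness f s j with hq2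
  have hqdec : q = a • gradSum f xt + q₂ := by
    have e : ∀ j, halfG f S s j = trackErr w s j + w j • ∑ k, s.G k + ind S j • staleness f s j :=
      fun j => by rw [halfG_eq, trackErr, sub_add_cancel]
    simp only [hq, e, smul_add, Finset.sum_add_distrib, smul_smul]
    rw [← Finset.sum_smul, ← ha]
    rw [hq2, hr, smul_sub]; abel
  have hq2n : ‖q₂‖ ^ 2 ≤ (6 * M + 3) * gradientSq f s + 6 * M * L ^ 2 * spreadSq u s.x
      + 3 * trackingSq w s := by
    have b := norm_add_three_sq_le (a • r) (∑ j, (v j * ind S j) • trackErr w s j)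
      (∑ j, (v j * ind S j * ind S j) • staleness f s j)
    have b1 : ‖a • r‖ ^ 2 ≤ ‖r‖ ^ 2 := by
      refine pow_le_pow_left₀ (norm_nonneg _) ?_ 2
      rw [norm_smul, Real.norm_of_nonneg ha0]
      exact mul_le_of_le_one_left (norm_nonneg _) ha1
    have b2 := norm_sq_sum_G_sub_le hL hs u
    have b3 : ‖∑ j, (v j * ind S j) • trackErr w s j‖ ^ 2 ≤ trackingSq w s :=
      norm_sum_smul_sq_le_sum _ _ hvi hvi1
    have b4 : ‖∑ j, (v j * ind S j * ind S j) • staleness f s j‖ ^ 2 ≤ gradientSq f s := by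
      refine norm_sum_smul_sq_le_sum _ _ (fun j => mul_nonneg (hvi j) (ind_nonneg S j)) ?_
      exact le_trans (Finset.sum_le_sum fun j _ =>
        mul_le_of_le_one_right (hvi j) (ind_le_one S j)) hvi1
    rw [← hq2] at b
    rw [← hM, ← hxt, ← hr] at b2
    linarith
  have hcross : -(2 * inner ℝ (xt - z) q₂) ≤ lam * ‖xt - z‖ ^ 2 + 1 / lam * ‖q₂‖ ^ 2 := by
    have c1 : -(inner ℝ (xt - z) q₂) ≤ ‖xt - z‖ * ‖q₂‖ := by
      have := real_inner_le_norm (xt - z) (-q₂)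
      rwa [inner_neg_right, norm_neg] at this
    have c2 : 0 ≤ (lam * ‖xt - z‖ - ‖q₂‖) ^ 2 / lam := by positivity
    have c3 : (lam * ‖xt - z‖ - ‖q₂‖) ^ 2 / lam
        = lam * ‖xt - z‖ ^ 2 - 2 * (‖xt - z‖ * ‖q₂‖) + 1 / lam * ‖q₂‖ ^ 2 := by
      field_simp; ring
    linarith
  have hmono := hz xt
  rw [real_inner_comm] at hmono
  have hsuma : ∑ j, (v j * ind S j) * (w j * ‖xt - z‖ ^ 2) = a * ‖xt - z‖ ^ 2 := by
    rw [ha, Finset.sum_mul]; exact Finset.sum_congr rfl fun j _ => by ring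
  have hfull : ‖wmean u (step f η A B S s).x - z‖ ^ 2 = ‖xt - z‖ ^ 2 + 2 * inner ℝ (xt - z) n
      - 2 * η * (a * inner ℝ (xt - z) (gradSum f xt)) + η * (-(2 * inner ℝ (xt - z) q₂))
      + ‖n - η • q‖ ^ 2 := by
    have hiq : inner ℝ (xt - z) q = a * inner ℝ (xt - z) (gradSum f xt) + inner ℝ (xt - z) q₂ := by
      rw [hqdec, inner_add_right, real_inner_smul_right]
    rw [hdec, norm_add_sq_real, inner_sub_right, real_inner_smul_right, hiq]
    ring
  have d1 : 2 * η * (a * (m * ‖xt - z‖ ^ 2)) ≤ 2 * η * (a * inner ℝ (xt - z) (gradSum f xt)) := by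
    gcongr
  have d2 : η * (-(2 * inner ℝ (xt - z) q₂)) ≤ η * (lam * ‖xt - z‖ ^ 2 + 1 / lam *
      ((6 * M + 3) * gradientSq f s + 6 * M * L ^ 2 * spreadSq u s.x + 3 * trackingSq w s)) := by
    refine mul_le_mul_of_nonneg_left (hcross.trans ?_) hη
    gcongr
  rw [hfull, hin, hsuma]
  have d3 : η / lam * ((6 * M + 3) * gradientSq f s + 6 * M * L ^ 2 * spreadSq u s.x
      + 3 * trackingSq w s) = η * (1 / lam * ((6 * M + 3) * gradientSq f s
      + 6 * M * L ^ 2 * spreadSq u s.x + 3 * trackingSq w s)) := by ring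
  rw [d3]
  linarith

end Pathwise

/-! ### Adaptedness, integrability and independence. -/

section Probability

variable {ι E Ω : Type*} [Fintype ι] [DecidableEq ι] [NormedAddCommGroup E]
  [InnerProductSpace ℝ E] [CompleteSpace E] [MeasurableSpace Ω] {P : Measure Ω}
  {A B : ℕ → Ω → Matrix ι ι ℝ} {S : ℕ → Ω → Finset ι} {p : ι → ℝ} {δ : ℝ}

omit [MeasurableSpace Ω] in
/-- The random input of the iteration at time `t`. -/
def input (A B : ℕ → Ω → Matrix ι ι ℝ) (S : ℕ → Ω → Finset ι) (t : ℕ) (ω : Ω) :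
    Matrix ι ι ℝ × Matrix ι ι ℝ × Finset ι := (A t ω, B t ω, S t ω)

/-- The events determined by the inputs before time `t`. -/
@[reducible]
def past (A B : ℕ → Ω → Matrix ι ι ℝ) (S : ℕ → Ω → Finset ι) (t : ℕ) : MeasurableSpace Ω :=
  ⨆ s ∈ Set.Iio t, MeasurableSpace.comap (input A B S s) inferInstance

/-- State and tracker weights as a point of a normed space. -/
noncomputable def stateTuple (f : ι → E → ℝ) (η : ℝ) (A B : ℕ → Ω → Matrix ι ι ℝ)
    (S : ℕ → Ω → Finset ι) (s₀ : State ι E) (t : ℕ) (ω : Ω) :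
    (ι → E) × (ι → E) × (ι → E) × (ι → ℝ) :=
  ((run f η A B S s₀ t ω).x, (run f η A B S s₀ t ω).c, (run f η A B S s₀ t ω).G, weight B t ω)

/-- The state encoded by a tuple. -/
def toState (q : (ι → E) × (ι → E) × (ι → E) × (ι → ℝ)) : State ι E := ⟨q.1, q.2.1, q.2.2.1⟩

omit [Fintype ι] [DecidableEq ι] [MeasurableSpace Ω] in
lemma past_mono {t t' : ℕ} (h : t ≤ t') : past A B S t ≤ past A B S t' :=
  biSup_mono fun _ hs => lt_of_lt_of_le hs h

omit [Fintype ι] [DecidableEq ι] in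
lemma measurable_matrix_apply (i j : ι) : Measurable fun M : Matrix ι ι ℝ => M i j :=
  (measurable_pi_apply j).comp (measurable_pi_apply (X := fun _ : ι => ι → ℝ) i)

lemma Environment.measurable_input (henv : Environment P A B S p δ) (t : ℕ) :
    Measurable (input A B S t) :=
  (henv.measurable_A t).prodMk ((henv.measurable_B t).prodMk (henv.measurable_S t))

lemma Environment.past_le (henv : Environment P A B S p δ) (t : ℕ) :
    past A B S t ≤ (inferInstance : MeasurableSpace Ω) :=
  iSup₂_le fun s _ => (henv.measurable_input s).comap_le

lemma Environment.indep_past (henv : Environment P A B S p δ) (t : ℕ) :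
    Indep (MeasurableSpace.comap (input A B S t) inferInstance) (past A B S t) P := by
  have h := indep_iSup_of_disjoint (fun s => (henv.measurable_input s).comap_le) henv.indep
    (S := {t}) (T := Set.Iio t) (by simp)
  rwa [iSup_singleton] at h

omit [Fintype ι] in
lemma measurable_ind (i : ι) : Measurable fun T : Finset ι => ind T i :=
  Measurable.ite (measurableSet_setOfPred.2 (by fun_prop)) measurable_const measurable_const

variable [MeasurableSpace E] [BorelSpace E] [SecondCountableTopology E]

omit [MeasurableSpace Ω] in
lemma measurable_stateTuple {f : ι → E → ℝ} (hf : ∀ i, Continuous (gradient (f i))) (η : ℝ)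
    (s₀ : State ι E) (t : ℕ) :
    Measurable[past A B S t] (stateTuple f η A B S s₀ t) := by
  induction t with
  | zero =>
    exact @measurable_const _ _ _ (past A B S 0)
      (s₀.x, s₀.c, s₀.G, fun _ : ι => 1 / (Fintype.card ι : ℝ))
  | succ t ih =>
    have h1 : Measurable[past A B S (t + 1)] (input A B S t) := by
      have : MeasurableSpace.comap (input A B S t) inferInstance ≤ past A B S (t + 1) :=
        le_biSup (fun s => MeasurableSpace.comap (input A B S s) inferInstance)
          (Set.mem_Iio.2 (Nat.lt_succ_self t))
      exact measurable_iff_comap_le.2 this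
    have h2 : Measurable[past A B S (t + 1)] (stateTuple f η A B S s₀ t) :=
      ih.mono (past_mono (Nat.le_succ t)) le_rfl
    -- One iteration as a deterministic measurable map of the new input and the old state.
    let Φ : (Matrix ι ι ℝ × Matrix ι ι ℝ × Finset ι) × ((ι → E) × (ι → E) × (ι → E) × (ι → ℝ)) →
        (ι → E) × (ι → E) × (ι → E) × (ι → ℝ) := fun r =>
      ((step f η r.1.1 r.1.2.1 r.1.2.2 (toState r.2)).x,
        (step f η r.1.1 r.1.2.1 r.1.2.2 (toState r.2)).c,
        (step f η r.1.1 r.1.2.1 r.1.2.2 (toState r.2)).G, r.1.2.1.mulVec r.2.2.2.2)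
    have hgrad : ∀ i, Measurable (gradient (f i)) := fun i => (hf i).measurable
    have hA : ∀ i j, Measurable fun r : (Matrix ι ι ℝ × Matrix ι ι ℝ × Finset ι) ×
        ((ι → E) × (ι → E) × (ι → E) × (ι → ℝ)) => r.1.1 i j := fun i j =>
      (measurable_matrix_apply i j).comp (by fun_prop)
    have hB : ∀ i j, Measurable fun r : (Matrix ι ι ℝ × Matrix ι ι ℝ × Finset ι) ×
        ((ι → E) × (ι → E) × (ι → E) × (ι → ℝ)) => r.1.2.1 i j := fun i j =>
      (measurable_matrix_apply i j).comp (by fun_prop)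
    have hI : ∀ i, Measurable fun r : (Matrix ι ι ℝ × Matrix ι ι ℝ × Finset ι) ×
        ((ι → E) × (ι → E) × (ι → E) × (ι → ℝ)) => ind r.1.2.2 i := fun i =>
      (measurable_ind i).comp (by fun_prop)
    have hG : ∀ i, Measurable fun r : (Matrix ι ι ℝ × Matrix ι ι ℝ × Finset ι) ×
        ((ι → E) × (ι → E) × (ι → E) × (ι → ℝ)) => halfG f r.1.2.2 (toState r.2) i := fun i => by
      simp only [halfG_eq, toState, staleness]
      have := hI i; have := hgrad i
      fun_prop
    have hΦ : Measurable Φ := by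
      refine Measurable.prodMk ?_ (Measurable.prodMk ?_ (Measurable.prodMk ?_ ?_))
      · refine measurable_pi_iff.2 fun i => ?_
        change Measurable fun r : (Matrix ι ι ℝ × Matrix ι ι ℝ × Finset ι) ×
          ((ι → E) × (ι → E) × (ι → E) × (ι → ℝ)) =>
            ∑ j, r.1.1 i j • halfX f η r.1.2.2 (toState r.2) j
        refine Finset.measurable_sum _ fun j _ => (hA i j).smul ?_
        simp only [halfX_eq]
        have := hI j; have := hG j
        unfold toState at this ⊢
        fun_prop
      · refine measurable_pi_iff.2 fun i => ?_
        refine Measurable.ite (measurableSet_setOfPred.2 ?_) ?_ ?_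
        · fun_prop
        · unfold toState; fun_prop
        · unfold toState; fun_prop
      · refine measurable_pi_iff.2 fun i => ?_
        exact Finset.measurable_sum _ fun j _ => (hB i j).smul (hG j)
      · refine measurable_pi_iff.2 fun i => ?_
        refine Finset.measurable_sum _ fun j _ => (hB i j).mul ?_
        fun_prop
    exact hΦ.comp (h1.prodMk h2)

omit [DecidableEq ι] [CompleteSpace E] [MeasurableSpace E] [BorelSpace E]
  [SecondCountableTopology E] in
lemma norm_sum_smul_le_card_mul {c : ι → ℝ} {y : ι → E} {K : ℝ} (h0 : ∀ j, 0 ≤ c j)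
    (h1 : ∀ j, c j ≤ 1) (hy : ∀ j, ‖y j‖ ≤ K) : ‖∑ j, c j • y j‖ ≤ Fintype.card ι * K := by
  refine (norm_sum_le _ _).trans ?_
  refine (Finset.sum_le_sum (g := fun _ => K) fun j _ => ?_).trans (by simp)
  rw [norm_smul, Real.norm_of_nonneg (h0 j)]
  exact (mul_le_of_le_one_left (norm_nonneg _) (h1 j)).trans (hy j)

omit [MeasurableSpace E] [BorelSpace E] [SecondCountableTopology E] in
lemma norm_step_le {f : ι → E → ℝ} {L : ℝ≥0} (hL : ∀ i, LipschitzWith L (gradient (f i))) {η R : ℝ}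
    {A B : Matrix ι ι ℝ} (hA : A ∈ Matrix.rowStochastic ℝ ι) (hB : B ∈ Matrix.colStochastic ℝ ι)
    (S : Finset ι) {s : State ι E} (hx : ∀ i, ‖s.x i‖ ≤ R) (hc : ∀ i, ‖s.c i‖ ≤ R)
    (hG : ∀ i, ‖s.G i‖ ≤ R) :
    (∀ i, ‖(step f η A B S s).x i‖ ≤ Fintype.card ι * (R + |η| * (R + L * (R + R)))) ∧
    (∀ i, ‖(step f η A B S s).c i‖ ≤ R) ∧
    (∀ i, ‖(step f η A B S s).G i‖ ≤ Fintype.card ι * (R + L * (R + R))) := by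
  have h1 : ∀ i, ‖halfG f S s i‖ ≤ R + L * (R + R) := fun i => by
    rw [halfG_eq]
    refine (norm_add_le _ _).trans (add_le_add (hG i) ?_)
    rw [norm_smul, Real.norm_of_nonneg (ind_nonneg S i)]
    refine (mul_le_of_le_one_left (norm_nonneg _) (ind_le_one S i)).trans ?_
    refine ((hL i).norm_sub_le _ _).trans ?_
    gcongr
    exact (norm_sub_le _ _).trans (add_le_add (hx i) (hc i))
  have h2 : ∀ i, ‖halfX f η S s i‖ ≤ R + |η| * (R + L * (R + R)) := fun i => by
    rw [halfX_eq]
    refine (norm_sub_le _ _).trans (add_le_add (hx i) ?_)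
    rw [norm_smul, norm_mul, Real.norm_eq_abs, Real.norm_of_nonneg (ind_nonneg S i)]
    refine mul_le_mul ?_ (h1 i) (norm_nonneg _) (abs_nonneg _)
    exact mul_le_of_le_one_right (abs_nonneg _) (ind_le_one S i)
  refine ⟨fun i => ?_, fun i => ?_, fun i => ?_⟩
  · exact norm_sum_smul_le_card_mul (fun j => Matrix.nonneg_of_mem_rowStochastic hA)
      (fun j => Matrix.le_one_of_mem_rowStochastic hA) h2
  · change ‖if i ∈ S then s.x i else s.c i‖ ≤ R
    split_ifs
    exacts [hx i, hc i]
  · exact norm_sum_smul_le_card_mul (fun j => Matrix.nonneg_of_mem_colStochastic hB)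
      (fun j => Matrix.le_one_of_mem_colStochastic hB) h1

omit [MeasurableSpace E] [BorelSpace E] [SecondCountableTopology E] in
-- The initial state is deterministic and one step is of linear growth with bounded coefficients.
-- The bound may grow with `t`; it serves only integrability.
lemma Environment.exists_norm_stateTuple_le [Nonempty ι] (henv : Environment P A B S p δ)
    {f : ι → E → ℝ} {L : ℝ≥0} (hL : ∀ i, LipschitzWith L (gradient (f i))) (η : ℝ) (s₀ : State ι E)
    (t : ℕ) :
    ∃ R, ∀ᵐ ω ∂P, ‖stateTuple f η A B S s₀ t ω‖ ≤ R := by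
  induction t with
  | zero =>
    exact ⟨‖(s₀.x, s₀.c, s₀.G, fun _ : ι => 1 / (Fintype.card ι : ℝ))‖,
      Eventually.of_forall fun ω => le_rfl⟩
  | succ t ih =>
    obtain ⟨R, hR⟩ := ih
    obtain ⟨R', hR', h⟩ : ∃ R', 0 ≤ R' ∧ ∀ᵐ ω ∂P, ‖stateTuple f η A B S s₀ t ω‖ ≤ R' :=
      ⟨max R 0, le_max_right _ _, hR.mono fun ω h => h.trans (le_max_left _ _)⟩
    refine ⟨Fintype.card ι * (R' + |η| * (R' + L * (R' + R'))) + (R'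
      + (Fintype.card ι * (R' + L * (R' + R')) + Fintype.card ι * R')), ?_⟩
    filter_upwards [h, henv.row_stochastic t, henv.col_stochastic t] with ω hω hA hB
    simp only [stateTuple, norm_prod_le_iff, pi_norm_le_iff_of_nonneg hR'] at hω
    obtain ⟨hx, hc, hG, hw⟩ := hω
    obtain ⟨gx, gc, gG⟩ := norm_step_le hL (η := η) hA hB (S t ω) hx hc hG
    have gw : ∀ i, ‖(B t ω).mulVec (weight B t ω) i‖ ≤ Fintype.card ι * R' := fun i =>
      norm_sum_smul_le_card_mul (fun j => Matrix.nonneg_of_mem_colStochastic hB)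
        (fun j => Matrix.le_one_of_mem_colStochastic hB) hw
    have n1 : 0 ≤ Fintype.card ι * (R' + |η| * (R' + L * (R' + R'))) := by positivity
    have n2 : 0 ≤ Fintype.card ι * (R' + L * (R' + R')) := by positivity
    have n3 : 0 ≤ Fintype.card ι * R' := by positivity
    have n4 : 0 ≤ Fintype.card ι * (R' + |η| * (R' + L * (R' + R'))) + (R'
      + (Fintype.card ι * (R' + L * (R' + R')) + Fintype.card ι * R')) := by positivity
    simp only [stateTuple, norm_prod_le_iff, pi_norm_le_iff_of_nonneg n4]
    refine ⟨fun i => (gx i).trans (by linarith), fun i => (gc i).trans (by linarith),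
      fun i => (gG i).trans (by linarith), fun i => (gw i).trans (by linarith)⟩

omit [MeasurableSpace E] [BorelSpace E] [SecondCountableTopology E] in
lemma Environment.ae_conserved [Nonempty ι] (henv : Environment P A B S p δ) (f : ι → E → ℝ)
    (η : ℝ) {s₀ : State ι E} (hs₀ : ∑ i, s₀.G i = ∑ i, gradient (f i) (s₀.c i)) :
    ∀ᵐ ω ∂P, ∀ t, Conserved f (weight B t ω) (run f η A B S s₀ t ω) := by
  filter_upwards [ae_all_iff.2 henv.col_stochastic] with ω hω t
  induction t with
  | zero =>
    refine ⟨hs₀, fun i => ?_, ?_⟩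
    · change 0 ≤ 1 / (Fintype.card ι : ℝ)
      positivity
    · change ∑ _i : ι, 1 / (Fintype.card ι : ℝ) = 1
      simp
  | succ t ih => exact conserved_step η (A t ω) (hω t) (S t ω) ih

variable [ProperSpace E] [IsProbabilityMeasure P]

lemma Environment.integrable_stateTuple [Nonempty ι] (henv : Environment P A B S p δ)
    {f : ι → E → ℝ} {L : ℝ≥0} (hL : ∀ i, LipschitzWith L (gradient (f i))) (η : ℝ) (s₀ : State ι E)
    (t : ℕ) {Φ : (ι → E) × (ι → E) × (ι → E) × (ι → ℝ) → ℝ} (hΦ : Continuous Φ) :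
    Integrable (fun ω => Φ (stateTuple f η A B S s₀ t ω)) P := by
  obtain ⟨R, hR⟩ := henv.exists_norm_stateTuple_le hL η s₀ t
  obtain ⟨K, hK⟩ := ((isCompact_closedBall (0 : (ι → E) × (ι → E) × (ι → E) × (ι → ℝ)) R).image
    hΦ.norm).bddAbove
  have hm : Measurable (stateTuple f η A B S s₀ t) :=
    (measurable_stateTuple (fun i => (hL i).continuous) η s₀ t).mono (henv.past_le t) le_rfl
  refine Integrable.of_bound (hΦ.measurable.comp hm).aestronglyMeasurable K ?_
  filter_upwards [hR] with ω hω
  exact hK ⟨_, by simpa using hω, rfl⟩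

/-- The state at time `t` is a function of the earlier inputs, hence independent of the input at
time `t`. Independence enters the convergence proof through this factorization. -/
lemma Environment.integral_input_mul [Nonempty ι] (henv : Environment P A B S p δ)
    {f : ι → E → ℝ} {L : ℝ≥0} (hL : ∀ i, LipschitzWith L (gradient (f i))) (η : ℝ) (s₀ : State ι E)
    (t : ℕ) {φ : Matrix ι ι ℝ × Matrix ι ι ℝ × Finset ι → ℝ} (hφ : Measurable φ) {K : ℝ}
    (hK : ∀ᵐ ω ∂P, |φ (input A B S t ω)| ≤ K)
    {Φ : (ι → E) × (ι → E) × (ι → E) × (ι → ℝ) → ℝ} (hΦ : Continuous Φ) :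
    Integrable (fun ω => φ (input A B S t ω) * Φ (stateTuple f η A B S s₀ t ω)) P ∧
    ∫ ω, φ (input A B S t ω) * Φ (stateTuple f η A B S s₀ t ω) ∂P
      = (∫ ω, φ (input A B S t ω) ∂P) * ∫ ω, Φ (stateTuple f η A B S s₀ t ω) ∂P := by
  have hm := measurable_stateTuple (A := A) (B := B) (S := S) (fun i => (hL i).continuous) η s₀ t
  have hΦm : Measurable[past A B S t] fun ω => Φ (stateTuple f η A B S s₀ t ω) :=
    hΦ.measurable.comp hm
  have hφm : Measurable fun ω => φ (input A B S t ω) := hφ.comp (henv.measurable_input t)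
  have hi := henv.integrable_stateTuple hL η s₀ t hΦ
  refine ⟨hi.bdd_mul hφm.aestronglyMeasurable hK, ?_⟩
  refine IndepFun.integral_fun_mul_eq_mul_integral ?_ hφm.aestronglyMeasurable
    hi.aestronglyMeasurable
  rw [IndepFun_iff_Indep]
  refine indep_of_indep_of_le_left (indep_of_indep_of_le_right (henv.indep_past t)
    (measurable_iff_comap_le.1 hΦm)) ?_
  change MeasurableSpace.comap (φ ∘ input A B S t) _ ≤ _
  rw [← MeasurableSpace.comap_comp]
  exact MeasurableSpace.comap_mono hφ.comap_le

end Probability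

/-! ### Contraction of the variance by a mean matrix. -/

section SpectralGap

variable {ι : Type*} [Fintype ι] [DecidableEq ι]

/-- `u` is a stationary distribution of `A`, bounded below by `κ`, with Poincaré constant `c`. -/
structure SpectralGap (A : Matrix ι ι ℝ) (u : ι → ℝ) (κ c : ℝ) : Prop where
  bound_pos : 0 < κ
  bound_le : ∀ i, κ ≤ u i
  sum_one : ∑ i, u i = 1
  stationary : ∀ j, ∑ i, u i * A i j = u j
  row_sum : ∀ i, ∑ j, A i j = 1
  gap_pos : 0 < c
  gap_le : ∀ (E : Type) [NormedAddCommGroup E] [InnerProductSpace ℝ E] (x : ι → E),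
    c * wvar u x ≤ energy u A x

lemma exists_spectralGap [Nonempty ι] {A : Matrix ι ι ℝ} (hA : A ∈ Matrix.rowStochastic ℝ ι)
    (hp : A.IsPrimitive) : ∃ u κ c, SpectralGap A u κ c := by
  obtain ⟨u, hu, hu1, hs⟩ := exists_pos_stationary hA hp
  obtain ⟨c, hc, h⟩ := exists_wvar_le_energy hA hp (fun i => (hu i).le) hu1 hs
  obtain ⟨i₀, hi₀⟩ := Finite.exists_min u
  exact ⟨u, u i₀, c, hu i₀, hi₀, hu1, hs, fun i => Matrix.sum_row_of_mem_rowStochastic hA i, hc, h⟩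

omit [DecidableEq ι] in
lemma SpectralGap.nonneg {A : Matrix ι ι ℝ} {u : ι → ℝ} {κ c : ℝ} (h : SpectralGap A u κ c)
    (i : ι) : 0 ≤ u i := h.bound_pos.le.trans (h.bound_le i)

omit [DecidableEq ι] in
lemma SpectralGap.spreadSq_le {A : Matrix ι ι ℝ} {u : ι → ℝ} {κ c : ℝ} (h : SpectralGap A u κ c)
    {E : Type*} [NormedAddCommGroup E] [InnerProductSpace ℝ E] (x : ι → E) :
    spreadSq u x ≤ wvar u x / κ := by
  rw [le_div_iff₀ h.bound_pos, mul_comm]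
  exact mul_spreadSq_le_wvar h.bound_le x

omit [DecidableEq ι] in
/-- The averaged upper bound on the mixed variance is a contraction. -/
lemma SpectralGap.sum_sub_energy_le {A : Matrix ι ι ℝ} {u : ι → ℝ} {κ c δ : ℝ}
    (h : SpectralGap A u κ c) (hδ : 0 ≤ δ) {E : Type} [NormedAddCommGroup E]
    [InnerProductSpace ℝ E] (x : ι → E) :
    ∑ i, ∑ j, A i j * (u i * ‖x j - wmean u x‖ ^ 2 - δ * u i * ‖x i - x j‖ ^ 2)
      ≤ (1 - δ * c) * wvar u x := by
  have h1 : ∑ i, ∑ j, A i j * (u i * ‖x j - wmean u x‖ ^ 2 - δ * u i * ‖x i - x j‖ ^ 2)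
      = wvar u x - δ * energy u A x := by
    -- Stationarity: the `u`-average of the row averages is the `u`-average.
    have e1 : wvar u x = ∑ i, ∑ j, A i j * (u i * ‖x j - wmean u x‖ ^ 2) := by
      rw [Finset.sum_comm, wvar]
      refine Finset.sum_congr rfl fun j _ => ?_
      rw [← Finset.sum_congr rfl fun i _ => mul_left_comm (u i) (A i j) _]
      simp only [← mul_assoc]
      rw [← Finset.sum_mul, h.stationary j]
    rw [e1, energy, Finset.mul_sum, ← Finset.sum_sub_distrib]
    refine Finset.sum_congr rfl fun i _ => ?_
    rw [Finset.mul_sum, ← Finset.sum_sub_distrib]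
    exact Finset.sum_congr rfl fun j _ => by ring
  rw [h1]
  nlinarith [mul_le_mul_of_nonneg_left (h.gap_le E x) hδ]

end SpectralGap

/-! ### The mean matrices and the sampling probabilities. -/

section ExpectedMatrices

variable {ι Ω : Type*} [Fintype ι] [DecidableEq ι] [MeasurableSpace Ω] {P : Measure Ω}
  [IsProbabilityMeasure P]
  {A B : ℕ → Ω → Matrix ι ι ℝ} {S : ℕ → Ω → Finset ι} {p : ι → ℝ} {δ : ℝ}

omit [IsProbabilityMeasure P] in
lemma Environment.abs_A_le_one (henv : Environment P A B S p δ) (t : ℕ) (i j : ι) :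
    ∀ᵐ ω ∂P, |A t ω i j| ≤ 1 := by
  filter_upwards [henv.row_stochastic t] with ω h
  rw [abs_of_nonneg (Matrix.nonneg_of_mem_rowStochastic h)]
  exact Matrix.le_one_of_mem_rowStochastic h

omit [IsProbabilityMeasure P] in
lemma Environment.abs_B_le_one (henv : Environment P A B S p δ) (t : ℕ) (i j : ι) :
    ∀ᵐ ω ∂P, |B t ω i j| ≤ 1 := by
  filter_upwards [henv.col_stochastic t] with ω h
  rw [abs_of_nonneg (Matrix.nonneg_of_mem_colStochastic h)]
  exact Matrix.le_one_of_mem_colStochastic h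

lemma Environment.integrable_A (henv : Environment P A B S p δ) (t : ℕ) (i j : ι) :
    Integrable (fun ω => A t ω i j) P :=
  Integrable.of_bound ((measurable_matrix_apply i j).comp
    (henv.measurable_A t)).aestronglyMeasurable 1 (henv.abs_A_le_one t i j)

lemma Environment.integrable_B (henv : Environment P A B S p δ) (t : ℕ) (i j : ι) :
    Integrable (fun ω => B t ω i j) P :=
  Integrable.of_bound ((measurable_matrix_apply i j).comp
    (henv.measurable_B t)).aestronglyMeasurable 1 (henv.abs_B_le_one t i j)

omit [Fintype ι] [DecidableEq ι] [IsProbabilityMeasure P] in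
lemma integral_matrix_apply_eq {C C' : Ω → Matrix ι ι ℝ} (h : IdentDistrib C C' P P) (i j : ι) :
    ∫ ω, C ω i j ∂P = expMatrix P C' i j :=
  (h.comp (measurable_matrix_apply i j)).integral_eq

lemma Environment.expMatrix_A_mem (henv : Environment P A B S p δ) :
    expMatrix P (A 0) ∈ Matrix.rowStochastic ℝ ι := by
  rw [Matrix.mem_rowStochastic_iff_sum]
  refine ⟨henv.primitive_A.nonneg, fun i => ?_⟩
  change ∑ j, ∫ ω, A 0 ω i j ∂P = 1
  rw [← integral_finsetSum _ fun j _ => henv.integrable_A 0 i j]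
  rw [integral_congr_ae (g := fun _ => (1 : ℝ))]
  · simp
  · filter_upwards [henv.row_stochastic 0] with ω h
    exact Matrix.sum_row_of_mem_rowStochastic h i

lemma Environment.expMatrix_B_transpose_mem (henv : Environment P A B S p δ) :
    (expMatrix P (B 0)).transpose ∈ Matrix.rowStochastic ℝ ι := by
  rw [Matrix.mem_rowStochastic_iff_sum]
  refine ⟨fun i j => henv.primitive_B.nonneg j i, fun i => ?_⟩
  change ∑ j, ∫ ω, B 0 ω j i ∂P = 1
  rw [← integral_finsetSum _ fun j _ => henv.integrable_B 0 j i]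
  rw [integral_congr_ae (g := fun _ => (1 : ℝ))]
  · simp
  · filter_upwards [henv.col_stochastic 0] with ω h
    exact Matrix.sum_col_of_mem_colStochastic h i

lemma isPrimitive_transpose {C : Matrix ι ι ℝ} (h : C.IsPrimitive) : C.transpose.IsPrimitive := by
  obtain ⟨k, hk, hpos⟩ := h.exists_pos_pow
  refine ⟨fun i j => h.nonneg j i, k, hk, fun i j => ?_⟩
  rw [← Matrix.transpose_pow]
  exact hpos j i

omit [DecidableEq ι] in
lemma measurable_wvar_input (u y : ι → ℝ) :
    Measurable fun r : Matrix ι ι ℝ × Matrix ι ι ℝ × Finset ι =>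
      wvar u fun j => ∑ i, r.2.1 i j * y i := by
  have hB : ∀ i j, Measurable fun r : Matrix ι ι ℝ × Matrix ι ι ℝ × Finset ι => r.2.1 i j :=
    fun i j => (measurable_matrix_apply i j).comp (by fun_prop)
  unfold wvar wmean
  fun_prop

/-- Mixing by the transpose of `B t` contracts the expected variance of a fixed vector. -/
lemma Environment.integral_wvar_transpose_le (henv : Environment P A B S p δ) {u : ι → ℝ} {κ c : ℝ}
    (hg : SpectralGap (expMatrix P (B 0)).transpose u κ c) (t : ℕ) (y : ι → ℝ) :
    Integrable (fun ω => wvar u fun j => ∑ i, B t ω i j * y i) P ∧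
    ∫ ω, wvar u (fun j => ∑ i, B t ω i j * y i) ∂P ≤ (1 - δ * c) * wvar u y := by
  set F : ι → ι → ℝ := fun i j => u i * ‖y j - wmean u y‖ ^ 2 - δ * u i * ‖y i - y j‖ ^ 2
  have hae : ∀ᵐ ω ∂P, wvar u (fun j => ∑ i, B t ω i j * y i) ≤ ∑ i, ∑ j, B t ω j i * F i j := by
    filter_upwards [henv.col_stochastic t, henv.diag_B t] with ω h hd
    have h' := Matrix.transpose_mem_rowStochastic_iff_mem_colStochastic.2 h
    exact (wvar_le hg.sum_one _ (wmean u y)).trans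
      (sum_mul_norm_mix_sq_le (A := (B t ω).transpose) h' hd hg.nonneg y (wmean u y))
  have hint : Integrable (fun ω => ∑ i, ∑ j, B t ω j i * F i j) P :=
    integrable_finsetSum _ fun i _ => integrable_finsetSum _ fun j _ =>
      (henv.integrable_B t j i).mul_const _
  have hi : Integrable (fun ω => wvar u fun j => ∑ i, B t ω i j * y i) P := by
    refine hint.mono' ((measurable_wvar_input u y).comp
      (henv.measurable_input t)).aestronglyMeasurable ?_
    filter_upwards [hae] with ω h
    rwa [Real.norm_of_nonneg (wvar_nonneg hg.nonneg _)]
  refine ⟨hi, (integral_mono_ae hi hint hae).trans ?_⟩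
  rw [integral_finsetSum _ fun i _ => integrable_finsetSum _ fun j _ =>
      (henv.integrable_B t j i).mul_const _]
  refine le_trans (le_of_eq ?_) (hg.sum_sub_energy_le henv.diag_pos.le y)
  refine Finset.sum_congr rfl fun i _ => ?_
  rw [integral_finsetSum _ fun j _ => (henv.integrable_B t j i).mul_const _]
  refine Finset.sum_congr rfl fun j _ => ?_
  rw [integral_mul_const, integral_matrix_apply_eq (henv.ident_B t)]
  rfl

lemma Environment.integral_ind (henv : Environment P A B S p δ) (t : ℕ) (i : ι) :
    Integrable (fun ω => ind (S t ω) i) P ∧ ∫ ω, ind (S t ω) i ∂P = p i := by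
  have hset : MeasurableSet {ω | i ∈ S t ω} :=
    (henv.measurable_S t) (measurableSet_setOfPred.2 (by fun_prop) :
      MeasurableSet {T : Finset ι | i ∈ T})
  have e : (fun ω => ind (S t ω) i) = Set.indicator {ω | i ∈ S t ω} 1 := by
    funext ω
    simp only [ind, Set.indicator, Set.mem_ofPred_eq, Pi.one_apply]
  rw [e]
  exact ⟨(integrable_const (1 : ℝ)).indicator hset, by
    rw [integral_indicator_one hset, henv.sampling]⟩

end ExpectedMatrices

/-! ### One-step inequalities for the expected errors. -/

section Recursion

variable {ι Ω : Type*} {E : Type} [Fintype ι] [DecidableEq ι] [Nonempty ι] [NormedAddCommGroup E]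
  [InnerProductSpace ℝ E] [CompleteSpace E] [MeasurableSpace Ω] {P : Measure Ω}
  {A B : ℕ → Ω → Matrix ι ι ℝ} {S : ℕ → Ω → Finset ι} {p : ι → ℝ} {δ : ℝ}
  [MeasurableSpace E] [BorelSpace E] [SecondCountableTopology E]
  [ProperSpace E] [IsProbabilityMeasure P] {f : ι → E → ℝ} {L : ℝ≥0}

/-- The constant in the bound on the updated trackers. -/
noncomputable def halfConst (ι : Type*) [Fintype ι] (L : ℝ≥0) : ℝ :=
  3 + 6 * (Fintype.card ι : ℝ) ^ 3 * L ^ 2 + 12 * (Fintype.card ι : ℝ) ^ 2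
    + 12 * (Fintype.card ι : ℝ) ^ 2 * L ^ 2

omit [DecidableEq ι] [Nonempty ι] [MeasurableSpace E] [BorelSpace E] [SecondCountableTopology E]
  [ProperSpace E] [CompleteSpace E] in
lemma continuous_wvar (u : ι → ℝ) :
    Continuous fun q : (ι → E) × (ι → E) × (ι → E) × (ι → ℝ) => wvar u q.1 := by
  unfold wvar wmean; fun_prop

omit [DecidableEq ι] [Nonempty ι] [MeasurableSpace E] [BorelSpace E] [SecondCountableTopology E]
  [ProperSpace E] [CompleteSpace E] in
lemma continuous_spreadSq (u : ι → ℝ) :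
    Continuous fun q : (ι → E) × (ι → E) × (ι → E) × (ι → ℝ) => spreadSq u q.1 := by
  unfold spreadSq wmean; fun_prop

omit [DecidableEq ι] [Nonempty ι] [MeasurableSpace E] [BorelSpace E] [SecondCountableTopology E]
  [ProperSpace E] [CompleteSpace E] in
lemma continuous_norm_sq_wmean_sub (u : ι → ℝ) (z : E) :
    Continuous fun q : (ι → E) × (ι → E) × (ι → E) × (ι → ℝ) => ‖wmean u q.1 - z‖ ^ 2 := by
  unfold wmean; fun_prop

omit [DecidableEq ι] [Nonempty ι] [MeasurableSpace E] [BorelSpace E] [SecondCountableTopology E]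
  [ProperSpace E] [CompleteSpace E] in
lemma continuous_trackErr (i : ι) :
    Continuous fun q : (ι → E) × (ι → E) × (ι → E) × (ι → ℝ) =>
      trackErr q.2.2.2 (toState q) i := by
  unfold trackErr toState; fun_prop

omit [DecidableEq ι] [Nonempty ι] [MeasurableSpace E] [BorelSpace E] [SecondCountableTopology E]
  [ProperSpace E] [CompleteSpace E] in
lemma continuous_trackingSq :
    Continuous fun q : (ι → E) × (ι → E) × (ι → E) × (ι → ℝ) =>
      trackingSq q.2.2.2 (toState q) :=
  continuous_finsetSum _ fun i _ => (continuous_trackErr i).norm.pow 2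

omit [Fintype ι] [DecidableEq ι] [Nonempty ι] [MeasurableSpace E] [BorelSpace E]
  [SecondCountableTopology E] [ProperSpace E] in
lemma continuous_staleness (hL : ∀ i, LipschitzWith L (gradient (f i))) (i : ι) :
    Continuous fun q : (ι → E) × (ι → E) × (ι → E) × (ι → ℝ) => staleness f (toState q) i := by
  have := (hL i).continuous
  unfold staleness toState; fun_prop

omit [DecidableEq ι] [Nonempty ι] [MeasurableSpace E] [BorelSpace E]
  [SecondCountableTopology E] [ProperSpace E] in
lemma continuous_gradientSq (hL : ∀ i, LipschitzWith L (gradient (f i))) :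
    Continuous fun q : (ι → E) × (ι → E) × (ι → E) × (ι → ℝ) => gradientSq f (toState q) :=
  continuous_finsetSum _ fun i _ => (continuous_staleness hL i).norm.pow 2

omit [DecidableEq ι] [Nonempty ι] [MeasurableSpace E] [BorelSpace E]
  [SecondCountableTopology E] [ProperSpace E] in
lemma continuous_totalErr (hL : ∀ i, LipschitzWith L (gradient (f i))) (u : ι → ℝ) (z : E) :
    Continuous fun q : (ι → E) × (ι → E) × (ι → E) × (ι → ℝ) =>
      totalErr u f z q.2.2.2 (toState q) :=
  (((continuous_norm_sq_wmean_sub u z).add (continuous_spreadSq u)).add continuous_trackingSq).add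
    (continuous_gradientSq hL)

variable (henv : Environment P A B S p δ) (hL : ∀ i, LipschitzWith L (gradient (f i)))
  (η : ℝ) {s₀ : State ι E} (hs₀ : ∑ i, s₀.G i = ∑ i, gradient (f i) (s₀.c i))
include henv hL hs₀

lemma integral_wvar_succ_le {u : ι → ℝ} {κ c θ : ℝ}
    (hg : SpectralGap (expMatrix P (A 0)) u κ c) (hθ : 0 < θ) {z : E} (hz : gradSum f z = 0)
    (t : ℕ) :
    ∫ ω, wvar u (run f η A B S s₀ (t + 1) ω).x ∂P ≤
      (1 + θ) * (1 - δ * c) * ∫ ω, wvar u (run f η A B S s₀ t ω).x ∂P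
      + (1 + 1 / θ) * η ^ 2 * halfConst ι L
        * ∫ ω, totalErr u f z (weight B t ω) (run f η A B S s₀ t ω) ∂P := by
  set Φ : ι → ι → (ι → E) × (ι → E) × (ι → E) × (ι → ℝ) → ℝ := fun i j q =>
    u i * ‖q.1 j - wmean u q.1‖ ^ 2 - δ * u i * ‖q.1 i - q.1 j‖ ^ 2 with hΦdef
  have hΦ : ∀ i j, Continuous (Φ i j) := fun i j => by
    simp only [hΦdef]; unfold wmean; fun_prop
  have hmul : ∀ i j, Integrable (fun ω => A t ω i j * Φ i j (stateTuple f η A B S s₀ t ω)) P ∧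
      ∫ ω, A t ω i j * Φ i j (stateTuple f η A B S s₀ t ω) ∂P
        = (∫ ω, A t ω i j ∂P) * ∫ ω, Φ i j (stateTuple f η A B S s₀ t ω) ∂P :=
    fun i j => henv.integral_input_mul hL η s₀ t (φ := fun r => r.1 i j)
    ((measurable_matrix_apply i j).comp measurable_fst) (henv.abs_A_le_one t i j) (hΦ i j)
  have hW : Integrable (fun ω => totalErr u f z (weight B t ω) (run f η A B S s₀ t ω)) P :=
    henv.integrable_stateTuple hL η s₀ t (continuous_totalErr hL u z)
  have hV : Integrable (fun ω => wvar u (run f η A B S s₀ t ω).x) P :=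
    henv.integrable_stateTuple hL η s₀ t (continuous_wvar u)
  have hV' := henv.integrable_stateTuple hL η s₀ (t + 1) (continuous_wvar u)
  have hsum : Integrable (fun ω => ∑ i, ∑ j, A t ω i j * Φ i j (stateTuple f η A B S s₀ t ω)) P :=
    integrable_finsetSum _ fun i _ => integrable_finsetSum _ fun j _ => (hmul i j).1
  have hae : ∀ᵐ ω ∂P, wvar u (run f η A B S s₀ (t + 1) ω).x ≤
      (1 + θ) * (∑ i, ∑ j, A t ω i j * Φ i j (stateTuple f η A B S s₀ t ω))
      + (1 + 1 / θ) * η ^ 2 * halfConst ι L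
        * totalErr u f z (weight B t ω) (run f η A B S s₀ t ω) := by
    filter_upwards [henv.row_stochastic t, henv.diag_A t, henv.ae_conserved f η hs₀]
      with ω hA hd hc
    refine (wvar_step_le f (η := η) hθ (B t ω) hA hd (S t ω) (run f η A B S s₀ t ω) hg.nonneg
      hg.sum_one).trans ?_
    have h1 := sum_norm_sq_halfG_le hL (hc t) u (S t ω) hz
    rw [mul_assoc _ (halfConst ι L)]
    refine add_le_add le_rfl (mul_le_mul_of_nonneg_left h1 (by positivity))
  refine (integral_mono_ae hV' ((hsum.const_mul _).add (hW.const_mul _)) hae).trans ?_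
  have e1 : ∫ ω, ∑ i, ∑ j, A t ω i j * Φ i j (stateTuple f η A B S s₀ t ω) ∂P
      ≤ (1 - δ * c) * ∫ ω, wvar u (run f η A B S s₀ t ω).x ∂P := by
    -- Since the bound is linear in `A t`, independence replaces each entry by its expectation.
    have e2 : ∫ ω, ∑ i, ∑ j, A t ω i j * Φ i j (stateTuple f η A B S s₀ t ω) ∂P
        = ∫ ω, ∑ i, ∑ j, expMatrix P (A 0) i j * Φ i j (stateTuple f η A B S s₀ t ω) ∂P := by
      have hc : ∀ i j, Integrable (fun ω => expMatrix P (A 0) i j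
          * Φ i j (stateTuple f η A B S s₀ t ω)) P := fun i j =>
        (henv.integrable_stateTuple hL η s₀ t (hΦ i j)).const_mul _
      rw [integral_finsetSum _ fun i _ => integrable_finsetSum _ fun j _ => (hmul i j).1,
        integral_finsetSum _ fun i _ => integrable_finsetSum _ fun j _ => hc i j]
      refine Finset.sum_congr rfl fun i _ => ?_
      rw [integral_finsetSum _ fun j _ => (hmul i j).1, integral_finsetSum _ fun j _ => hc i j]
      refine Finset.sum_congr rfl fun j _ => ?_
      rw [integral_const_mul, ← integral_matrix_apply_eq (henv.ident_A t)]
      exact (hmul i j).2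
    rw [e2, ← integral_const_mul]
    refine integral_mono ?_ (hV.const_mul _) fun ω => hg.sum_sub_energy_le henv.diag_pos.le _
    exact integrable_finsetSum _ fun i _ => integrable_finsetSum _ fun j _ =>
      (henv.integrable_stateTuple hL η s₀ t (hΦ i j)).const_mul _
  simp only [Pi.add_apply]
  rw [integral_add (hsum.const_mul _) (hW.const_mul _), integral_const_mul, integral_const_mul]
  refine add_le_add ?_ le_rfl
  rw [mul_assoc]
  exact mul_le_mul_of_nonneg_left e1 (by linarith)

/-- Whether a node is sampled is independent of its staleness, so the old staleness survives with
probability `1 - p i ≤ 1 - p₀`. -/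
lemma integral_gradientSq_succ_le {u : ι → ℝ} {θ p₀ : ℝ} (hθ : 0 < θ) (hp₀ : ∀ i, p₀ ≤ p i) {z : E}
    (hz : gradSum f z = 0) (t : ℕ) :
    ∫ ω, gradientSq f (run f η A B S s₀ (t + 1) ω) ∂P ≤
      (1 + θ) * (1 - p₀) * ∫ ω, gradientSq f (run f η A B S s₀ t ω) ∂P
      + (1 + 1 / θ) * L ^ 2 * (Fintype.card ι * (6 * ∫ ω, spreadSq u (run f η A B S s₀ t ω).x ∂P
        + 3 * η ^ 2 * (halfConst ι L
          * ∫ ω, totalErr u f z (weight B t ω) (run f η A B S s₀ t ω) ∂P))) := by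
  set Φ : ι → (ι → E) × (ι → E) × (ι → E) × (ι → ℝ) → ℝ := fun i q =>
    ‖staleness f (toState q) i‖ ^ 2 with hΦdef
  have hΦ : ∀ i, Continuous (Φ i) := fun i => (continuous_staleness hL i).norm.pow 2
  have hmul : ∀ i, Integrable (fun ω => (1 - ind (S t ω) i)
        * Φ i (stateTuple f η A B S s₀ t ω)) P ∧
      ∫ ω, (1 - ind (S t ω) i) * Φ i (stateTuple f η A B S s₀ t ω) ∂P
        = (∫ ω, (1 - ind (S t ω) i) ∂P) * ∫ ω, Φ i (stateTuple f η A B S s₀ t ω) ∂P :=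
    fun i => henv.integral_input_mul hL η s₀ t (φ := fun r => 1 - ind r.2.2 i)
    (measurable_const.sub ((measurable_ind i).comp (by fun_prop))) (K := 1)
    (Eventually.of_forall fun ω => by
      have h1 := ind_nonneg (input A B S t ω).2.2 i
      have h2 := ind_le_one (input A B S t ω).2.2 i
      rw [abs_le]; constructor <;> linarith) (hΦ i)
  have hind : ∀ i, ∫ ω, (1 - ind (S t ω) i) ∂P = 1 - p i := fun i => by
    rw [integral_sub (integrable_const _) (henv.integral_ind t i).1, (henv.integral_ind t i).2]
    simp
  have hW : Integrable (fun ω => totalErr u f z (weight B t ω) (run f η A B S s₀ t ω)) P :=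
    henv.integrable_stateTuple hL η s₀ t (continuous_totalErr hL u z)
  have hX : Integrable (fun ω => spreadSq u (run f η A B S s₀ t ω).x) P :=
    henv.integrable_stateTuple hL η s₀ t (continuous_spreadSq (E := E) u)
  have hsum : Integrable (fun ω => ∑ i, (1 - ind (S t ω) i)
      * Φ i (stateTuple f η A B S s₀ t ω)) P :=
    integrable_finsetSum _ fun i _ => (hmul i).1
  have hae : ∀ᵐ ω ∂P, gradientSq f (run f η A B S s₀ (t + 1) ω) ≤
      (1 + θ) * (∑ i, (1 - ind (S t ω) i) * Φ i (stateTuple f η A B S s₀ t ω))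
      + (1 + 1 / θ) * L ^ 2 * (Fintype.card ι * (6 * spreadSq u (run f η A B S s₀ t ω).x
        + 3 * η ^ 2 * (halfConst ι L
          * totalErr u f z (weight B t ω) (run f η A B S s₀ t ω)))) := by
    filter_upwards [henv.row_stochastic t, henv.ae_conserved f η hs₀] with ω hA hc
    refine (gradientSq_step_le hL η hθ (A t ω) (B t ω) (S t ω) (run f η A B S s₀ t ω)).trans ?_
    have h1 := sum_norm_sq_halfG_le hL (hc t) u (S t ω) hz
    have h2 := sum_norm_sq_step_sub_le f (η := η) (B t ω) hA (S t ω) (run f η A B S s₀ t ω) u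
    refine add_le_add le_rfl (mul_le_mul_of_nonneg_left (h2.trans ?_) (by positivity))
    refine mul_le_mul_of_nonneg_left (add_le_add le_rfl ?_) (by positivity)
    exact mul_le_mul_of_nonneg_left h1 (by positivity)
  have hr : Integrable (fun ω => (1 + 1 / θ) * L ^ 2 * (Fintype.card ι *
      (6 * spreadSq u (run f η A B S s₀ t ω).x + 3 * η ^ 2 * (halfConst ι L
          * totalErr u f z (weight B t ω) (run f η A B S s₀ t ω))))) P :=
    (((hX.const_mul 6).add ((hW.const_mul (halfConst ι L)).const_mul (3 * η ^ 2))).const_mul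
      _).const_mul _
  refine (integral_mono_ae (henv.integrable_stateTuple hL η s₀ (t + 1) (continuous_gradientSq hL))
    ((hsum.const_mul _).add hr) hae).trans ?_
  simp only [Pi.add_apply]
  rw [integral_add (hsum.const_mul _) hr, integral_const_mul, integral_const_mul,
    integral_const_mul, integral_add (hX.const_mul 6)
      ((hW.const_mul (halfConst ι L)).const_mul (3 * η ^ 2)), integral_const_mul,
    integral_const_mul, integral_const_mul]
  refine add_le_add ?_ le_rfl
  rw [mul_assoc]
  refine mul_le_mul_of_nonneg_left ?_ (by linarith)
  rw [integral_finsetSum _ fun i _ => (hmul i).1]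
  have e3 : ∫ ω, gradientSq f (run f η A B S s₀ t ω) ∂P
      = ∑ i, ∫ ω, Φ i (stateTuple f η A B S s₀ t ω) ∂P :=
    integral_finsetSum _ fun i _ => henv.integrable_stateTuple hL η s₀ t (hΦ i)
  rw [e3, Finset.mul_sum]
  refine Finset.sum_le_sum fun i _ => ?_
  refine (hmul i).2.le.trans ?_
  rw [hind i]
  exact mul_le_mul_of_nonneg_right (by linarith [hp₀ i])
    (integral_nonneg fun ω => sq_nonneg _)

/-- The term linear in the mixing shift has expectation zero by stationarity and independence. The
drift survives with rate at least `κ'`, uniformly over the tracker weights. -/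
lemma integral_norm_sq_wmean_succ_le {u : ι → ℝ} {κ c m lam κ' : ℝ}
    (hg : SpectralGap (expMatrix P (A 0)) u κ c) (hη : 0 ≤ η) (hm : 0 ≤ m) (hlam : 0 < lam)
    (hκ' : ∀ j, κ' ≤ δ * u j * p j) {z : E} (hz : gradSum f z = 0)
    (hmono : ∀ y, m * ‖y - z‖ ^ 2 ≤ inner ℝ (gradSum f y) (y - z)) (t : ℕ) :
    ∫ ω, ‖wmean u (run f η A B S s₀ (t + 1) ω).x - z‖ ^ 2 ∂P ≤
      (1 - 2 * η * m * κ' + η * lam) * ∫ ω, ‖wmean u (run f η A B S s₀ t ω).x - z‖ ^ 2 ∂P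
      + η / lam * ((6 * Fintype.card ι + 3) * ∫ ω, gradientSq f (run f η A B S s₀ t ω) ∂P
        + 6 * Fintype.card ι * L ^ 2 * ∫ ω, spreadSq u (run f η A B S s₀ t ω).x ∂P
        + 3 * ∫ ω, trackingSq (weight B t ω) (run f η A B S s₀ t ω) ∂P)
      + 2 * Fintype.card ι * ∫ ω, spreadSq u (run f η A B S s₀ t ω).x ∂P
      + 2 * η ^ 2 * (halfConst ι L
        * ∫ ω, totalErr u f z (weight B t ω) (run f η A B S s₀ t ω) ∂P) := by
  have hu := hg.nonneg
  set X : ℕ → Ω → State ι E := run f η A B S s₀ with hXdef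
  set Φ : ι → (ι → E) × (ι → E) × (ι → E) × (ι → ℝ) → ℝ := fun j q =>
    inner ℝ (wmean u q.1 - z) (q.1 j - wmean u q.1) with hΦdef
  have hΦ : ∀ j, Continuous (Φ j) := fun j => by
    simp only [hΦdef]; unfold wmean; fun_prop
  set Ψ : ι → (ι → E) × (ι → E) × (ι → E) × (ι → ℝ) → ℝ := fun j q =>
    q.2.2.2 j * ‖wmean u q.1 - z‖ ^ 2 with hΨdef
  have hΨ : ∀ j, Continuous (Ψ j) := fun j => by
    simp only [hΨdef]; unfold wmean; fun_prop
  have hA : ∀ i j, Measurable fun r : Matrix ι ι ℝ × Matrix ι ι ℝ × Finset ι => r.1 i j :=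
    fun i j => (measurable_matrix_apply i j).comp (by fun_prop)
  have hI : ∀ j, Measurable fun r : Matrix ι ι ℝ × Matrix ι ι ℝ × Finset ι => ind r.2.2 j :=
    fun j => (measurable_ind j).comp (by fun_prop)
  have hAall : ∀ᵐ ω ∂P, ∀ i j, |A t ω i j| ≤ 1 :=
    ae_all_iff.2 fun i => ae_all_iff.2 fun j => henv.abs_A_le_one t i j
  have hv : ∀ j, ∀ᵐ ω ∂P, |∑ i, u i * A t ω i j| ≤ 1 := fun j => by
    filter_upwards [hAall] with ω h
    refine (Finset.abs_sum_le_sum_abs _ _).trans ?_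
    rw [← hg.sum_one]
    refine Finset.sum_le_sum fun i _ => ?_
    rw [abs_mul, abs_of_nonneg (hu i)]
    exact mul_le_of_le_one_right (hu i) (h i j)
  have hmul1 : ∀ j, Integrable (fun ω => (∑ i, u i * A t ω i j - u j)
        * Φ j (stateTuple f η A B S s₀ t ω)) P ∧
      ∫ ω, (∑ i, u i * A t ω i j - u j) * Φ j (stateTuple f η A B S s₀ t ω) ∂P
        = (∫ ω, (∑ i, u i * A t ω i j - u j) ∂P) * ∫ ω, Φ j (stateTuple f η A B S s₀ t ω) ∂P :=
    fun j => henv.integral_input_mul hL η s₀ t (φ := fun r => ∑ i, u i * r.1 i j - u j)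
      (by have := fun i => hA i j; fun_prop) (K := 1 + |u j|)
      ((hv j).mono fun ω h => (abs_sub _ _).trans (add_le_add h le_rfl)) (hΦ j)
  have hmul2 : ∀ j, Integrable (fun ω => ((∑ i, u i * A t ω i j) * ind (S t ω) j)
        * Ψ j (stateTuple f η A B S s₀ t ω)) P ∧
      ∫ ω, ((∑ i, u i * A t ω i j) * ind (S t ω) j) * Ψ j (stateTuple f η A B S s₀ t ω) ∂P
        = (∫ ω, (∑ i, u i * A t ω i j) * ind (S t ω) j ∂P)
          * ∫ ω, Ψ j (stateTuple f η A B S s₀ t ω) ∂P :=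
    fun j => henv.integral_input_mul hL η s₀ t (φ := fun r => (∑ i, u i * r.1 i j) * ind r.2.2 j)
      (by have := fun i => hA i j; have := hI j; fun_prop) (K := 1)
      ((hv j).mono fun ω h => by
        rw [abs_mul, abs_of_nonneg (ind_nonneg _ _)]
        exact mul_le_one₀ h (ind_nonneg _ _) (ind_le_one _ _)) (hΨ j)
  have hzero : ∀ j, ∫ ω, (∑ i, u i * A t ω i j - u j) ∂P = 0 := fun j => by
    have hi : ∀ i, Integrable (fun ω => u i * A t ω i j) P := fun i =>
      (henv.integrable_A t i j).const_mul _
    rw [integral_sub (integrable_finsetSum _ fun i _ => hi i) (integrable_const _),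
      integral_finsetSum _ fun i _ => hi i]
    simp only [integral_const_mul, integral_matrix_apply_eq (henv.ident_A t), hg.stationary]
    simp
  -- Keeping only the diagonal entry, which is at least `δ` surely enough to ignore its dependence
  -- on `S t`, leaves the sampling probability.
  have hlow : ∀ j, κ' ≤ ∫ ω, (∑ i, u i * A t ω i j) * ind (S t ω) j ∂P := fun j => by
    refine (hκ' j).trans ?_
    rw [← (henv.integral_ind t j).2, ← integral_const_mul]
    refine integral_mono_ae ((henv.integral_ind t j).1.const_mul _) ?_ ?_
    · refine (henv.integral_ind t j).1.bdd_mul (c := 1) ?_ (hv j)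
      refine (Finset.measurable_sum _ fun i _ => ?_).aestronglyMeasurable
      exact ((measurable_matrix_apply i j).comp (henv.measurable_A t)).const_mul _
    · filter_upwards [henv.row_stochastic t, henv.diag_A t] with ω hr hd
      refine mul_le_mul_of_nonneg_right ?_ (ind_nonneg _ _)
      calc δ * u j ≤ u j * A t ω j j := by rw [mul_comm]; exact mul_le_mul_of_nonneg_left (hd j) (hu j)
        _ ≤ _ := Finset.single_le_sum (f := fun i => u i * A t ω i j)
          (fun i _ => mul_nonneg (hu i) (Matrix.nonneg_of_mem_rowStochastic hr))
          (Finset.mem_univ j)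
  have hW : Integrable (fun ω => totalErr u f z (weight B t ω) (X t ω)) P :=
    henv.integrable_stateTuple hL η s₀ t (continuous_totalErr hL u z)
  have hX : Integrable (fun ω => spreadSq u (X t ω).x) P :=
    henv.integrable_stateTuple hL η s₀ t (continuous_spreadSq (E := E) u)
  have hH : Integrable (fun ω => gradientSq f (X t ω)) P :=
    henv.integrable_stateTuple hL η s₀ t (continuous_gradientSq hL)
  have hT : Integrable (fun ω => trackingSq (weight B t ω) (X t ω)) P :=
    henv.integrable_stateTuple hL η s₀ t continuous_trackingSq
  have hD : Integrable (fun ω => ‖wmean u (X t ω).x - z‖ ^ 2) P :=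
    henv.integrable_stateTuple hL η s₀ t (continuous_norm_sq_wmean_sub u z)
  have hD' : Integrable (fun ω => ‖wmean u (X (t + 1) ω).x - z‖ ^ 2) P :=
    henv.integrable_stateTuple hL η s₀ (t + 1) (continuous_norm_sq_wmean_sub u z)
  have hs1 : Integrable (fun ω => ∑ j, (∑ i, u i * A t ω i j - u j)
      * Φ j (stateTuple f η A B S s₀ t ω)) P := integrable_finsetSum _ fun j _ => (hmul1 j).1
  have hs2 : Integrable (fun ω => ∑ j, ((∑ i, u i * A t ω i j) * ind (S t ω) j)
      * Ψ j (stateTuple f η A B S s₀ t ω)) P := integrable_finsetSum _ fun j _ => (hmul2 j).1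
  have hae : ∀ᵐ ω ∂P, ‖wmean u (X (t + 1) ω).x - z‖ ^ 2 ≤ ‖wmean u (X t ω).x - z‖ ^ 2
      + 2 * (∑ j, (∑ i, u i * A t ω i j - u j) * Φ j (stateTuple f η A B S s₀ t ω))
      - 2 * η * m * (∑ j, ((∑ i, u i * A t ω i j) * ind (S t ω) j)
          * Ψ j (stateTuple f η A B S s₀ t ω))
      + η * lam * ‖wmean u (X t ω).x - z‖ ^ 2
      + η / lam * ((6 * Fintype.card ι + 3) * gradientSq f (X t ω)
        + 6 * Fintype.card ι * L ^ 2 * spreadSq u (X t ω).x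
        + 3 * trackingSq (weight B t ω) (X t ω))
      + 2 * Fintype.card ι * spreadSq u (X t ω).x
      + 2 * η ^ 2 * (halfConst ι L * totalErr u f z (weight B t ω) (X t ω)) := by
    filter_upwards [henv.row_stochastic t, henv.ae_conserved f η hs₀] with ω hA hc
    refine (norm_sq_wmean_step_sub_le hL hη hlam (B t ω) hA (S t ω) (hc t) hu hg.sum_one
      hmono).trans (add_le_add le_rfl ?_)
    exact mul_le_mul_of_nonneg_left (sum_norm_sq_halfG_le hL (hc t) u (S t ω) hz) (by positivity)
  have i1 := hD.add (hs1.const_mul 2)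
  have i2 := i1.sub (hs2.const_mul (2 * η * m))
  have i3 := i2.add (hD.const_mul (η * lam))
  have j1 := (hH.const_mul (6 * Fintype.card ι + 3 : ℝ)).add
    (hX.const_mul (6 * Fintype.card ι * L ^ 2 : ℝ))
  have j2 := j1.add (hT.const_mul 3)
  have i4 := i3.add (j2.const_mul (η / lam))
  have i5 := i4.add (hX.const_mul (2 * Fintype.card ι : ℝ))
  have i6 := i5.add ((hW.const_mul (halfConst ι L)).const_mul (2 * η ^ 2))
  refine (integral_mono_ae hD' i6 hae).trans ?_
  rw [integral_add' i5 ((hW.const_mul _).const_mul _), integral_add' i4 (hX.const_mul _),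
    integral_add' i3 (j2.const_mul _), integral_add' i2 (hD.const_mul _),
    integral_sub' i1 (hs2.const_mul _), integral_add' hD (hs1.const_mul _), integral_const_mul,
    integral_const_mul, integral_const_mul, integral_const_mul, integral_const_mul,
    integral_const_mul, integral_const_mul, integral_add' j1 (hT.const_mul _),
    integral_add' (hH.const_mul _) (hX.const_mul _), integral_const_mul, integral_const_mul,
    integral_const_mul]
  have e1 : ∫ ω, ∑ j, (∑ i, u i * A t ω i j - u j) * Φ j (stateTuple f η A B S s₀ t ω) ∂P = 0 := by
    rw [integral_finsetSum _ fun j _ => (hmul1 j).1]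
    refine Finset.sum_eq_zero fun j _ => ?_
    rw [(hmul1 j).2, hzero, zero_mul]
  have e2 : κ' * ∫ ω, ‖wmean u (X t ω).x - z‖ ^ 2 ∂P
      ≤ ∫ ω, ∑ j, ((∑ i, u i * A t ω i j) * ind (S t ω) j)
          * Ψ j (stateTuple f η A B S s₀ t ω) ∂P := by
    -- The tracker weights sum to one, so a lower bound common to all nodes suffices.
    have e3 : ∫ ω, ‖wmean u (X t ω).x - z‖ ^ 2 ∂P
        = ∑ j, ∫ ω, Ψ j (stateTuple f η A B S s₀ t ω) ∂P := by
      rw [← integral_finsetSum _ fun j _ => henv.integrable_stateTuple hL η s₀ t (hΨ j)]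
      refine integral_congr_ae ?_
      filter_upwards [henv.ae_conserved f η hs₀] with ω hc
      change _ = ∑ j, weight B t ω j * ‖wmean u (X t ω).x - z‖ ^ 2
      rw [← Finset.sum_mul, (hc t).sum_one, one_mul]
    rw [integral_finsetSum _ fun j _ => (hmul2 j).1, e3, Finset.mul_sum]
    refine Finset.sum_le_sum fun j _ => ?_
    rw [(hmul2 j).2]
    refine mul_le_mul_of_nonneg_right (hlow j) (integral_nonneg_of_ae ?_)
    filter_upwards [henv.ae_conserved f η hs₀] with ω hc
    exact mul_nonneg ((hc t).nonneg j) (sq_nonneg _)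
  rw [e1]
  have e4 := mul_le_mul_of_nonneg_left e2 (show 0 ≤ 2 * η * m by positivity)
  linarith

/-- The hypothesis on all fixed test vectors is applied to the random vector `Bᵀ y`, which is
legitimate because `B t` is independent of the deviations; then the variance of `Bᵀ y` contracts on
average. -/
lemma integral_norm_sq_trackErr_succ_le {u : ι → ℝ} {κ c θ a : ℝ}
    (hg : SpectralGap (expMatrix P (B 0)).transpose u κ c) (hθ : 0 < θ) (t : ℕ) (ha0 : 0 ≤ a)
    (ha : ∀ y : ι → ℝ, ∫ ω, ‖∑ i, y i • trackErr (weight B t ω) (run f η A B S s₀ t ω) i‖ ^ 2 ∂P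
      ≤ a * wvar u y) (y : ι → ℝ) :
    ∫ ω, ‖∑ i, y i • trackErr (weight B (t + 1) ω) (run f η A B S s₀ (t + 1) ω) i‖ ^ 2 ∂P
      ≤ ((1 + θ) * (1 - δ * c) * a + (1 + 1 / θ) * (4 * (Fintype.card ι : ℝ) ^ 3 / κ)
        * ∫ ω, gradientSq f (run f η A B S s₀ t ω) ∂P) * wvar u y := by
  set X : ℕ → Ω → State ι E := run f η A B S s₀ with hXdef
  set e : Ω → ι → E := fun ω => trackErr (weight B t ω) (X t ω) with he
  set Φ : ι → ι → (ι → E) × (ι → E) × (ι → E) × (ι → ℝ) → ℝ := fun j k q =>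
    inner ℝ (trackErr q.2.2.2 (toState q) j) (trackErr q.2.2.2 (toState q) k) with hΦdef
  have hΦ : ∀ j k, Continuous (Φ j k) := fun j k =>
    (continuous_trackErr j).inner (continuous_trackErr k)
  have hΦi := fun j k => henv.integrable_stateTuple hL η s₀ t (hΦ j k)
  have hB : ∀ i j, Measurable fun r : Matrix ι ι ℝ × Matrix ι ι ℝ × Finset ι => r.2.1 i j :=
    fun i j => (measurable_matrix_apply i j).comp (by fun_prop)
  set w : Ω → ι → ℝ := fun ω j => ∑ i, B t ω i j * y i with hw
  have hBall : ∀ᵐ ω ∂P, ∀ i j, |B t ω i j| ≤ 1 :=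
    ae_all_iff.2 fun i => ae_all_iff.2 fun j => henv.abs_B_le_one t i j
  have hwb : ∀ᵐ ω ∂P, ∀ j, |w ω j| ≤ ∑ i, |y i| := by
    filter_upwards [hBall] with ω h j
    refine (Finset.abs_sum_le_sum_abs _ _).trans (Finset.sum_le_sum fun i _ => ?_)
    rw [abs_mul]
    exact mul_le_of_le_one_left (abs_nonneg _) (h i j)
  have hmul : ∀ j k, Integrable (fun ω => (w ω j * w ω k) * Φ j k (stateTuple f η A B S s₀ t ω)) P ∧
      ∫ ω, (w ω j * w ω k) * Φ j k (stateTuple f η A B S s₀ t ω) ∂P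
        = (∫ ω, w ω j * w ω k ∂P) * ∫ ω, Φ j k (stateTuple f η A B S s₀ t ω) ∂P :=
    fun j k => henv.integral_input_mul hL η s₀ t
      (φ := fun r => (∑ i, r.2.1 i j * y i) * ∑ i, r.2.1 i k * y i)
      (by have := fun i => hB i j; have := fun i => hB i k; fun_prop)
      (K := (∑ i, |y i|) * ∑ i, |y i|)
      (hwb.mono fun ω h => by
        change |w ω j * w ω k| ≤ _
        rw [abs_mul]
        exact mul_le_mul (h j) (h k) (abs_nonneg _) ((abs_nonneg _).trans (h j))) (hΦ j k)
  have hwi : ∀ j k, Integrable (fun ω => w ω j * w ω k) P := fun j k => by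
    refine Integrable.of_bound ?_ ((∑ i, |y i|) * ∑ i, |y i|) ?_
    · have h : Measurable fun r : Matrix ι ι ℝ × Matrix ι ι ℝ × Finset ι =>
          (∑ i, r.2.1 i j * y i) * ∑ i, r.2.1 i k * y i := by
        have := fun i => hB i j; have := fun i => hB i k; fun_prop
      exact (h.comp (henv.measurable_input t)).aestronglyMeasurable
    · filter_upwards [hwb] with ω h
      rw [Real.norm_eq_abs, abs_mul]
      exact mul_le_mul (h j) (h k) (abs_nonneg _) ((abs_nonneg _).trans (h j))
  -- Expanding the square makes it a finite sum of products of an input factor and a state factor,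
  -- to which independence applies.
  have hexp : ∀ (v : ι → ℝ) (ω : Ω), ‖∑ j, v j • e ω j‖ ^ 2
      = ∑ j, ∑ k, (v j * v k) * Φ j k (stateTuple f η A B S s₀ t ω) := fun v ω => by
    rw [← real_inner_self_eq_norm_sq, sum_inner]
    refine Finset.sum_congr rfl fun j _ => ?_
    rw [inner_sum]
    refine Finset.sum_congr rfl fun k _ => ?_
    rw [real_inner_smul_left, real_inner_smul_right, ← mul_assoc]
    rfl
  have hmain_int : Integrable (fun ω => ‖∑ j, w ω j • e ω j‖ ^ 2) P := by
    simp only [hexp]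
    exact integrable_finsetSum _ fun j _ => integrable_finsetSum _ fun k _ => (hmul j k).1
  have hmain : ∫ ω, ‖∑ j, w ω j • e ω j‖ ^ 2 ∂P ≤ a * ((1 - δ * c) * wvar u y) := by
    have e1 : ∫ ω, ‖∑ j, w ω j • e ω j‖ ^ 2 ∂P
        = ∫ ω, ∑ j, ∑ k, (w ω j * w ω k) * ∫ ω', Φ j k (stateTuple f η A B S s₀ t ω') ∂P ∂P := by
      simp only [hexp]
      rw [integral_finsetSum _ fun j _ => integrable_finsetSum _ fun k _ => (hmul j k).1,
        integral_finsetSum _ fun j _ => integrable_finsetSum _ fun k _ => (hwi j k).mul_const _]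
      refine Finset.sum_congr rfl fun j _ => ?_
      rw [integral_finsetSum _ fun k _ => (hmul j k).1,
        integral_finsetSum _ fun k _ => (hwi j k).mul_const _]
      exact Finset.sum_congr rfl fun k _ => by rw [(hmul j k).2, integral_mul_const]
    -- For a frozen value of the test vector the double sum folds back into an expected square over
    -- `ω'`.
    have e2 : ∀ ω, ∑ j, ∑ k, (w ω j * w ω k) * ∫ ω', Φ j k (stateTuple f η A B S s₀ t ω') ∂P
        ≤ a * wvar u (w ω) := fun ω => by
      refine le_trans (le_of_eq ?_) (ha (w ω))
      change _ = ∫ ω', ‖∑ j, w ω j • e ω' j‖ ^ 2 ∂P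
      simp only [hexp (w ω)]
      rw [integral_finsetSum _ fun j _ => integrable_finsetSum _ fun k _ => (hΦi j k).const_mul _]
      refine Finset.sum_congr rfl fun j _ => ?_
      rw [integral_finsetSum _ fun k _ => (hΦi j k).const_mul _]
      exact Finset.sum_congr rfl fun k _ => by rw [integral_const_mul]
    obtain ⟨h1, h2⟩ := henv.integral_wvar_transpose_le hg t y
    rw [e1]
    refine (integral_mono ?_ (h1.const_mul a) e2).trans ?_
    · exact integrable_finsetSum _ fun j _ => integrable_finsetSum _ fun k _ =>
        (hwi j k).mul_const _
    · rw [integral_const_mul]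
      exact mul_le_mul_of_nonneg_left h2 ha0
  have hH : Integrable (fun ω => gradientSq f (X t ω)) P :=
    henv.integrable_stateTuple hL η s₀ t (continuous_gradientSq hL)
  have hcont : Continuous fun q : (ι → E) × (ι → E) × (ι → E) × (ι → ℝ) =>
      ‖∑ i, y i • trackErr q.2.2.2 (toState q) i‖ ^ 2 :=
    (continuous_finsetSum _ fun i _ => (continuous_trackErr i).const_smul (y i)).norm.pow 2
  have hae : ∀ᵐ ω ∂P, ‖∑ i, y i • trackErr (weight B (t + 1) ω) (X (t + 1) ω) i‖ ^ 2
      ≤ (1 + θ) * ‖∑ j, w ω j • e ω j‖ ^ 2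
        + (1 + 1 / θ) * (4 * (Fintype.card ι : ℝ) ^ 3 / κ * wvar u y) * gradientSq f (X t ω) := by
    filter_upwards [henv.col_stochastic t, henv.ae_conserved f η hs₀] with ω hBc hc
    have h1 := sum_smul_trackErr_step (f := f) η (A t ω) hBc (S t ω) (weight B t ω) (X t ω) y
    have h2 := norm_sq_trackErr_input_le hBc (S t ω) (hc t) y u
    change ‖∑ i, y i • trackErr ((B t ω).mulVec (weight B t ω))
      (step f η (A t ω) (B t ω) (S t ω) (X t ω)) i‖ ^ 2 ≤ _
    rw [h1]
    refine (norm_add_sq_le_theta _ _ hθ).trans (add_le_add le_rfl ?_)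
    rw [mul_assoc (1 + 1 / θ)]
    refine mul_le_mul_of_nonneg_left (h2.trans ?_) (by positivity)
    refine mul_le_mul_of_nonneg_right ?_ (gradientSq_nonneg f _)
    rw [div_mul_eq_mul_div, ← mul_div_assoc']
    exact mul_le_mul_of_nonneg_left (hg.spreadSq_le y) (by positivity)
  have hi1 := hmain_int.const_mul (1 + θ)
  have hi2 := hH.const_mul ((1 + 1 / θ) * (4 * (Fintype.card ι : ℝ) ^ 3 / κ * wvar u y))
  refine (integral_mono_ae (henv.integrable_stateTuple hL η s₀ (t + 1) hcont)
    (hi1.add hi2) hae).trans ?_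
  rw [integral_add' hi1 hi2, integral_const_mul, integral_const_mul]
  have h3 := mul_le_mul_of_nonneg_left hmain (show 0 ≤ 1 + θ by linarith)
  linarith

omit [Nonempty ι] hs₀ in
-- Coordinate vectors as tests recover each deviation; their variance is at most one.
lemma integral_trackingSq_le [Nonempty ι] {C : Matrix ι ι ℝ} {u : ι → ℝ} {κ c a : ℝ}
    (hg : SpectralGap C u κ c) (t : ℕ) (ha0 : 0 ≤ a)
    (ha : ∀ y : ι → ℝ, ∫ ω, ‖∑ i, y i • trackErr (weight B t ω) (run f η A B S s₀ t ω) i‖ ^ 2 ∂P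
      ≤ a * wvar u y) :
    ∫ ω, trackingSq (weight B t ω) (run f η A B S s₀ t ω) ∂P ≤ Fintype.card ι * a := by
  have e1 : ∫ ω, trackingSq (weight B t ω) (run f η A B S s₀ t ω) ∂P
      = ∑ i, ∫ ω, ‖trackErr (weight B t ω) (run f η A B S s₀ t ω) i‖ ^ 2 ∂P :=
    integral_finsetSum _ fun i _ => henv.integrable_stateTuple hL η s₀ t
      ((continuous_trackErr i).norm.pow 2)
  rw [e1]
  refine (Finset.sum_le_sum (g := fun _ => a) fun i _ => ?_).trans (by simp)
  have h1 := ha (Pi.single i 1)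
  simp only [Pi.single_apply, ite_smul, one_smul, zero_smul, Finset.sum_ite_eq', Finset.mem_univ,
    if_true] at h1
  refine h1.trans (mul_le_of_le_one_right ha0 ?_)
  refine (wvar_le hg.sum_one _ 0).trans ?_
  refine (Finset.sum_le_sum fun j _ => mul_le_of_le_one_right (hg.nonneg j) ?_).trans hg.sum_one.le
  by_cases h : j = i <;> simp [h]

end Recursion

/-! ### Strong convexity and the minimizer. -/

section Objective

variable {ι E : Type*} [Fintype ι] [NormedAddCommGroup E] [InnerProductSpace ℝ E] [CompleteSpace E]

/-- The strong convexity inequality along the segment from `y` to `z`, divided by `t`, as `t` tends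
to zero from the right. -/
lemma le_of_strongConvexOn {F : E → ℝ} {μ : ℝ} (hF : StrongConvexOn Set.univ μ F) {g y : E}
    (hg : HasGradientAt F g y) (z : E) :
    F y + inner ℝ g (z - y) + μ / 2 * ‖z - y‖ ^ 2 ≤ F z := by
  have h1 : Tendsto (fun t : ℝ => t⁻¹ • (F (y + t • (z - y)) - F y)) (𝓝[>] 0)
      (𝓝 (inner ℝ g (z - y))) :=
    (hg.hasFDerivAt.hasLineDerivAt (z - y)).tendsto_slope_zero_right
  have h2 : Tendsto (fun t : ℝ => F z - F y - (1 - t) * (μ / 2 * ‖z - y‖ ^ 2)) (𝓝[>] 0)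
      (𝓝 (F z - F y - (1 - 0) * (μ / 2 * ‖z - y‖ ^ 2))) := by
    refine Tendsto.mono_left (Continuous.tendsto ?_ 0) nhdsWithin_le_nhds
    fun_prop
  have h3 : ∀ᶠ t : ℝ in 𝓝[>] 0, t⁻¹ • (F (y + t • (z - y)) - F y)
      ≤ F z - F y - (1 - t) * (μ / 2 * ‖z - y‖ ^ 2) := by
    filter_upwards [Ioo_mem_nhdsGT (zero_lt_one (α := ℝ))] with t ht
    have h4 := hF.2 (Set.mem_univ z) (Set.mem_univ y) ht.1.le (by linarith [ht.2] : 0 ≤ 1 - t)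
      (by ring)
    have e : t • z + (1 - t) • y = y + t • (z - y) := by
      rw [sub_smul, one_smul, smul_sub]; abel
    rw [e] at h4
    simp only [smul_eq_mul] at h4
    rw [smul_eq_mul, inv_mul_le_iff₀ ht.1]
    linarith
  have h5 := le_of_tendsto_of_tendsto h1 h2 h3
  linarith

lemma hasGradientAt_objective {f : ι → E → ℝ} (hf : ∀ i, Differentiable ℝ (f i)) (y : E) :
    HasGradientAt (objective f) ((1 / (Fintype.card ι : ℝ)) • gradSum f y) y := by
  have h1 : ∀ i, HasFDerivAt (f i) (InnerProductSpace.toDual ℝ E (gradient (f i) y)) y :=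
    fun i => (hf i y).hasGradientAt.hasFDerivAt
  have h2 := (HasFDerivAt.fun_sum fun i (_ : i ∈ Finset.univ) => h1 i).const_mul
    (1 / (Fintype.card ι : ℝ))
  rw [hasGradientAt_iff_hasFDerivAt]
  have e : InnerProductSpace.toDual ℝ E ((1 / (Fintype.card ι : ℝ)) • gradSum f y)
      = (1 / (Fintype.card ι : ℝ)) • ∑ i, InnerProductSpace.toDual ℝ E (gradient (f i) y) := by
    simp [gradSum]
  rw [e]
  exact h2

/-- The quadratic lower bound at the origin makes `F` coercive. -/
lemma exists_forall_le_of_strongConvexOn [ProperSpace E] {F : E → ℝ} {μ : ℝ} (hμ : 0 < μ)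
    (hF : StrongConvexOn Set.univ μ F) {F' : E → E} (hF' : ∀ y, HasGradientAt F (F' y) y) :
    ∃ z, ∀ y, F z ≤ F y := by
  have hcont : Continuous F := continuous_iff_continuousAt.2 fun y => (hF' y).continuousAt
  refine hcont.exists_forall_le ?_
  have h1 : Tendsto (fun r : ℝ => F 0 + r * (μ / 2 * r - ‖F' 0‖)) atTop atTop := by
    refine tendsto_atTop_add_const_left _ _ (tendsto_id.atTop_mul_atTop₀ ?_)
    exact tendsto_atTop_add_const_right _ _ (tendsto_id.const_mul_atTop (by positivity))
  refine tendsto_atTop_mono (fun y => ?_) (h1.comp (tendsto_norm_cocompact_atTop (E := E)))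
  have h2 := le_of_strongConvexOn hF (hF' 0) y
  have h3 : -(‖F' 0‖ * ‖y‖) ≤ inner ℝ (F' 0) y := by
    have := abs_real_inner_le_norm (F' 0) y
    exact (abs_le.1 this).1
  rw [sub_zero] at h2
  change F 0 + ‖y‖ * (μ / 2 * ‖y‖ - ‖F' 0‖) ≤ F y
  nlinarith

/-- The properties of the minimizer used in the convergence proof. -/
lemma exists_minimizer [Nonempty ι] [ProperSpace E] {f : ι → E → ℝ} {μ : ℝ} {L : ℝ≥0} (hμ : 0 < μ)
    (hf : ∀ i, Differentiable ℝ (f i)) (hL : ∀ i, LipschitzWith L (gradient (f i)))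
    (hF : StrongConvexOn Set.univ μ (objective f)) :
    ∃ z, (∀ y, y ≠ z → objective f z < objective f y) ∧ gradSum f z = 0 ∧
      (∀ y, Fintype.card ι * (μ / 2) * ‖y - z‖ ^ 2 ≤ inner ℝ (gradSum f y) (y - z)) ∧
      ∀ y, objective f y - objective f z ≤ L * ‖y - z‖ ^ 2 := by
  have hg := hasGradientAt_objective hf
  have hM : 0 < (Fintype.card ι : ℝ) := by exact_mod_cast Fintype.card_pos
  obtain ⟨z, hz⟩ := exists_forall_le_of_strongConvexOn hμ hF hg
  have h0 : (1 / (Fintype.card ι : ℝ)) • gradSum f z = 0 := by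
    have h1 : IsLocalMin (objective f) z := Eventually.of_forall hz
    simpa using h1.hasFDerivAt_eq_zero (hg z).hasFDerivAt
  have hz0 : gradSum f z = 0 := (smul_eq_zero.1 h0).resolve_left (by positivity)
  refine ⟨z, fun y hy => ?_, hz0, fun y => ?_, fun y => ?_⟩
  · have h1 := le_of_strongConvexOn hF (hg z) y
    rw [h0, inner_zero_left] at h1
    have : 0 < ‖y - z‖ := norm_pos_iff.2 (sub_ne_zero.2 hy)
    have : 0 < μ / 2 * ‖y - z‖ ^ 2 := by positivity
    linarith
  · have h1 := le_of_strongConvexOn hF (hg y) z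
    -- Tangent bound at `y`, evaluated at `z`, combined with minimality of `z`; this yields the
    -- constant `μ / 2`.
    rw [← neg_sub y z, inner_neg_right, norm_neg, real_inner_smul_left] at h1
    have h2 := hz y
    have h3 : μ / 2 * ‖y - z‖ ^ 2 ≤ 1 / (Fintype.card ι : ℝ) * inner ℝ (gradSum f y) (y - z) := by
      linarith
    rw [one_div, ← div_eq_inv_mul, le_div_iff₀ hM] at h3
    linarith
  · have h1 := le_of_strongConvexOn hF (hg y) z
    rw [← neg_sub y z, inner_neg_right, norm_neg] at h1
    have h2 : 0 ≤ μ / 2 * ‖y - z‖ ^ 2 := by positivity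
    have h3 := real_inner_le_norm ((1 / (Fintype.card ι : ℝ)) • gradSum f y) (y - z)
    have h4 : ‖(1 / (Fintype.card ι : ℝ)) • gradSum f y‖ ≤ L * ‖y - z‖ := by
      refine le_of_sq_le_sq ?_ (by positivity)
      have h5 := norm_sq_gradSum_sub_le hL y z
      rw [hz0, sub_zero] at h5
      rw [norm_smul, mul_pow, Real.norm_of_nonneg (by positivity), div_pow, one_pow, one_div,
        inv_mul_le_iff₀ (by positivity), mul_pow]
      linarith
    have h6 := mul_le_mul_of_nonneg_right h4 (norm_nonneg (y - z))
    nlinarith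

end Objective

/-! ### A small-gain argument for a linear system. -/

section Scalar

/-- A linear system of error inequalities admits a contracting weighted sum for small steps. -/
lemma exists_contracting_weights {K c : ℝ} (hK : 1 ≤ K) (hc : 0 < c) (hc1 : c ≤ 1) :
    ∃ α β ηbar : ℝ, 1 ≤ α ∧ 1 ≤ β ∧ 0 < ηbar ∧ ηbar ≤ 1 ∧ ∀ η : ℝ, 0 < η → η ≤ ηbar →
      ∀ D V H s D' V' H' s' : ℝ, 0 ≤ D → 0 ≤ V → 0 ≤ H → 0 ≤ s →
        D' ≤ (1 - c * η) * D + K * V + K * η * (s + H) + K * η ^ 2 * (D + V + H + s) →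
        V' ≤ (1 - c) * V + K * η ^ 2 * (D + V + H + s) →
        H' ≤ (1 - c) * H + K * V + K * η ^ 2 * (D + V + H + s) →
        s' ≤ (1 - c) * s + K * H →
        D' + α * V' + β * H' + s' ≤ (1 - c * η / 2) * (D + α * V + β * H + s) := by
  -- The weights are chosen against the order-one couplings: the decay `β c` of `H` pays for its
  -- entry into `s` (and `D`), then the decay `α c` of `V` pays for its entry into `D` and `H`.
  set β := 2 * (2 * K + 1) / c with hβ
  set α := 2 * (K + β * K + 1) / c with hα
  have hβc : β * c = 2 * (2 * K + 1) := by rw [hβ]; field_simp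
  have hαc : α * c = 2 * (K + β * K + 1) := by rw [hα]; field_simp
  have hβ1 : 1 ≤ β := by rw [hβ, le_div_iff₀ hc]; linarith
  have hα1 : 1 ≤ α := by
    rw [hα, le_div_iff₀ hc]
    have : 0 ≤ β * K := by positivity
    linarith
  have hq : 0 < K * (1 + α + β) := by positivity
  -- The three bounds on `η` give respectively `c η ≤ c / 2`, total quadratic remainder at most `c η
  -- / 2`, and `K η ≤ c / 4`.
  refine ⟨α, β, min (1 / 2) (min (c / (2 * (K * (1 + α + β)))) (c / (4 * K))), hα1, hβ1, ?_, ?_, ?_⟩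
  · positivity
  · exact (min_le_left _ _).trans (by norm_num)
  intro η hη hle D V H s D' V' H' s' hD hV hH hs i1 i2 i3 i4
  have l1 : η ≤ 1 / 2 := hle.trans (min_le_left _ _)
  have l2 : η ≤ c / (2 * (K * (1 + α + β))) := hle.trans ((min_le_right _ _).trans (min_le_left _ _))
  have l3 : η ≤ c / (4 * K) := hle.trans ((min_le_right _ _).trans (min_le_right _ _))
  rw [le_div_iff₀ (by positivity)] at l2 l3
  set w := K * (1 + α + β) * η ^ 2 with hw
  have hwle : w ≤ c * η / 2 := by rw [hw]; nlinarith
  have hcη : c * η ≤ 1 / 2 * c := by nlinarith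
  have hKη : K * η ≤ c / 4 := by linarith
  have hw0 : w ≤ 1 / 4 * c := by linarith
  have hsum : D' + α * V' + β * H' + s' ≤ (1 - c * η + w) * D
      + (α * (1 - c) + K + β * K + w) * V + (β * (1 - c) + K + K * η + w) * H
      + (1 - c + K * η + w) * s := by
    have j2 := mul_le_mul_of_nonneg_left i2 (zero_le_one.trans hα1)
    have j3 := mul_le_mul_of_nonneg_left i3 (zero_le_one.trans hβ1)
    rw [hw]
    linarith
  refine hsum.trans ?_
  have c1 : 1 - c * η + w ≤ 1 - c * η / 2 := by linarith
  have c2 : α * (1 - c) + K + β * K + w ≤ (1 - c * η / 2) * α := by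
    have : α * (c * η) ≤ α * (1 / 2 * c) := mul_le_mul_of_nonneg_left hcη (by linarith)
    have : 0 ≤ β * K := by positivity
    linarith
  have c3 : β * (1 - c) + K + K * η + w ≤ (1 - c * η / 2) * β := by
    have : β * (c * η) ≤ β * (1 / 2 * c) := mul_le_mul_of_nonneg_left hcη (by linarith)
    linarith
  have c4 : 1 - c + K * η + w ≤ 1 - c * η / 2 := by linarith
  have d1 := mul_le_mul_of_nonneg_right c1 hD
  have d2 := mul_le_mul_of_nonneg_right c2 hV
  have d3 := mul_le_mul_of_nonneg_right c3 hH
  have d4 := mul_le_mul_of_nonneg_right c4 hs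
  linarith

end Scalar

/-! ### From geometric decay in mean to almost sure convergence. -/

section Limit

/-- The expectations are summable, so by Tonelli the series `∑ t, Q t` is finite almost surely and
its terms tend to zero. -/
lemma ae_tendsto_zero_of_integral_le_geometric {Ω : Type*} [MeasurableSpace Ω] {P : Measure Ω}
    {Q : ℕ → Ω → ℝ} (hQ : ∀ t ω, 0 ≤ Q t ω) (hi : ∀ t, Integrable (Q t) P) {K ρ : ℝ} (hρ : 0 ≤ ρ)
    (hρ1 : ρ < 1) (hle : ∀ t, ∫ ω, Q t ω ∂P ≤ K * ρ ^ t) :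
    ∀ᵐ ω ∂P, Tendsto (fun t => Q t ω) atTop (𝓝 0) := by
  have hm : ∀ t, AEMeasurable (fun ω => ENNReal.ofReal (Q t ω)) P := fun t =>
    (hi t).aemeasurable.ennreal_ofReal
  have hK : 0 ≤ K := by simpa using (integral_nonneg (hQ 0)).trans (hle 0)
  have hfin : ∫⁻ ω, ∑' t, ENNReal.ofReal (Q t ω) ∂P ≠ ⊤ := by
    rw [lintegral_tsum hm]
    have h1 : ∀ t, ∫⁻ ω, ENNReal.ofReal (Q t ω) ∂P ≤ ENNReal.ofReal (K * ρ ^ t) := fun t => by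
      rw [← ofReal_integral_eq_lintegral_ofReal (hi t) (Eventually.of_forall (hQ t))]
      exact ENNReal.ofReal_le_ofReal (hle t)
    refine ne_top_of_le_ne_top ?_ (ENNReal.tsum_le_tsum h1)
    exact ((summable_geometric_of_lt_one hρ hρ1).mul_left K).tsum_ofReal_ne_top
  filter_upwards [ae_lt_top' (AEMeasurable.tsum hm) hfin] with ω hω
  have h2 := ENNReal.tendsto_atTop_zero_of_tsum_ne_top hω.ne
  have h3 := (ENNReal.tendsto_toReal ENNReal.zero_ne_top).comp h2
  simpa [Function.comp_def, ENNReal.toReal_ofReal (hQ _ ω)] using h3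

end Limit

/-! ### Choice of constants and geometric decay of the errors. -/

section Main

/-- A bound on a sequence of four errors from a coupled system of one-step inequalities. -/
lemma geometric_of_coupled {α β r Ψ₀ : ℝ} {D V H T : ℕ → ℝ} {M : ℝ} (hα : 1 ≤ α) (hβ : 1 ≤ β)
    (hr : 0 ≤ r) (hM : 1 ≤ M) (hD : ∀ t, 0 ≤ D t) (hV : ∀ t, 0 ≤ V t) (hH : ∀ t, 0 ≤ H t)
    (Q : ℕ → ℝ → Prop) (hQT : ∀ t a, 0 ≤ a → Q t a → T t ≤ M * a) {a₀ : ℝ} (ha₀ : 0 ≤ a₀)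
    (hQ₀ : Q 0 a₀) (hΨ₀ : D 0 + α * V 0 + β * H 0 + a₀ ≤ Ψ₀)
    (hstep : ∀ t a, 0 ≤ a → Q t a → ∃ a', 0 ≤ a' ∧ Q (t + 1) a' ∧
      D (t + 1) + α * V (t + 1) + β * H (t + 1) + a' ≤ r * (D t + α * V t + β * H t + a)) (t : ℕ) :
    D t ≤ Ψ₀ * r ^ t ∧ V t ≤ Ψ₀ * r ^ t ∧ H t ≤ Ψ₀ * r ^ t ∧ T t ≤ M * (Ψ₀ * r ^ t) := by
  -- The tracker constant `a` is a valid bound rather than a function of the state, so the induction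
  -- carries its existence.
  have key : ∀ t, ∃ a, 0 ≤ a ∧ Q t a ∧ D t + α * V t + β * H t + a ≤ Ψ₀ * r ^ t := fun t => by
    induction t with
    | zero => exact ⟨a₀, ha₀, hQ₀, by simpa using hΨ₀⟩
    | succ t ih =>
      obtain ⟨a, ha, hQ, hle⟩ := ih
      obtain ⟨a', ha', hQ', hle'⟩ := hstep t a ha hQ
      refine ⟨a', ha', hQ', hle'.trans ?_⟩
      rw [pow_succ, ← mul_assoc, mul_comm r]
      exact mul_le_mul_of_nonneg_right hle hr
  obtain ⟨a, ha, hQ, hle⟩ := key t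
  have h1 := hD t; have h2 := hV t; have h3 := hH t
  have h4 : V t ≤ α * V t := le_mul_of_one_le_left h2 hα
  have h5 : H t ≤ β * H t := le_mul_of_one_le_left h3 hβ
  refine ⟨by linarith, by linarith, by linarith, (hQT t a ha hQ).trans ?_⟩
  exact mul_le_mul_of_nonneg_left (by linarith) (by linarith)

/-- Constants for which the one-step inequalities of the expected errors contract. -/
lemma exists_uniform_constants {κ κB M K₀ L θ₁ θ₂ θ₃ lam : ℝ} (hκ : 0 < κ) (hκB : 0 < κB)
    (hM : 1 ≤ M) (hK₀ : 0 ≤ K₀) (h1 : 0 < θ₁) (h2 : 0 < θ₂) (h3 : 0 < θ₃) (hlam : 0 < lam) :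
    ∃ α β c ηbar : ℝ, 1 ≤ α ∧ 1 ≤ β ∧ 0 < c ∧ c ≤ 1 ∧ 0 < ηbar ∧ ηbar ≤ 1 ∧
      ∀ η : ℝ, 0 < η → η ≤ ηbar → ∀ D V H Y T W a D' V' H' : ℝ, 0 ≤ D → 0 ≤ V → 0 ≤ H → 0 ≤ a →
        Y ≤ V / κ → T ≤ M * a → W = D + Y + T + H →
        V' ≤ (1 + θ₁) * (1 - 2 * θ₁) * V + (1 + 1 / θ₁) * η ^ 2 * K₀ * W →
        H' ≤ (1 + θ₃) * (1 - 2 * θ₃) * H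
          + (1 + 1 / θ₃) * L ^ 2 * (M * (6 * Y + 3 * η ^ 2 * (K₀ * W))) →
        D' ≤ (1 - η * lam) * D + η / lam * ((6 * M + 3) * H + 6 * M * L ^ 2 * Y + 3 * T)
          + 2 * M * Y + 2 * η ^ 2 * (K₀ * W) →
        ∃ a', 0 ≤ a' ∧
          (1 + θ₂) * (1 - 2 * θ₂) * a + (1 + 1 / θ₂) * (4 * M ^ 3 / κB) * H ≤ a' ∧
          D' + α * V' + β * H' + a' ≤ (1 - c * η / 2) * (D + α * V + β * H + a) := by
  obtain ⟨K₅, hK₅def⟩ : ∃ K₅, K₅ = 1 / κ + M + 1 := ⟨_, rfl⟩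
  have hK₅ : 0 ≤ K₅ := by rw [hK₅def]; positivity
  obtain ⟨k₁, hk₁⟩ : ∃ k, k = (1 + 1 / θ₁) * (K₀ * K₅) := ⟨_, rfl⟩
  obtain ⟨k₂, hk₂⟩ : ∃ k, k = (1 + 1 / θ₃) * L ^ 2 * M * (6 / κ) := ⟨_, rfl⟩
  obtain ⟨k₃, hk₃⟩ : ∃ k, k = (1 + 1 / θ₃) * L ^ 2 * M * (3 * (K₀ * K₅)) := ⟨_, rfl⟩
  obtain ⟨k₄, hk₄⟩ : ∃ k, k = 6 * M * L ^ 2 / (lam * κ) + 2 * M / κ := ⟨_, rfl⟩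
  obtain ⟨k₅, hk₅⟩ : ∃ k, k = (6 * M + 3) / lam := ⟨_, rfl⟩
  obtain ⟨k₆, hk₆⟩ : ∃ k, k = 3 * M / lam := ⟨_, rfl⟩
  obtain ⟨k₇, hk₇⟩ : ∃ k, k = 2 * (K₀ * K₅) := ⟨_, rfl⟩
  obtain ⟨k₈, hk₈⟩ : ∃ k, k = (1 + 1 / θ₂) * (4 * M ^ 3 / κB) := ⟨_, rfl⟩
  have n1 : 0 ≤ k₁ := by rw [hk₁]; positivity
  have n2 : 0 ≤ k₂ := by rw [hk₂]; positivity
  have n3 : 0 ≤ k₃ := by rw [hk₃]; positivity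
  have n4 : 0 ≤ k₄ := by rw [hk₄]; positivity
  have n5 : 0 ≤ k₅ := by rw [hk₅]; positivity
  have n6 : 0 ≤ k₆ := by rw [hk₆]; positivity
  have n7 : 0 ≤ k₇ := by rw [hk₇]; positivity
  have n8 : 0 ≤ k₈ := by rw [hk₈]; positivity
  -- A single constant dominating every coupling coefficient, free of `η`.
  obtain ⟨K, hK⟩ : ∃ K, K = 1 + k₁ + k₂ + k₃ + k₄ + k₅ + k₆ + k₇ + k₈ := ⟨_, rfl⟩
  obtain ⟨c, hc, hc1, hcθ₁, hcθ₂, hcθ₃, hclam⟩ :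
      ∃ c, 0 < c ∧ c ≤ 1 ∧ c ≤ θ₁ ∧ c ≤ θ₂ ∧ c ≤ θ₃ ∧ c ≤ lam :=
    ⟨min 1 (min θ₁ (min θ₂ (min θ₃ lam))), by positivity, by simp, by simp, by simp, by simp,
      by simp⟩
  obtain ⟨α, β, ηbar, hα, hβ, hηbar, hηbar1, hsys⟩ :=
    exists_contracting_weights (K := K) (by linarith) hc hc1
  refine ⟨α, β, c, ηbar, hα, hβ, hc, hc1, hηbar, hηbar1, ?_⟩
  intro η hη hηle D V H Y T W a D' V' H' hD hV hH ha hY hTa hW r1 r2 r3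
  have hη1 : η ≤ 1 := hηle.trans hηbar1
  -- With `2 θ` the available gap, Young's inequality costs at most half of it.
  have hθ : ∀ θ, 0 < θ → c ≤ θ → (1 + θ) * (1 - 2 * θ) ≤ 1 - c := fun θ h h' => by
    have : 0 ≤ θ ^ 2 := sq_nonneg θ
    linarith
  have hWle : W ≤ K₅ * (D + V + H + a) := by
    have q1 : 0 ≤ (M + 1 / κ) * D := by positivity
    have q2 : 0 ≤ (M + 1) * V := by positivity
    have q3 : 0 ≤ (M + 1 / κ) * H := by positivity
    have q4 : 0 ≤ (1 + 1 / κ) * a := by positivity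
    have q5 : V / κ = 1 / κ * V := by ring
    rw [hW, hK₅def]
    linarith
  obtain ⟨w, hw⟩ : ∃ w, w = D + V + H + a := ⟨_, rfl⟩
  rw [← hw] at hWle
  have hw0 : 0 ≤ w := by rw [hw]; positivity
  have hKW : K₀ * W ≤ K₀ * K₅ * w := by
    rw [mul_assoc]; exact mul_le_mul_of_nonneg_left hWle hK₀
  have hηw : 0 ≤ η ^ 2 * w := by positivity
  refine ⟨(1 - c) * a + K * H,
    add_nonneg (mul_nonneg (by linarith) ha) (mul_nonneg (by linarith) hH), ?_, ?_⟩
  · have e2 := mul_le_mul_of_nonneg_right (hθ θ₂ h2 hcθ₂) ha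
    rw [← hk₈]
    have e3 : k₈ * H ≤ K * H := mul_le_mul_of_nonneg_right (by linarith) hH
    exact add_le_add e2 e3
  · refine hsys η hη hηle D V H a _ _ _ _ hD hV hH ha ?_ ?_ ?_ le_rfl
    · rw [← hw]
      refine r3.trans ?_
      have e1 : (1 - η * lam) * D ≤ (1 - c * η) * D :=
        mul_le_mul_of_nonneg_right (by linarith [mul_le_mul_of_nonneg_left hclam hη.le]) hD
      have e2 : η / lam * ((6 * M + 3) * H + 6 * M * L ^ 2 * Y + 3 * T)
          + 2 * M * Y ≤ k₄ * V + η * k₅ * H + η * k₆ * a := by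
        have f1 : 6 * M * L ^ 2 * Y ≤ 6 * M * L ^ 2 * (V / κ) := by gcongr
        have f2 : η / lam * ((6 * M + 3) * H + 6 * M * L ^ 2 * Y + 3 * T)
            ≤ η / lam * ((6 * M + 3) * H + 6 * M * L ^ 2 * (V / κ) + 3 * (M * a)) := by
          gcongr
        have f3 : η / lam * ((6 * M + 3) * H + 6 * M * L ^ 2 * (V / κ) + 3 * (M * a))
            = η * k₅ * H + η * (6 * M * L ^ 2 / (lam * κ) * V) + η * k₆ * a := by
          rw [hk₅, hk₆]; field_simp
        have f4 : η * (6 * M * L ^ 2 / (lam * κ) * V) ≤ 6 * M * L ^ 2 / (lam * κ) * V :=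
          mul_le_of_le_one_left (by positivity) hη1
        have f5 : 2 * M * Y ≤ 2 * M * (V / κ) := by gcongr
        have f6 : 2 * M * (V / κ) = 2 * M / κ * V := by ring
        have f7 : k₄ * V = 6 * M * L ^ 2 / (lam * κ) * V + 2 * M / κ * V := by
          rw [hk₄]; ring
        linarith
      have e3 : 2 * η ^ 2 * (K₀ * W) ≤ k₇ * (η ^ 2 * w) := by
        have := mul_le_mul_of_nonneg_left hKW (show 0 ≤ 2 * η ^ 2 by positivity)
        rw [hk₇]; linarith
      have g1 : k₄ * V ≤ K * V := mul_le_mul_of_nonneg_right (by linarith) hV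
      have g2 : k₅ * (η * H) ≤ K * (η * H) :=
        mul_le_mul_of_nonneg_right (by linarith) (by positivity)
      have g3 : k₆ * (η * a) ≤ K * (η * a) :=
        mul_le_mul_of_nonneg_right (by linarith) (by positivity)
      have g4 : k₇ * (η ^ 2 * w) ≤ K * (η ^ 2 * w) :=
        mul_le_mul_of_nonneg_right (by linarith) hηw
      linarith
    · rw [← hw]
      refine r1.trans ?_
      have e2 := mul_le_mul_of_nonneg_right (hθ θ₁ h1 hcθ₁) hV
      have e3 : (1 + 1 / θ₁) * η ^ 2 * K₀ * W ≤ k₁ * (η ^ 2 * w) := by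
        have := mul_le_mul_of_nonneg_left hKW (show 0 ≤ (1 + 1 / θ₁) * η ^ 2 by positivity)
        rw [hk₁]; linarith
      have g4 : k₁ * (η ^ 2 * w) ≤ K * (η ^ 2 * w) :=
        mul_le_mul_of_nonneg_right (by linarith) hηw
      rw [mul_assoc K]
      exact add_le_add e2 (e3.trans g4)
    · rw [← hw]
      refine r2.trans ?_
      have e2 := mul_le_mul_of_nonneg_right (hθ θ₃ h3 hcθ₃) hH
      have e3 : (1 + 1 / θ₃) * L ^ 2 * (M * (6 * Y + 3 * η ^ 2 * (K₀ * W)))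
          ≤ k₂ * V + k₃ * (η ^ 2 * w) := by
        have f1 : 6 * Y + 3 * η ^ 2 * (K₀ * W)
            ≤ 6 * (V / κ) + 3 * η ^ 2 * (K₀ * K₅ * w) := by gcongr
        have f2 : (1 + 1 / θ₃) * L ^ 2 * (M * (6 * Y + 3 * η ^ 2 * (K₀ * W)))
            ≤ (1 + 1 / θ₃) * L ^ 2 * (M * (6 * (V / κ) + 3 * η ^ 2 * (K₀ * K₅ * w))) := by
          gcongr
        refine f2.trans (le_of_eq ?_)
        rw [hk₂, hk₃]; ring
      have g1 : k₂ * V ≤ K * V := mul_le_mul_of_nonneg_right (by linarith) hV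
      have g4 : k₃ * (η ^ 2 * w) ≤ K * (η ^ 2 * w) :=
        mul_le_mul_of_nonneg_right (by linarith) hηw
      rw [mul_assoc K, add_assoc]
      exact add_le_add e2 (by linarith)

variable {ι : Type*} [Fintype ι] [DecidableEq ι] [Nonempty ι]

omit [DecidableEq ι] in
lemma sum_norm_sub_average_sq_le {E : Type*} [NormedAddCommGroup E] [InnerProductSpace ℝ E]
    (x : ι → E) (y : E) : ∑ i, ‖x i - average x‖ ^ 2 ≤ ∑ i, ‖x i - y‖ ^ 2 := by
  have hM : 0 < (Fintype.card ι : ℝ) := by exact_mod_cast Fintype.card_pos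
  have h1 : ∑ _i : ι, 1 / (Fintype.card ι : ℝ) = 1 := by simp
  have h2 := wvar_le h1 x y
  have e : wmean (fun _ => 1 / (Fintype.card ι : ℝ)) x = average x := by
    rw [wmean, average, Finset.smul_sum]
  rw [wvar, e, ← Finset.mul_sum, ← Finset.mul_sum] at h2
  exact le_of_mul_le_mul_left h2 (by positivity)

omit [DecidableEq ι] in
lemma norm_average_sub_sq_le {E : Type*} [NormedAddCommGroup E] [InnerProductSpace ℝ E]
    (x : ι → E) (y : E) : ‖average x - y‖ ^ 2 ≤ ∑ i, ‖x i - y‖ ^ 2 := by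
  have h1 : ∑ _i : ι, 1 / (Fintype.card ι : ℝ) = 1 := by simp
  have h2 := norm_sum_smul_sq_le_sum (fun _ => 1 / (Fintype.card ι : ℝ)) (fun i => x i - y)
    (fun _ => by positivity) h1.le
  have e : wmean (fun _ => 1 / (Fintype.card ι : ℝ)) x = average x := by
    rw [wmean, average, Finset.smul_sum]
  rwa [wmean_sub_const h1, e] at h2

omit [DecidableEq ι] [Nonempty ι] in
lemma norm_wmean_sub_sq_le {E : Type*} [NormedAddCommGroup E] [InnerProductSpace ℝ E]
    {u : ι → ℝ} (hu : ∀ i, 0 ≤ u i) (hu1 : ∑ i, u i = 1)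
    (x : ι → E) (y : E) : ‖wmean u x - y‖ ^ 2 ≤ ∑ i, ‖x i - y‖ ^ 2 := by
  have h2 := norm_sum_smul_sq_le_sum u (fun i => x i - y) hu hu1.le
  rwa [wmean_sub_const hu1] at h2

omit [DecidableEq ι] [Nonempty ι] in
lemma wvar_le_sum {E : Type*} [NormedAddCommGroup E] [InnerProductSpace ℝ E]
    {u : ι → ℝ} (hu : ∀ i, 0 ≤ u i) (hu1 : ∑ i, u i = 1)
    (x : ι → E) (y : E) : wvar u x ≤ ∑ i, ‖x i - y‖ ^ 2 := by
  refine (wvar_le hu1 x y).trans (Finset.sum_le_sum fun i _ => ?_)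
  refine mul_le_of_le_one_left (sq_nonneg _) ?_
  rw [← hu1]; exact Finset.single_le_sum (fun j _ => hu j) (Finset.mem_univ i)

variable {Ω : Type*} [MeasurableSpace Ω] {P : Measure Ω} [IsProbabilityMeasure P]
  {A B : ℕ → Ω → Matrix ι ι ℝ} {S : ℕ → Ω → Finset ι} {p : ι → ℝ} {δ : ℝ}

/-- Geometric decay of the four errors, uniformly over the objective and the initial state. -/
lemma Environment.exists_geometric_decay (henv : Environment P A B S p δ) {m : ℝ} (hm : 0 < m)
    (L : ℝ≥0) :
    ∃ u : ι → ℝ, (∀ i, 0 ≤ u i) ∧ ∑ i, u i = 1 ∧ ∃ ηbar : ℝ, 0 < ηbar ∧ ∀ η : ℝ, 0 < η → η ≤ ηbar →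
      ∃ C ρ : ℝ, 0 < C ∧ 0 < ρ ∧ ρ < 1 ∧
        ∀ (E : Type) [NormedAddCommGroup E] [InnerProductSpace ℝ E] [CompleteSpace E]
          [MeasurableSpace E] [BorelSpace E] [SecondCountableTopology E] [ProperSpace E]
          (f : ι → E → ℝ), (∀ i, LipschitzWith L (gradient (f i))) →
          ∀ z : E, gradSum f z = 0 →
          (∀ y, m * ‖y - z‖ ^ 2 ≤ inner ℝ (gradSum f y) (y - z)) →
          ∀ s₀ : State ι E, (∑ i, s₀.G i = ∑ i, gradient (f i) (s₀.c i)) → ∀ t,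
            ∫ ω, ‖wmean u (run f η A B S s₀ t ω).x - z‖ ^ 2 ∂P ≤ C * initialError f z s₀ * ρ ^ t ∧
            ∫ ω, spreadSq u (run f η A B S s₀ t ω).x ∂P ≤ C * initialError f z s₀ * ρ ^ t ∧
            ∫ ω, gradientSq f (run f η A B S s₀ t ω) ∂P ≤ C * initialError f z s₀ * ρ ^ t ∧
            ∫ ω, trackingSq (weight B t ω) (run f η A B S s₀ t ω) ∂P
              ≤ C * initialError f z s₀ * ρ ^ t := by
  obtain ⟨u, κ, cA, hA⟩ := exists_spectralGap henv.expMatrix_A_mem henv.primitive_A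
  obtain ⟨v, κB, cB, hB⟩ := exists_spectralGap henv.expMatrix_B_transpose_mem
    (isPrimitive_transpose henv.primitive_B)
  obtain ⟨i₀, hi₀⟩ := Finite.exists_min p
  obtain ⟨j₀, hj₀⟩ := Finite.exists_min fun j => δ * u j * p j
  have hκ := hA.bound_pos
  have hκB := hB.bound_pos
  have hδ := henv.diag_pos
  have hκ' : 0 < δ * u j₀ * p j₀ :=
    mul_pos (mul_pos hδ (hκ.trans_le (hA.bound_le _))) (henv.sampling_pos _)
  have h1 : 0 < δ * cA / 2 := by have := hA.gap_pos; positivity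
  have h2 : 0 < δ * cB / 2 := by have := hB.gap_pos; positivity
  have h3 : 0 < p i₀ / 2 := by have := henv.sampling_pos i₀; positivity
  -- Half of the drift rate `2 m κ'` is spent on the cross term, leaving `1 - η lam`.
  have hlam : 0 < m * (δ * u j₀ * p j₀) := by positivity
  have hM : 1 ≤ (Fintype.card ι : ℝ) := by exact_mod_cast Fintype.card_pos
  have hK₀ : 0 ≤ halfConst ι L := by rw [halfConst]; positivity
  obtain ⟨α, β, c, ηbar, hα, hβ, hc, hc1, hηbar, hηbar1, hsys⟩ :=
    exists_uniform_constants (L := L) hκ hκB hM hK₀ h1 h2 h3 hlam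
  set M : ℝ := (Fintype.card ι : ℝ) with hMdef
  refine ⟨u, hA.nonneg, hA.sum_one, ηbar, hηbar, fun η hη hηle => ?_⟩
  have hη1 : η ≤ 1 := hηle.trans hηbar1
  set C₀ := 4 + α + β + 1 / κB with hC₀def
  have hC₀ : 0 < C₀ := by positivity
  have hcη : c * η ≤ 1 := mul_le_one₀ hc1 hη.le hη1
  have hcη0 : 0 < c * η := by positivity
  -- The prefactor covers all four bounds: `1 / κ` converts variance to spread, `M` converts `a` to
  -- the tracking error, and `1` serves the other two.
  refine ⟨(1 / κ + M + 1) * C₀, 1 - c * η / 2, by positivity, by linarith, by linarith, ?_⟩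
  intro E _ _ _ _ _ _ _ f hL z hz hmono s₀ hs₀
  set X := run f η A B S s₀ with hX
  set D : ℕ → ℝ := fun t => ∫ ω, ‖wmean u (X t ω).x - z‖ ^ 2 ∂P with hDdef
  set V : ℕ → ℝ := fun t => ∫ ω, wvar u (X t ω).x ∂P with hVdef
  set Y : ℕ → ℝ := fun t => ∫ ω, spreadSq u (X t ω).x ∂P with hYdef
  set H : ℕ → ℝ := fun t => ∫ ω, gradientSq f (X t ω) ∂P with hHdef
  set T : ℕ → ℝ := fun t => ∫ ω, trackingSq (weight B t ω) (X t ω) ∂P with hTdef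
  set W : ℕ → ℝ := fun t => ∫ ω, totalErr u f z (weight B t ω) (X t ω) ∂P with hWdef
  have hD0 : ∀ t, 0 ≤ D t := fun t => integral_nonneg fun ω => sq_nonneg _
  have hV0 : ∀ t, 0 ≤ V t := fun t => integral_nonneg fun ω => wvar_nonneg hA.nonneg _
  have hH0 : ∀ t, 0 ≤ H t := fun t => integral_nonneg fun ω => gradientSq_nonneg f _
  have hYV : ∀ t, Y t ≤ V t / κ := fun t => by
    rw [hVdef, ← integral_div]
    exact integral_mono (henv.integrable_stateTuple hL η s₀ t (continuous_spreadSq u))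
      ((henv.integrable_stateTuple hL η s₀ t (continuous_wvar u)).div_const κ)
      fun ω => hA.spreadSq_le _
  have hW : ∀ t, W t = D t + Y t + T t + H t := fun t => by
    have i1 := henv.integrable_stateTuple hL η s₀ t (continuous_norm_sq_wmean_sub u z)
    have i2 := i1.add (henv.integrable_stateTuple hL η s₀ t (continuous_spreadSq u))
    have i3 := i2.add (henv.integrable_stateTuple hL η s₀ t continuous_trackingSq)
    refine (integral_add' i3 (henv.integrable_stateTuple hL η s₀ t
      (continuous_gradientSq hL))).trans ?_
    rw [integral_add' i2 (henv.integrable_stateTuple hL η s₀ t continuous_trackingSq),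
      integral_add' i1 (henv.integrable_stateTuple hL η s₀ t (continuous_spreadSq u))]
    rfl
  set Q : ℕ → ℝ → Prop := fun t a => ∀ y : ι → ℝ,
    ∫ ω, ‖∑ i, y i • trackErr (weight B t ω) (X t ω) i‖ ^ 2 ∂P ≤ a * wvar v y with hQdef
  have hQT : ∀ t a, 0 ≤ a → Q t a → T t ≤ M * a := fun t a ha hQ =>
    integral_trackingSq_le henv hL η hB t ha hQ
  have hI0 : 0 ≤ initialError f z s₀ := by
    have : 0 ≤ consensusSq s₀ := Finset.sum_nonneg fun _ _ => sq_nonneg _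
    have : 0 ≤ distSq z s₀ := sq_nonneg _
    have := gradientSq_nonneg f s₀
    have := trackingSq_nonneg (fun _ => 1 / (Fintype.card ι : ℝ)) s₀
    unfold initialError; positivity
  have hstep : ∀ t a, 0 ≤ a → Q t a → ∃ a', 0 ≤ a' ∧ Q (t + 1) a' ∧
      D (t + 1) + α * V (t + 1) + β * H (t + 1) + a'
        ≤ (1 - c * η / 2) * (D t + α * V t + β * H t + a) := by
    intro t a ha hQ
    have r1 := integral_wvar_succ_le henv hL η hs₀ hA h1 hz t
    have r2 := integral_gradientSq_succ_le henv hL η hs₀ (u := u) h3 hi₀ hz t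
    have r3 := integral_norm_sq_wmean_succ_le henv hL η hs₀ hA hη.le hm.le hlam hj₀ hz hmono t
    have r4 := integral_norm_sq_trackErr_succ_le henv hL η hs₀ hB h2 t ha hQ
    obtain ⟨a', ha', hle, hΨ⟩ := hsys η hη hηle (D t) (V t) (H t) (Y t) (T t) (W t) a
      (D (t + 1)) (V (t + 1)) (H (t + 1))
      (hD0 t) (hV0 t) (hH0 t) ha (hYV t) (hQT t a ha hQ) (hW t)
      (by rwa [mul_div_cancel₀ _ (two_ne_zero' ℝ)]) (by rwa [mul_div_cancel₀ _ (two_ne_zero' ℝ)])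
      (r3.trans_eq (by ring))
    refine ⟨a', ha', fun y => (r4 y).trans
      (mul_le_mul_of_nonneg_right (le_trans (le_of_eq ?_) hle) (wvar_nonneg hB.nonneg y)), hΨ⟩
    rw [mul_div_cancel₀ _ (two_ne_zero' ℝ)]
  set w₀ : ι → ℝ := fun _ => 1 / (Fintype.card ι : ℝ) with hw₀
  -- The initial deviations have zero sum, so Cauchy–Schwarz against the centred test vector gives
  -- this constant, with `κB` converting spread to variance.
  set a₀ := trackingSq w₀ s₀ / κB with ha₀def
  have hT0 := trackingSq_nonneg w₀ s₀
  have ha₀ : 0 ≤ a₀ := by positivity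
  have hconst : ∀ r : ℝ, ∫ _ω : Ω, r ∂P = r := fun r => by simp
  have hQ₀ : Q 0 a₀ := fun y => by
    refine (hconst (‖∑ i, y i • trackErr w₀ s₀ i‖ ^ 2)).le.trans ?_
    have hsum : ∑ i, trackErr w₀ s₀ i = 0 := by
      simp only [trackErr, Finset.sum_sub_distrib, ← Finset.sum_smul, hw₀]
      simp
    refine (norm_sq_sum_smul_le_of_sum_eq_zero hsum (wmean v y)).trans ?_
    have hsp := hB.spreadSq_le y
    have e : ∑ i, (y i - wmean v y) ^ 2 = spreadSq v y :=
      Finset.sum_congr rfl fun i _ => by rw [Real.norm_eq_abs, sq_abs]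
    rw [e]
    calc spreadSq v y * trackingSq w₀ s₀ ≤ wvar v y / κB * trackingSq w₀ s₀ := by gcongr
      _ = _ := by rw [ha₀def]; ring
  have hΨ₀ : D 0 + α * V 0 + β * H 0 + a₀ ≤ C₀ * initialError f z s₀ := by
    have eD : D 0 = ‖wmean u s₀.x - z‖ ^ 2 := hconst (‖wmean u s₀.x - z‖ ^ 2)
    have eV : V 0 = wvar u s₀.x := hconst (wvar u s₀.x)
    have eH : H 0 = gradientSq f s₀ := hconst (gradientSq f s₀)
    rw [eD, eV, eH]
    have q1 : ‖wmean u s₀.x - z‖ ^ 2 ≤ 2 * consensusSq s₀ + 2 * distSq z s₀ := by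
      have := norm_add_sq_le_two (wmean u s₀.x - average s₀.x) (average s₀.x - z)
      rw [sub_add_sub_cancel] at this
      have h := norm_wmean_sub_sq_le hA.nonneg hA.sum_one s₀.x (average s₀.x)
      unfold consensusSq distSq
      linarith
    have q2 : wvar u s₀.x ≤ consensusSq s₀ := wvar_le_sum hA.nonneg hA.sum_one _ _
    have q3 := mul_le_mul_of_nonneg_left q2 (zero_le_one.trans hα)
    have p1 : 0 ≤ consensusSq s₀ := Finset.sum_nonneg fun _ _ => sq_nonneg _
    have p2 : 0 ≤ distSq z s₀ := sq_nonneg _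
    have p3 := gradientSq_nonneg f s₀
    have eI : initialError f z s₀ = distSq z s₀ + consensusSq s₀ + trackingSq w₀ s₀
      + gradientSq f s₀ := rfl
    have ea : a₀ = 1 / κB * trackingSq w₀ s₀ := by rw [ha₀def]; ring
    rw [eI, hC₀def, ea]
    have t1 : 0 ≤ (2 + α + β + 1 / κB) * distSq z s₀ := by positivity
    have t2 : 0 ≤ (2 + β + 1 / κB) * consensusSq s₀ := by positivity
    have t3 : 0 ≤ (4 + α + β) * trackingSq w₀ s₀ := by positivity
    have t4 : 0 ≤ (4 + α + 1 / κB) * gradientSq f s₀ := by positivity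
    linarith
  intro t
  have hr : 0 ≤ 1 - c * η / 2 := by linarith
  obtain ⟨b1, b2, b3, b4⟩ :=
    geometric_of_coupled hα hβ hr hM hD0 hV0 hH0 Q hQT ha₀ hQ₀ hΨ₀ hstep t
  set Z := C₀ * initialError f z s₀ * (1 - c * η / 2) ^ t with hZ
  have hZ0 : 0 ≤ Z := by positivity
  have eZ : (1 / κ + M + 1) * C₀ * initialError f z s₀ * (1 - c * η / 2) ^ t
      = 1 / κ * Z + M * Z + Z := by rw [hZ]; ring
  have z1 : 0 ≤ 1 / κ * Z := by positivity
  have z2 : 0 ≤ M * Z := by positivity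
  rw [eZ]
  refine ⟨by linarith, ?_, by linarith, by linarith⟩
  have : V t / κ ≤ 1 / κ * Z := by
    rw [div_eq_mul_one_div, mul_comm]
    exact mul_le_mul_of_nonneg_left b2 (by positivity)
  linarith [hYV t]

end Main

end PPDS

/-! ### From the weighted mean to the quantities of the theorem. -/

theorem mainTheorem1 {ι : Type*} [Fintype ι] [DecidableEq ι] [Nonempty ι]
    {Ω : Type*} [MeasurableSpace Ω] (P : Measure Ω) [IsProbabilityMeasure P]
    (A B : ℕ → Ω → Matrix ι ι ℝ) (S : ℕ → Ω → Finset ι) (p : ι → ℝ) (δ : ℝ)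
    (henv : PPDS.Environment P A B S p δ) (μ : ℝ) (hμ : 0 < μ) (L : ℝ≥0) :
    ∃ ηbar : ℝ, 0 < ηbar ∧ ∀ η : ℝ, 0 < η → η ≤ ηbar →
      ∃ C ρ : ℝ, 0 < C ∧ 0 < ρ ∧ ρ < 1 ∧
        ∀ (d : ℕ) (f : ι → EuclideanSpace ℝ (Fin d) → ℝ),
          (∀ i, ConvexOn ℝ Set.univ (f i)) →
          (∀ i, Differentiable ℝ (f i)) →
          (∀ i, LipschitzWith L (gradient (f i))) →
          StrongConvexOn Set.univ μ (PPDS.objective f) →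
          ∃ xs : EuclideanSpace ℝ (Fin d),
            (∀ y, y ≠ xs → PPDS.objective f xs < PPDS.objective f y) ∧
            ∀ s₀ : PPDS.State ι (EuclideanSpace ℝ (Fin d)),
              (∑ i, s₀.G i = ∑ i, gradient (f i) (s₀.c i)) →
              PPDS.GeomBound P
                (fun t ω => PPDS.distSq xs (PPDS.run f η A B S s₀ t ω))
                (C * PPDS.initialError f xs s₀) ρ ∧
              PPDS.GeomBound P
                (fun t ω => PPDS.objective f (PPDS.average (PPDS.run f η A B S s₀ t ω).x)
                  - PPDS.objective f xs)
                (C * PPDS.initialError f xs s₀) ρ ∧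
              PPDS.GeomBound P
                (fun t ω => PPDS.consensusSq (PPDS.run f η A B S s₀ t ω))
                (C * PPDS.initialError f xs s₀) ρ ∧
              PPDS.GeomBound P
                (fun t ω => PPDS.trackingSq (PPDS.weight B t ω) (PPDS.run f η A B S s₀ t ω))
                (C * PPDS.initialError f xs s₀) ρ ∧
              PPDS.GeomBound P
                (fun t ω => PPDS.gradientSq f (PPDS.run f η A B S s₀ t ω))
                (C * PPDS.initialError f xs s₀) ρ ∧
              (∀ i, PPDS.GeomBound P
                (fun t ω => ‖(PPDS.run f η A B S s₀ t ω).x i - xs‖ ^ 2)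
                (C * PPDS.initialError f xs s₀) ρ) ∧
              ∀ᵐ ω ∂P, ∀ i,
                Tendsto (fun t => (PPDS.run f η A B S s₀ t ω).x i) atTop (𝓝 xs) := by
  have hM : 0 < (Fintype.card ι : ℝ) := by exact_mod_cast Fintype.card_pos
  obtain ⟨u, hu, hu1, ηbar, hηbar, hdecay⟩ :=
    henv.exists_geometric_decay (m := Fintype.card ι * (μ / 2)) (by positivity) L
  refine ⟨ηbar, hηbar, fun η hη hηle => ?_⟩
  obtain ⟨C, ρ, hC, hρ, hρ1, hbound⟩ := hdecay η hη hηle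
  -- Passing from the weighted mean to the average or to one node costs `2 * spreadSq + 2 * ‖wmean -
  -- z‖²`, hence `4`; the objective gap costs a further factor `L`.
  refine ⟨(4 + 4 * L) * C, ρ, by positivity, hρ, hρ1, fun d f _ hdiff hL hF => ?_⟩
  obtain ⟨z, hmin, hz, hmono, hgap⟩ := PPDS.exists_minimizer hμ hdiff hL hF
  refine ⟨z, hmin, fun s₀ hs₀ => ?_⟩
  have hb := hbound (EuclideanSpace ℝ (Fin d)) f hL z hz hmono s₀ hs₀
  have hcont := PPDS.hasGradientAt_objective hdiff
  have hFc : Continuous (PPDS.objective f) :=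
    continuous_iff_continuousAt.2 fun y => (hcont y).continuousAt
  set X := PPDS.run f η A B S s₀ with hX
  set I := PPDS.initialError f z s₀ with hI
  have hint := fun t Φ h => henv.integrable_stateTuple hL η s₀ t (Φ := Φ) h
  have hD : ∀ t, Integrable (fun ω => ‖PPDS.wmean u (X t ω).x - z‖ ^ 2) P :=
    fun t => hint t _ (PPDS.continuous_norm_sq_wmean_sub u z)
  have hY : ∀ t, Integrable (fun ω => PPDS.spreadSq u (X t ω).x) P :=
    fun t => hint t _ (PPDS.continuous_spreadSq u)
  have hb0 : ∀ t, 0 ≤ C * I * ρ ^ t := fun t =>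
    (integral_nonneg fun ω => sq_nonneg _).trans (hb t).1
  have hLb : ∀ t, 0 ≤ (L : ℝ) * (C * I * ρ ^ t) := fun t => mul_nonneg L.2 (hb0 t)
  have eC : ∀ t, (4 + 4 * L) * C * I * ρ ^ t = 4 * (C * I * ρ ^ t) + 4 * (L * (C * I * ρ ^ t)) :=
    fun t => by ring
  have hDY : ∀ t, ∫ ω, (2 * PPDS.spreadSq u (X t ω).x + 2 * ‖PPDS.wmean u (X t ω).x - z‖ ^ 2) ∂P
      ≤ 4 * (C * I * ρ ^ t) := fun t => by
    rw [integral_add ((hY t).const_mul 2) ((hD t).const_mul 2), integral_const_mul,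
      integral_const_mul]
    linarith [(hb t).1, (hb t).2.1]
  have hDYi : ∀ t, Integrable (fun ω => 2 * PPDS.spreadSq u (X t ω).x
      + 2 * ‖PPDS.wmean u (X t ω).x - z‖ ^ 2) P := fun t =>
    ((hY t).const_mul 2).add ((hD t).const_mul 2)
  have hdist_le : ∀ t ω, PPDS.distSq z (X t ω) ≤ 2 * PPDS.spreadSq u (X t ω).x
      + 2 * ‖PPDS.wmean u (X t ω).x - z‖ ^ 2 := fun t ω => by
    have h1 := PPDS.norm_add_sq_le_two (PPDS.average (X t ω).x - PPDS.wmean u (X t ω).x)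
      (PPDS.wmean u (X t ω).x - z)
    rw [sub_add_sub_cancel] at h1
    have h2 := PPDS.norm_average_sub_sq_le (X t ω).x (PPDS.wmean u (X t ω).x)
    unfold PPDS.distSq PPDS.spreadSq
    linarith
  have hnode_le : ∀ t ω i, ‖(X t ω).x i - z‖ ^ 2 ≤ 2 * PPDS.spreadSq u (X t ω).x
      + 2 * ‖PPDS.wmean u (X t ω).x - z‖ ^ 2 := fun t ω i => by
    have h1 := PPDS.norm_add_sq_le_two ((X t ω).x i - PPDS.wmean u (X t ω).x)
      (PPDS.wmean u (X t ω).x - z)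
    rw [sub_add_sub_cancel] at h1
    have h2 : ‖(X t ω).x i - PPDS.wmean u (X t ω).x‖ ^ 2 ≤ PPDS.spreadSq u (X t ω).x :=
      Finset.single_le_sum (f := fun i => ‖(X t ω).x i - PPDS.wmean u (X t ω).x‖ ^ 2)
        (fun j _ => sq_nonneg _) (Finset.mem_univ i)
    linarith
  have hdist_i : ∀ t, Integrable (fun ω => PPDS.distSq z (X t ω)) P := fun t =>
    hint t (fun q => ‖PPDS.average q.1 - z‖ ^ 2) (by unfold PPDS.average; fun_prop)
  have hdist : ∀ t, ∫ ω, PPDS.distSq z (X t ω) ∂P ≤ 4 * (C * I * ρ ^ t) := fun t =>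
    (integral_mono (hdist_i t) (hDYi t) (hdist_le t)).trans (hDY t)
  have hnode_i : ∀ t i, Integrable (fun ω => ‖(X t ω).x i - z‖ ^ 2) P := fun t i =>
    hint t (fun q => ‖q.1 i - z‖ ^ 2) (by fun_prop)
  have hnode : ∀ i t, ∫ ω, ‖(X t ω).x i - z‖ ^ 2 ∂P ≤ (4 + 4 * L) * C * I * ρ ^ t := fun i t => by
    rw [eC]
    refine ((integral_mono (hnode_i t i) (hDYi t) fun ω => hnode_le t ω i).trans (hDY t)).trans ?_
    linarith [hLb t]
  refine ⟨fun t => ⟨hdist_i t, ?_⟩, fun t => ?_, fun t => ?_, fun t => ?_, fun t => ?_,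
    fun i t => ⟨hnode_i t i, hnode i t⟩, ?_⟩
  · rw [eC]; linarith [hdist t, hLb t]
  · have hi : Integrable (fun ω => PPDS.objective f (PPDS.average (X t ω).x)
        - PPDS.objective f z) P :=
      hint t (fun q => PPDS.objective f (PPDS.average q.1) - PPDS.objective f z)
        (by unfold PPDS.average; fun_prop)
    refine ⟨hi, ?_⟩
    have h1 := integral_mono hi ((hdist_i t).const_mul L) fun ω => hgap (PPDS.average (X t ω).x)
    rw [integral_const_mul] at h1
    have h2 := mul_le_mul_of_nonneg_left (hdist t) L.2
    change (L : ℝ) * _ ≤ L * _ at h2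
    rw [eC]
    linarith [hb0 t]
  · have hi : Integrable (fun ω => PPDS.consensusSq (X t ω)) P :=
      hint t (fun q => ∑ i, ‖q.1 i - PPDS.average q.1‖ ^ 2) (by unfold PPDS.average; fun_prop)
    refine ⟨hi, ?_⟩
    rw [eC]
    have h1 := integral_mono hi (hY t) fun ω => PPDS.sum_norm_sub_average_sq_le (X t ω).x
      (PPDS.wmean u (X t ω).x)
    linarith [(hb t).2.1, hb0 t, hLb t]
  · refine ⟨hint t _ PPDS.continuous_trackingSq, ?_⟩
    rw [eC]
    linarith [(hb t).2.2.2, hb0 t, hLb t]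
  · refine ⟨hint t _ (PPDS.continuous_gradientSq hL), ?_⟩
    rw [eC]
    linarith [(hb t).2.2.1, hb0 t, hLb t]
  · refine ae_all_iff.2 fun i => ?_
    filter_upwards [PPDS.ae_tendsto_zero_of_integral_le_geometric
      (Q := fun t ω => ‖(X t ω).x i - z‖ ^ 2) (fun t ω => sq_nonneg _) (fun t => hnode_i t i) hρ.le
      hρ1 (hnode i)] with ω hω
    rw [tendsto_iff_norm_sub_tendsto_zero]
    have h1 := hω.sqrt
    simpa using h1
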